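/- Let $n\ge 0$ be an integer, $G=SO(n)$, $N=n(n-1)/2$, and let $M=T^*G$ be the cotangent bundle, a $2N$-dimensional manifold with its canonical Poisson bracket $\{f,h\}=\Pi(df,dh)$. For $L\subseteq T^*_mM$ put $L^\angle=\{u\in T_m^*M:\Pi(u,w)=0\ \forall w\in L\}$. For a skew-symmetric matrix $A$ let $V^L_A(X)=XA$ and $V^R_A(X)=AX$ be the left- and right-invariant vector fields on $G$, and let $P^L_{ij}(X,p)=\langle p,V^L_{D^{ij}}(X)\rangle$, $P^R_{ij}(X,p)=\langle p,V^R_{D^{ij}}(X)\rangle$, where $D^{ij}_{kl}=\delta_{ki}\delta_{lj}-\delta_{kj}\delta_{li}$; let $P^L=(P^L_{ij})$ be the corresponding skew-symmetric matrix of functions on $M$. Let $\lambda_1,\dots,\lambda_n>0$, let $\mu_1,\dots,\mu_u$ be the distinct values among the $\lambda_i$, and let $q_k$ be the number of indices $i$ with $\lambda_i=\mu_k$. Let $d(q)$ be the number of odd $q_k$, and put $z^\lambda=[n/2]+\sum_{k=1}^u[q_k/2]$. Let $$B^\lambda=\{P^L_{ij}: i<j,\ \lambda_i=\lambda_j\}\cup\{P^R_{ij}: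 i<j\}.$$ For a skew-symmetric matrix $A$ of size $q$ with $\det(tE-A)=t^q+C_1(A)t^{q-2}+C_2(A)t^{q-4}+\cdots$, the standard Casimir functions are $C_1,\dots,C_{[q/2]}$. Let $\bar C$ be the set of standard Casimir functions of the matrix $P^L$, and let $C^{L\lambda}$ be the set of all standard Casimir functions of the diagonal blocks $(P^L_{ij})_{\lambda_i=\lambda_j=\mu_k}$, $k=1,\dots,u$. Put $Z^\lambda=\bar C\cup C^{L\lambda}$ if $u>1$ and $Z^\lambda=\bar C$ if $u\le 1$. For a finite set $F$ of smooth functions on $M$ whose rank (the dimension of the image of the derivative of the map $F$) is the same almost everywhere, the centrality $k(F)$ is the maximal number $k$ of smooth functions $Z_1,\dots,Z_k$ on $M$ such that each $Z_j$ is a function of the elements of $F$, the differentials $dZ_1,\dots,dZ_k$ are linearly independent almost everywhere on $M$, and $\{Z_j,f\}=0$ on $M$ for all $j$ and all $f\in F$; the defect of integrability is $r(F)=2N-\operatorname{rank}F-k(F)$. Then, almost everywhere in $M$, $$\mathrm{Span}\,dZ^\lambda=\mathrm{Span}\,dB^\lambda\cap(\mathrm{Span}\,dB^\lambda)^\angle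 .$$ Moreover, if $u>1$, then almost everywhere in $M$ $$\operatorname{rank}B^\lambda=2N-\sum_{i<j}q_iq_j=\tfrac12\Bigl(n^2-2n+\sum_{i=1}^uq_i^2\Bigr),$$ and $$k(B^\lambda)=z^\lambda=[n/2]+\sum_{i=1}^u[q_i/2]=n-\Bigl[\tfrac{d(q)+1}2\Bigr],$$ $$r(B^\lambda)=\sum_{i<j}q_iq_j-z^\lambda=\tfrac12\Bigl(n^2-2n-\sum_{i=1}^uq_i^2\Bigr)+\Bigl[\tfrac{d(q)+1}2\Bigr].$$ -/

import Mathlib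

open scoped Manifold ContDiff Matrix

noncomputable section

/-! ### Skew-symmetric matrices and their coordinates -/

/-- The index pairs `(i, j)` with `i < j`; there are `N = n (n - 1) / 2` of them. -/
abbrev SOPair (n : ℕ) : Type := {p : Fin n × Fin n // p.1 < p.2}

/-- The model space `ℝ^N` of `SO(n)`: coordinates of a skew-symmetric matrix with respect to the
basis `D^{ij}`, `i < j`, of `so(n)`. -/
abbrev SOModel (n : ℕ) : Type := SOPair n → ℝ

/-- The group `SO(n)` of orthogonal `n × n` matrices of determinant one. -/
abbrev SOGroup (n : ℕ) : Type := Matrix.specialOrthogonalGroup (Fin n) ℝ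

/-- The skew-symmetric matrix `∑_{i<j} a_{ij} D^{ij}`. -/
def skewMat {n : ℕ} (a : SOModel n) : Matrix (Fin n) (Fin n) ℝ :=
  Matrix.of fun i j =>
    if h : i < j then a ⟨(i, j), h⟩ else if h : j < i then -a ⟨(j, i), h⟩ else 0

/-- The coordinates `(A_{ij})_{i<j}` of a (skew-symmetric) matrix `A`. -/
def skewCoord {n : ℕ} (A : Matrix (Fin n) (Fin n) ℝ) : SOModel n :=
  fun p => A p.1.1 p.1.2

/-- The matrix `D^{ij}`, with `D^{ij}_{kl} = δ_{ki} δ_{lj} - δ_{kj} δ_{li}`. -/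
def basisD {n : ℕ} (i j : Fin n) : Matrix (Fin n) (Fin n) ℝ :=
  Matrix.single i j 1 - Matrix.single j i 1

theorem skewMat_transpose {n : ℕ} (a : SOModel n) : (skewMat a)ᵀ = -skewMat a := by
  ext i j
  rcases lt_trichotomy i j with h | h | h
  · simp [skewMat, h, h.not_gt]
  · subst h; simp [skewMat]
  · simp [skewMat, h, h.not_gt]

theorem skewCoord_skewMat {n : ℕ} (a : SOModel n) : skewCoord (skewMat a) = a := by
  funext p
  simp [skewCoord, skewMat, p.2]

theorem skewMat_skewCoord {n : ℕ} {A : Matrix (Fin n) (Fin n) ℝ} (hA : Aᵀ = -A) :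
    skewMat (skewCoord A) = A := by
  ext i j
  have hij : ∀ i j, A j i = -A i j := fun i j => congrFun (congrFun hA i) j
  rcases lt_trichotomy i j with h | h | h
  · simp [skewMat, skewCoord, h]
  · subst h
    have := hij i i
    simp only [skewMat, lt_irrefl, dite_false, Matrix.of_apply]
    linarith
  · have := hij i j
    simp only [skewMat, skewCoord, h, h.not_gt, dite_true, dite_false, Matrix.of_apply]
    linarith

/-! ### The manifold structure of `SO(n)`

The chart centred at `X₀` is the inverse of `a ↦ X₀ cay(A)`, where `A = skewMat a` and
`cay(A) = (1 - A/2)⁻¹ (1 + A/2) = 1 + A + O(A²)` is the Cayley map. -/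

/-- The Cayley map `A ↦ (1 - A/2)⁻¹ (1 + A/2)`. -/
def cayleyMat {n : ℕ} (a : SOModel n) : Matrix (Fin n) (Fin n) ℝ :=
  (1 - (1 / 2 : ℝ) • skewMat a)⁻¹ * (1 + (1 / 2 : ℝ) • skewMat a)

/-- The inverse `Y ↦ 2 (Y - 1) (1 + Y)⁻¹` of the Cayley map. -/
def cayleyInv {n : ℕ} (Y : Matrix (Fin n) (Fin n) ℝ) : Matrix (Fin n) (Fin n) ℝ :=
  (2 : ℝ) • ((Y - 1) * (1 + Y)⁻¹)

theorem det_one_add_skew_ne_zero {n : ℕ} {A : Matrix (Fin n) (Fin n) ℝ} (hA : Aᵀ = -A) :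
    (1 + A).det ≠ 0 := by
  intro h
  obtain ⟨v, hv, hv0⟩ := Matrix.exists_mulVec_eq_zero_iff.2 h
  have h1 : v ⬝ᵥ (A *ᵥ v) = 0 := by
    have h2 : v ⬝ᵥ (A *ᵥ v) = (Aᵀ *ᵥ v) ⬝ᵥ v := by
      rw [Matrix.dotProduct_mulVec, ← Matrix.mulVec_transpose]
    rw [hA, Matrix.neg_mulVec, neg_dotProduct, dotProduct_comm (A *ᵥ v) v] at h2
    linarith
  rw [Matrix.add_mulVec, Matrix.one_mulVec] at hv0
  have h3 : v ⬝ᵥ v = 0 := by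
    have := congrArg (fun w => v ⬝ᵥ w) hv0
    simpa [dotProduct_add, h1] using this
  exact hv (dotProduct_self_eq_zero.1 h3)

theorem half_skew {n : ℕ} (c : ℝ) (a : SOModel n) :
    (c • skewMat a)ᵀ = -(c • skewMat a) := by
  rw [Matrix.transpose_smul, skewMat_transpose, smul_neg]

theorem isUnit_det_add {n : ℕ} (a : SOModel n) :
    IsUnit (1 + (1 / 2 : ℝ) • skewMat a).det :=
  isUnit_iff_ne_zero.2 (det_one_add_skew_ne_zero (half_skew _ a))

theorem isUnit_det_sub {n : ℕ} (a : SOModel n) :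
    IsUnit (1 - (1 / 2 : ℝ) • skewMat a).det := by
  have h := det_one_add_skew_ne_zero (half_skew (-(1 / 2 : ℝ)) a)
  rw [neg_smul, ← sub_eq_add_neg] at h
  exact isUnit_iff_ne_zero.2 h

theorem transpose_add_half {n : ℕ} (a : SOModel n) :
    (1 + (1 / 2 : ℝ) • skewMat a)ᵀ = 1 - (1 / 2 : ℝ) • skewMat a := by
  rw [Matrix.transpose_add, half_skew, Matrix.transpose_one, sub_eq_add_neg]

theorem transpose_sub_half {n : ℕ} (a : SOModel n) :
    (1 - (1 / 2 : ℝ) • skewMat a)ᵀ = 1 + (1 / 2 : ℝ) • skewMat a := by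
  rw [← transpose_add_half, Matrix.transpose_transpose]

theorem half_comm {n : ℕ} (a : SOModel n) :
    (1 + (1 / 2 : ℝ) • skewMat a) * (1 - (1 / 2 : ℝ) • skewMat a) =
      (1 - (1 / 2 : ℝ) • skewMat a) * (1 + (1 / 2 : ℝ) • skewMat a) := by
  simp only [add_mul, mul_sub, sub_mul, mul_add, one_mul, mul_one]
  abel

theorem cayleyMat_mem {n : ℕ} (a : SOModel n) :
    cayleyMat a ∈ Matrix.specialOrthogonalGroup (Fin n) ℝ := by
  have hp := isUnit_det_add a
  have hm := isUnit_det_sub a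
  rw [Matrix.mem_specialOrthogonalGroup_iff, Matrix.mem_orthogonalGroup_iff]
  constructor
  · change cayleyMat a * (cayleyMat a)ᵀ = 1
    rw [cayleyMat, Matrix.transpose_mul, Matrix.transpose_nonsing_inv, transpose_add_half,
      transpose_sub_half]
    calc _ = (1 - (1 / 2 : ℝ) • skewMat a)⁻¹ *
          ((1 + (1 / 2 : ℝ) • skewMat a) * (1 - (1 / 2 : ℝ) • skewMat a)) *
            (1 + (1 / 2 : ℝ) • skewMat a)⁻¹ := by simp only [Matrix.mul_assoc]
      _ = 1 := by
          rw [half_comm, ← Matrix.mul_assoc, Matrix.nonsing_inv_mul _ hm, Matrix.one_mul,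
            Matrix.mul_nonsing_inv _ hp]
  · rw [cayleyMat, Matrix.det_mul, Matrix.det_nonsing_inv, ← transpose_add_half,
      Matrix.det_transpose]
    exact Ring.inverse_mul_cancel _ hp

theorem one_add_cayleyMat {n : ℕ} (a : SOModel n) :
    1 + cayleyMat a = (2 : ℝ) • (1 - (1 / 2 : ℝ) • skewMat a)⁻¹ := by
  have hm := isUnit_det_sub a
  have h2 : (1 - (1 / 2 : ℝ) • skewMat a) + (1 + (1 / 2 : ℝ) • skewMat a) =
      (2 : ℝ) • (1 : Matrix (Fin n) (Fin n) ℝ) := by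
    rw [two_smul]; abel
  calc 1 + cayleyMat a = (1 - (1 / 2 : ℝ) • skewMat a)⁻¹ *
        ((1 - (1 / 2 : ℝ) • skewMat a) + (1 + (1 / 2 : ℝ) • skewMat a)) := by
          rw [Matrix.mul_add, Matrix.nonsing_inv_mul _ hm, cayleyMat]
    _ = _ := by rw [h2, Matrix.mul_smul, Matrix.mul_one]

theorem one_add_cayleyMat_mul {n : ℕ} (a : SOModel n) :
    (1 + cayleyMat a) * ((1 / 2 : ℝ) • (1 - (1 / 2 : ℝ) • skewMat a)) = 1 := by
  rw [one_add_cayleyMat, Matrix.smul_mul, Matrix.mul_smul,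
    Matrix.nonsing_inv_mul _ (isUnit_det_sub a), smul_smul]
  norm_num

theorem det_one_add_cayleyMat {n : ℕ} (a : SOModel n) : (1 + cayleyMat a).det ≠ 0 := by
  intro h
  have := congrArg Matrix.det (one_add_cayleyMat_mul a)
  rw [Matrix.det_mul, h, zero_mul, Matrix.det_one] at this
  exact zero_ne_one this

theorem cayleyInv_cayleyMat {n : ℕ} (a : SOModel n) : cayleyInv (cayleyMat a) = skewMat a := by
  have hm := isUnit_det_sub a
  have h1 : (1 + cayleyMat a)⁻¹ = (1 / 2 : ℝ) • (1 - (1 / 2 : ℝ) • skewMat a) :=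
    Matrix.inv_eq_right_inv (one_add_cayleyMat_mul a)
  have h2 : cayleyMat a - 1 = (1 + cayleyMat a) - (2 : ℝ) • 1 := by
    rw [two_smul]; abel
  rw [cayleyInv, h1, h2, Matrix.sub_mul, one_add_cayleyMat_mul, Matrix.smul_mul, Matrix.one_mul,
    smul_smul, smul_sub, smul_smul, smul_sub, smul_smul]
  norm_num

theorem cayleyInv_transpose {n : ℕ} {Y : Matrix (Fin n) (Fin n) ℝ} (hY : Yᵀ * Y = 1)
    (hd : (1 + Y).det ≠ 0) : (cayleyInv Y)ᵀ = -cayleyInv Y := by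
  have hu : IsUnit (1 + Y).det := isUnit_iff_ne_zero.2 hd
  have hut : IsUnit (1 + Yᵀ).det := by
    rw [← Matrix.transpose_one, ← Matrix.transpose_add, Matrix.det_transpose]; exact hu
  rw [cayleyInv, Matrix.transpose_smul, Matrix.transpose_mul, Matrix.transpose_nonsing_inv,
    Matrix.transpose_sub, Matrix.transpose_add, Matrix.transpose_one, ← smul_neg]
  congr 1
  have key : (Yᵀ - 1) * (1 + Y) = (1 + Yᵀ) * (-(Y - 1)) := by
    have : (Yᵀ - 1) * (1 + Y) - (1 + Yᵀ) * (-(Y - 1)) = (2 : ℝ) • (Yᵀ * Y - 1) := by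
      rw [two_smul]; noncomm_ring
    rw [hY, sub_self, smul_zero] at this
    exact sub_eq_zero.1 this
  calc (1 + Yᵀ)⁻¹ * (Yᵀ - 1)
      = (1 + Yᵀ)⁻¹ * ((Yᵀ - 1) * (1 + Y)) * (1 + Y)⁻¹ := by
        rw [Matrix.mul_assoc, Matrix.mul_assoc, Matrix.mul_nonsing_inv _ hu, Matrix.mul_one]
    _ = -((Y - 1) * (1 + Y)⁻¹) := by
        rw [key, ← Matrix.mul_assoc, Matrix.nonsing_inv_mul _ hut, Matrix.one_mul, Matrix.neg_mul]

theorem cayleyMat_cayleyInv {n : ℕ} {Y : Matrix (Fin n) (Fin n) ℝ} (hY : Yᵀ * Y = 1)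
    (hd : (1 + Y).det ≠ 0) : cayleyMat (skewCoord (cayleyInv Y)) = Y := by
  have hu : IsUnit (1 + Y).det := isUnit_iff_ne_zero.2 hd
  have hm := isUnit_det_sub (skewCoord (cayleyInv Y))
  rw [cayleyMat]
  rw [skewMat_skewCoord (cayleyInv_transpose hY hd)] at hm ⊢
  have hhalf : (1 / 2 : ℝ) • cayleyInv Y = (Y - 1) * (1 + Y)⁻¹ := by
    rw [cayleyInv, smul_smul]; norm_num
  rw [hhalf] at hm ⊢
  have hone : (1 : Matrix (Fin n) (Fin n) ℝ) = (1 + Y) * (1 + Y)⁻¹ :=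
    (Matrix.mul_nonsing_inv _ hu).symm
  have h1 : 1 - (Y - 1) * (1 + Y)⁻¹ = (2 : ℝ) • (1 + Y)⁻¹ := by
    calc 1 - (Y - 1) * (1 + Y)⁻¹ = ((1 + Y) - (Y - 1)) * (1 + Y)⁻¹ := by
          rw [Matrix.sub_mul (1 + Y), ← hone]
      _ = _ := by
          rw [show (1 + Y) - (Y - 1) = (2 : ℝ) • (1 : Matrix (Fin n) (Fin n) ℝ) by
            rw [two_smul]; abel, Matrix.smul_mul, Matrix.one_mul]
  have h2 : 1 + (Y - 1) * (1 + Y)⁻¹ = (2 : ℝ) • (Y * (1 + Y)⁻¹) := by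
    calc 1 + (Y - 1) * (1 + Y)⁻¹ = ((1 + Y) + (Y - 1)) * (1 + Y)⁻¹ := by
          rw [Matrix.add_mul (1 + Y), ← hone]
      _ = _ := by
          rw [show (1 + Y) + (Y - 1) = (2 : ℝ) • Y by rw [two_smul]; abel, Matrix.smul_mul]
  have hcomm : Y * (1 + Y)⁻¹ = (1 + Y)⁻¹ * Y := by
    have h3 : (1 + Y) * Y = Y * (1 + Y) := by noncomm_ring
    calc Y * (1 + Y)⁻¹ = (1 + Y)⁻¹ * ((1 + Y) * Y) * (1 + Y)⁻¹ := by
          rw [← Matrix.mul_assoc, Matrix.nonsing_inv_mul _ hu, Matrix.one_mul]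
      _ = _ := by
          rw [h3, Matrix.mul_assoc, Matrix.mul_assoc, Matrix.mul_nonsing_inv _ hu, Matrix.mul_one]
  have h4 : 1 + (Y - 1) * (1 + Y)⁻¹ = (1 - (Y - 1) * (1 + Y)⁻¹) * Y := by
    rw [h1, h2, hcomm, Matrix.smul_mul]
  rw [h4, ← Matrix.mul_assoc, Matrix.nonsing_inv_mul _ hm, Matrix.one_mul]

theorem SOGroup.transpose_mul_self {n : ℕ} (X : SOGroup n) :
    (X : Matrix (Fin n) (Fin n) ℝ)ᵀ * (X : Matrix (Fin n) (Fin n) ℝ) = 1 :=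
  (Matrix.mem_orthogonalGroup_iff' (Fin n) ℝ).1
    (Matrix.mem_specialOrthogonalGroup_iff.1 X.2).1

theorem SOGroup.mul_transpose_self {n : ℕ} (X : SOGroup n) :
    (X : Matrix (Fin n) (Fin n) ℝ) * (X : Matrix (Fin n) (Fin n) ℝ)ᵀ = 1 :=
  (Matrix.mem_orthogonalGroup_iff (Fin n) ℝ).1
    (Matrix.mem_specialOrthogonalGroup_iff.1 X.2).1

theorem SOGroup.transpose_mul_orth {n : ℕ} (X₀ X : SOGroup n) :
    ((X₀ : Matrix (Fin n) (Fin n) ℝ)ᵀ * (X : Matrix (Fin n) (Fin n) ℝ))ᵀ *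
      ((X₀ : Matrix (Fin n) (Fin n) ℝ)ᵀ * (X : Matrix (Fin n) (Fin n) ℝ)) = 1 := by
  rw [Matrix.transpose_mul, Matrix.transpose_transpose, Matrix.mul_assoc,
    ← Matrix.mul_assoc (X₀ : Matrix (Fin n) (Fin n) ℝ), SOGroup.mul_transpose_self,
    Matrix.one_mul, SOGroup.transpose_mul_self]

/-- A matrix-valued map with `C^k` entries. -/
def EntryContDiffOn {n : ℕ} (k : WithTop ℕ∞) (f : SOModel n → Matrix (Fin n) (Fin n) ℝ)
    (s : Set (SOModel n)) : Prop :=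
  ∀ i j, ContDiffOn ℝ k (fun a => f a i j) s

namespace EntryContDiffOn

variable {n : ℕ} {k : WithTop ℕ∞} {f g : SOModel n → Matrix (Fin n) (Fin n) ℝ}
  {s : Set (SOModel n)}

theorem const (A : Matrix (Fin n) (Fin n) ℝ) : EntryContDiffOn k (fun _ => A) s :=
  fun _ _ => contDiffOn_const

theorem add (hf : EntryContDiffOn k f s) (hg : EntryContDiffOn k g s) :
    EntryContDiffOn k (fun a => f a + g a) s :=
  fun i j => (hf i j).add (hg i j)

theorem sub (hf : EntryContDiffOn k f s) (hg : EntryContDiffOn k g s) :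
    EntryContDiffOn k (fun a => f a - g a) s :=
  fun i j => (hf i j).sub (hg i j)

theorem smul (c : ℝ) (hf : EntryContDiffOn k f s) : EntryContDiffOn k (fun a => c • f a) s :=
  fun i j => contDiffOn_const.mul (hf i j)

theorem mul (hf : EntryContDiffOn k f s) (hg : EntryContDiffOn k g s) :
    EntryContDiffOn k (fun a => f a * g a) s := by
  intro i j
  simp only [Matrix.mul_apply]
  exact ContDiffOn.sum fun l _ => (hf i l).mul (hg l j)

theorem det (hf : EntryContDiffOn k f s) : ContDiffOn ℝ k (fun a => (f a).det) s := by
  simp only [Matrix.det_apply']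
  exact ContDiffOn.sum fun σ _ => contDiffOn_const.mul (contDiffOn_prod fun i _ => hf (σ i) i)

theorem inv (hf : EntryContDiffOn k f s) (h0 : ∀ a ∈ s, (f a).det ≠ 0) :
    EntryContDiffOn k (fun a => (f a)⁻¹) s := by
  intro i j
  simp only [Matrix.inv_def, Ring.inverse_eq_inv', Matrix.smul_apply, smul_eq_mul,
    Matrix.adjugate_apply]
  refine (hf.det.inv h0).mul (EntryContDiffOn.det ?_)
  intro p q
  by_cases hp : p = j
  · subst hp
    simp only [Matrix.updateRow_self]
    exact contDiffOn_const
  · simp only [Matrix.updateRow_ne hp]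
    exact hf p q

end EntryContDiffOn

theorem entryContDiffOn_skewMat {n : ℕ} (k : WithTop ℕ∞) (s : Set (SOModel n)) :
    EntryContDiffOn k (skewMat (n := n)) s := by
  intro i j
  rcases lt_trichotomy i j with h | h | h
  · simp only [skewMat, Matrix.of_apply, h, dite_true]
    exact (contDiff_apply ℝ ℝ _).contDiffOn
  · subst h
    simp only [skewMat, Matrix.of_apply, lt_irrefl, dite_false]
    exact contDiffOn_const
  · simp only [skewMat, Matrix.of_apply, h, h.not_gt, dite_true, dite_false]
    exact (contDiff_apply ℝ ℝ _).neg.contDiffOn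

theorem entryContDiffOn_cayleyMat {n : ℕ} (k : WithTop ℕ∞) (s : Set (SOModel n)) :
    EntryContDiffOn k (cayleyMat (n := n)) s :=
  (((EntryContDiffOn.const 1).sub ((entryContDiffOn_skewMat k s).smul _)).inv
      fun a _ => (isUnit_det_sub a).ne_zero).mul
    ((EntryContDiffOn.const 1).add ((entryContDiffOn_skewMat k s).smul _))

theorem continuous_cayleyMat {n : ℕ} : Continuous (cayleyMat (n := n)) :=
  continuous_matrix fun i j =>
    ((contDiffOn_univ.1 (entryContDiffOn_cayleyMat 0 Set.univ i j))).continuous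

/-- The chart of `SO(n)` centred at `X₀`, with inverse `a ↦ X₀ cay(a)`. -/
def cayleyChart {n : ℕ} (X₀ : SOGroup n) : OpenPartialHomeomorph (SOGroup n) (SOModel n) where
  toFun X := skewCoord (cayleyInv ((X₀ : Matrix (Fin n) (Fin n) ℝ)ᵀ * X))
  invFun a := X₀ * ⟨cayleyMat a, cayleyMat_mem a⟩
  source := {X | (1 + (X₀ : Matrix (Fin n) (Fin n) ℝ)ᵀ * (X : Matrix (Fin n) (Fin n) ℝ)).det ≠ 0}
  target := Set.univ
  map_source' _ _ := Set.mem_univ _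
  map_target' a _ := by
    change (1 + (X₀ : Matrix (Fin n) (Fin n) ℝ)ᵀ *
      ((X₀ : Matrix (Fin n) (Fin n) ℝ) * cayleyMat a)).det ≠ 0
    rw [← Matrix.mul_assoc, SOGroup.transpose_mul_self, Matrix.one_mul]
    exact det_one_add_cayleyMat a
  left_inv' X hX := by
    apply Subtype.ext
    change (X₀ : Matrix (Fin n) (Fin n) ℝ) * cayleyMat (skewCoord (cayleyInv _)) = _
    rw [cayleyMat_cayleyInv (SOGroup.transpose_mul_orth X₀ X) hX, ← Matrix.mul_assoc,
      SOGroup.mul_transpose_self, Matrix.one_mul]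
  right_inv' a _ := by
    change skewCoord (cayleyInv ((X₀ : Matrix (Fin n) (Fin n) ℝ)ᵀ *
      ((X₀ : Matrix (Fin n) (Fin n) ℝ) * cayleyMat a))) = a
    rw [← Matrix.mul_assoc, SOGroup.transpose_mul_self, Matrix.one_mul, cayleyInv_cayleyMat,
      skewCoord_skewMat]
  open_source := by
    refine isOpen_ne_fun ?_ continuous_const
    exact (continuous_const.add (continuous_const.matrix_mul continuous_subtype_val)).matrix_det
  open_target := isOpen_univ
  continuousOn_toFun := by
    refine continuousOn_pi.2 fun p => ?_
    have hY : Continuous fun X : SOGroup n =>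
        (X₀ : Matrix (Fin n) (Fin n) ℝ)ᵀ * (X : Matrix (Fin n) (Fin n) ℝ) :=
      continuous_const.matrix_mul continuous_subtype_val
    have hadj : Continuous fun X : SOGroup n => ((X₀ : Matrix (Fin n) (Fin n) ℝ)ᵀ *
        (X : Matrix (Fin n) (Fin n) ℝ) - 1) *
        (1 + (X₀ : Matrix (Fin n) (Fin n) ℝ)ᵀ * (X : Matrix (Fin n) (Fin n) ℝ)).adjugate :=
      (hY.sub continuous_const).matrix_mul (continuous_const.add hY).matrix_adjugate
    have hdet : Continuous fun X : SOGroup n =>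
        (1 + (X₀ : Matrix (Fin n) (Fin n) ℝ)ᵀ * (X : Matrix (Fin n) (Fin n) ℝ)).det :=
      (continuous_const.add hY).matrix_det
    have := ((hdet.continuousOn (s := {X : SOGroup n | (1 + (X₀ : Matrix (Fin n) (Fin n) ℝ)ᵀ *
      (X : Matrix (Fin n) (Fin n) ℝ)).det ≠ 0})).inv₀ (fun X hX => hX)).mul
      (hadj.matrix_elem p.1.1 p.1.2).continuousOn
    refine ((continuousOn_const (c := (2 : ℝ))).mul this).congr fun X _ => ?_
    simp only [skewCoord, cayleyInv, Matrix.inv_def, Ring.inverse_eq_inv', Matrix.smul_apply,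
      Matrix.mul_smul, smul_eq_mul]
    rfl
  continuousOn_invFun := by
    refine (Continuous.subtype_mk ?_ _).continuousOn
    exact continuous_const.matrix_mul continuous_cayleyMat

theorem mem_cayleyChart_source {n : ℕ} (X : SOGroup n) : X ∈ (cayleyChart X).source := by
  change (1 + (X : Matrix (Fin n) (Fin n) ℝ)ᵀ * (X : Matrix (Fin n) (Fin n) ℝ)).det ≠ 0
  rw [SOGroup.transpose_mul_self]
  have : (1 + 1 : Matrix (Fin n) (Fin n) ℝ) = (2 : ℝ) • 1 := by rw [two_smul]
  rw [this, Matrix.det_smul, Matrix.det_one]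
  simp

instance instChartedSpaceSO (n : ℕ) : ChartedSpace (SOModel n) (SOGroup n) where
  atlas := Set.range cayleyChart
  chartAt := cayleyChart
  mem_chart_source := mem_cayleyChart_source
  chart_mem_atlas X := ⟨X, rfl⟩

instance instIsManifoldSO (n : ℕ) (k : WithTop ℕ∞) :
    IsManifold 𝓘(ℝ, SOModel n) k (SOGroup n) := by
  refine isManifold_of_contDiffOn _ _ _ ?_
  rintro _ _ ⟨X₀, rfl⟩ ⟨X₁, rfl⟩
  simp only [modelWithCornersSelf_coe, modelWithCornersSelf_coe_symm, Function.id_comp,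
    Function.comp_id, Set.range_id, Set.inter_univ, Set.preimage_id]
  have hs : ∀ a ∈ ((cayleyChart X₀).symm.trans (cayleyChart X₁)).source,
      (1 + (X₁ : Matrix (Fin n) (Fin n) ℝ)ᵀ *
        ((X₀ : Matrix (Fin n) (Fin n) ℝ) * cayleyMat a)).det ≠ 0 := by
    intro a ha
    rw [OpenPartialHomeomorph.trans_source] at ha
    exact ha.2
  have hY : EntryContDiffOn k (fun a => (X₁ : Matrix (Fin n) (Fin n) ℝ)ᵀ *
      ((X₀ : Matrix (Fin n) (Fin n) ℝ) * cayleyMat a))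
      ((cayleyChart X₀).symm.trans (cayleyChart X₁)).source :=
    (EntryContDiffOn.const _).mul ((EntryContDiffOn.const _).mul (entryContDiffOn_cayleyMat k _))
  have hI := ((hY.sub (EntryContDiffOn.const 1)).mul
    (((EntryContDiffOn.const 1).add hY).inv hs)).smul 2
  exact contDiffOn_pi.2 fun p => hI p.1.1 p.1.2

/-- The derivative at `a = 0` of the inverse chart `a ↦ cay(a)` at the neutral element is
`a ↦ skewMat a`: the tangent space of `SO(n)` at the neutral element, which is `SOModel n`, is
identified with `so(n)` through `a ↦ ∑_{i<j} a_{ij} D^{ij}`. -/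
theorem hasDerivAt_cayleyMat {n : ℕ} (a : SOModel n) (i j : Fin n) :
    HasDerivAt (fun t : ℝ => cayleyMat (t • a) i j) (skewMat a i j) 0 := by
  have hsm : ∀ t : ℝ, skewMat (t • a) = t • skewMat a := by
    intro t
    ext i j
    simp only [skewMat, Matrix.of_apply, Matrix.smul_apply, Pi.smul_apply, smul_eq_mul]
    split_ifs <;> simp
  have hid : ∀ t : ℝ, cayleyMat (t • a) =
      1 + t • ((1 / 2 : ℝ) • (skewMat a * (1 + cayleyMat (t • a)))) := by
    intro t
    have h1 : cayleyMat (t • a) = 1 + (1 / 2 : ℝ) • (skewMat (t • a) * (1 + cayleyMat (t • a))) := by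
      have h2 : (1 - (1 / 2 : ℝ) • skewMat (t • a)) * cayleyMat (t • a) =
          1 + (1 / 2 : ℝ) • skewMat (t • a) := by
        rw [cayleyMat, ← Matrix.mul_assoc, Matrix.mul_nonsing_inv _ (isUnit_det_sub _),
          Matrix.one_mul]
      rw [Matrix.sub_mul, Matrix.one_mul, sub_eq_iff_eq_add] at h2
      rw [Matrix.mul_add, Matrix.mul_one, smul_add, ← add_assoc, ← Matrix.smul_mul]
      exact h2
    calc cayleyMat (t • a) = _ := h1
      _ = _ := by rw [hsm, Matrix.smul_mul, smul_comm]
  have hc : Continuous fun t : ℝ => ((1 / 2 : ℝ) • (skewMat a * (1 + cayleyMat (t • a)))) i j := by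
    have h3 : Continuous fun t : ℝ => cayleyMat (t • a) :=
      continuous_cayleyMat.comp (continuous_id.smul continuous_const)
    have h5 : Continuous fun t : ℝ => skewMat a * (1 + cayleyMat (t • a)) :=
      continuous_const.matrix_mul (continuous_const.add h3)
    exact continuous_const.mul (h5.matrix_elem i j)
  have h0 : ((1 / 2 : ℝ) • (skewMat a * (1 + cayleyMat ((0 : ℝ) • a)))) i j = skewMat a i j := by
    have h4 : cayleyMat ((0 : ℝ) • a) = 1 := by rw [hid 0, zero_smul, add_zero]
    rw [h4, Matrix.mul_add, Matrix.mul_one, ← two_smul ℝ (skewMat a), smul_smul]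
    norm_num
  rw [hasDerivAt_iff_tendsto_slope_zero]
  have ht := (hc.tendsto 0).mono_left (nhdsWithin_le_nhds (s := {0}ᶜ))
  rw [h0] at ht
  refine ht.congr' ?_
  filter_upwards [self_mem_nhdsWithin] with t htne
  have htne' : t ≠ 0 := htne
  have e1 := congrFun (congrFun (hid t) i) j
  have e0 := congrFun (congrFun (hid 0) i) j
  rw [Matrix.add_apply, Matrix.smul_apply, smul_eq_mul] at e1 e0
  rw [zero_mul, add_zero] at e0
  rw [zero_add, e0, smul_eq_mul]
  rw [e1]
  field_simp
  ring

/-! ### Invariant vector fields and the cotangent bundle -/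

/-- The left-invariant vector field `V^L_A(X) = (L_X)_* A` of a skew-symmetric matrix `A`. -/
def leftField {n : ℕ} (A : Matrix (Fin n) (Fin n) ℝ) (X : SOGroup n) :
    TangentSpace 𝓘(ℝ, SOModel n) X :=
  mulInvariantVectorField (I := 𝓘(ℝ, SOModel n)) (G := SOGroup n) (skewCoord A) X

/-- The right-invariant vector field `V^R_A(X) = (R_X)_* A` of a skew-symmetric matrix `A`. -/
def rightField {n : ℕ} (A : Matrix (Fin n) (Fin n) ℝ) (X : SOGroup n) :
    TangentSpace 𝓘(ℝ, SOModel n) X :=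
  mfderiv 𝓘(ℝ, SOModel n) 𝓘(ℝ, SOModel n) (fun Y : SOGroup n => Y * X) (1 : SOGroup n)
    (skewCoord A)

/-- The cotangent bundle `T^*SO(n)`, whose points are pairs `(X, p)` with `p` a linear form on
`T_X SO(n)`. It is a smooth manifold modelled on `ℝ^N × (ℝ^N)^*`, and the chart centred at a point
over `X₀` consists of the canonical coordinates induced by the chart of `SO(n)` centred at `X₀`. -/
abbrev CotSO (n : ℕ) : Type :=
  Bundle.TotalSpace (SOModel n →L[ℝ] ℝ)
    (fun X : SOGroup n => TangentSpace 𝓘(ℝ, SOModel n) X →L[ℝ] Bundle.Trivial (SOGroup n) ℝ X)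

/-- The model space `ℝ^N × (ℝ^N)^*` of canonical coordinates `(x, p)`. -/
abbrev CotModel (n : ℕ) : Type := SOModel n × (SOModel n →L[ℝ] ℝ)

/-- The model with corners (without boundary) of the manifold `T^*SO(n)`. -/
abbrev cotI (n : ℕ) :
    ModelWithCorners ℝ (CotModel n) (ModelProd (SOModel n) (SOModel n →L[ℝ] ℝ)) :=
  𝓘(ℝ, SOModel n).prod 𝓘(ℝ, SOModel n →L[ℝ] ℝ)

/-- The cotangent space `T_m^* M` of the manifold `M = T^*SO(n)` at `m`. -/
abbrev CotangentAt {n : ℕ} (m : CotSO n) : Type := TangentSpace (cotI n) m →L[ℝ] ℝ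

/-- The differential `df ∈ T_m^* M` of a function `f` on `M = T^*SO(n)`. -/
def dAt {n : ℕ} (f : CotSO n → ℝ) (m : CotSO n) : CotangentAt m :=
  mfderiv (cotI n) 𝓘(ℝ, ℝ) f m

/-- The tangent vector `∂/∂x_r` at `m`, in canonical coordinates `(x, p)` centred at `m`. -/
def vecX {n : ℕ} (m : CotSO n) (r : SOPair n) : TangentSpace (cotI n) m :=
  ((Pi.single r 1, 0) : CotModel n)

/-- The tangent vector `∂/∂p_r` at `m`, in canonical coordinates `(x, p)` centred at `m`. -/
def vecP {n : ℕ} (m : CotSO n) (r : SOPair n) : TangentSpace (cotI n) m :=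
  ((0, ContinuousLinearMap.proj r) : CotModel n)

/-- The Poisson tensor `Π` of the canonical symplectic structure of `T^*SO(n)`: in canonical
coordinates `(x, p)` centred at `m`,
`Π(α, β) = ∑_r (α(∂/∂p_r) β(∂/∂x_r) - α(∂/∂x_r) β(∂/∂p_r))`. -/
def poissonTensor {n : ℕ} (m : CotSO n) (α β : CotangentAt m) : ℝ :=
  ∑ r, (α (vecP m r) * β (vecX m r) - α (vecX m r) * β (vecP m r))

/-- The Poisson bracket `{f, g} = Π(df, dg)`. -/
def poissonBracket {n : ℕ} (f g : CotSO n → ℝ) (m : CotSO n) : ℝ :=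
  poissonTensor m (dAt f m) (dAt g m)

/-- The subspace `L^∠` of `T_m^* M` skew-orthogonal to `L` with respect to `Π`. -/
def skewOrth {n : ℕ} {m : CotSO n} (L : Submodule ℝ (CotangentAt m)) :
    Submodule ℝ (CotangentAt m) where
  carrier := {α | ∀ β ∈ L, poissonTensor m α β = 0}
  zero_mem' := by
    intro β _
    have h : ∀ v, (0 : CotangentAt m) v = 0 := fun _ => rfl
    simp [poissonTensor, h]
  add_mem' := by
    intro α α' hα hα' β hβ
    have h : poissonTensor m (α + α') β = poissonTensor m α β + poissonTensor m α' β := by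
      have h' : ∀ v, (α + α') v = α v + α' v := fun _ => rfl
      simp only [poissonTensor, h', ← Finset.sum_add_distrib]
      exact Finset.sum_congr rfl fun r _ => by ring
    rw [h, hα β hβ, hα' β hβ, add_zero]
  smul_mem' := by
    intro c α hα β hβ
    have h : poissonTensor m (c • α) β = c * poissonTensor m α β := by
      have h' : ∀ v, (c • α) v = c * α v := fun _ => rfl
      simp only [poissonTensor, h', Finset.mul_sum]
      exact Finset.sum_congr rfl fun r _ => by ring
    rw [h, hα β hβ, mul_zero]

/-! ### Null sets, rank, centrality and defect of integrability -/

/-- A property holds almost everywhere on `M = T^*SO(n)`: in every chart centred at a point of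
`M`, the set where it fails is null for the Lebesgue (Haar) measure of the model space. -/
def AlmostEverywhere {n : ℕ} (P : CotSO n → Prop) : Prop :=
  ∀ m₀ : CotSO n, (MeasureTheory.Measure.addHaar : MeasureTheory.Measure (CotModel n))
    ((extChartAt (cotI n) m₀).target ∩ {z | ¬ P ((extChartAt (cotI n) m₀).symm z)}) = 0

/-- The span of the differentials at `m` of the functions of the set `F`. -/
def spanD {n : ℕ} (F : Set (CotSO n → ℝ)) (m : CotSO n) : Submodule ℝ (CotangentAt m) :=
  Submodule.span ℝ ((fun f => dAt f m) '' F)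

/-- The rank of `F` at `m`: the dimension of the image of `T_m M` under the derivative of the map
`M → ℝ^F` defined by the finite set of functions `F`. -/
def rankAt {n : ℕ} (F : Set (CotSO n → ℝ)) (m : CotSO n) : ℕ :=
  Module.finrank ℝ (LinearMap.range
    (LinearMap.pi fun f : F => ((dAt f.1 m : CotangentAt m) : TangentSpace (cotI n) m →ₗ[ℝ] ℝ)))

/-- There are `k` smooth functions `Z_1, …, Z_k` on `M`, each of them a function of the elements
of `F`, which are functionally independent almost everywhere and in involution with `F`. -/
def HasCentralFunctions {n : ℕ} (F : Set (CotSO n → ℝ)) (k : ℕ) : Prop :=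
  ∃ Z : Fin k → CotSO n → ℝ,
    (∀ j, ContMDiff (cotI n) 𝓘(ℝ, ℝ) ∞ (Z j)) ∧
    (∀ j, ∃ g : (F → ℝ) → ℝ, ∀ m, Z j m = g fun f => f.1 m) ∧
    AlmostEverywhere (fun m => LinearIndependent ℝ fun j => dAt (Z j) m) ∧
    ∀ j, ∀ f ∈ F, ∀ m, poissonBracket (Z j) f m = 0

/-- `k` is the centrality `k(F)`: the maximal number of central functions. -/
def IsCentrality {n : ℕ} (F : Set (CotSO n → ℝ)) (k : ℕ) : Prop :=
  IsGreatest {k | HasCentralFunctions F k} k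

/-- `r` is the defect of integrability `r(F) = 2N - rank F - k(F)`, where `rank F` is the common
value of the rank almost everywhere and `2N = n (n - 1)` is the dimension of `M`. -/
def IsDefect {n : ℕ} (F : Set (CotSO n → ℝ)) (r : ℤ) : Prop :=
  ∃ ρ k : ℕ, AlmostEverywhere (fun m => rankAt F m = ρ) ∧ IsCentrality F k ∧
    r = (n : ℤ) * (n - 1) - ρ - k

/-! ### The functions of the free rigid body -/

/-- The matrix `P^L(m)` of left-invariant momenta `P^L_{ij}(m) = ⟨p, V^L_{ij}(X)⟩`, `m = (X, p)`. -/
def PL {n : ℕ} (m : CotSO n) : Matrix (Fin n) (Fin n) ℝ :=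
  Matrix.of fun i j => m.2 (leftField (basisD i j) m.1)

/-- The matrix `P^R(m)` of right-invariant momenta `P^R_{ij}(m) = ⟨p, V^R_{ij}(X)⟩`. -/
def PR {n : ℕ} (m : CotSO n) : Matrix (Fin n) (Fin n) ℝ :=
  Matrix.of fun i j => m.2 (rightField (basisD i j) m.1)

/-- The set `B^λ` of all `P^R_{ij}`, `i < j`, and of those `P^L_{ij}`, `i < j`, for which
`λ_i = λ_j`. -/
def BSet {n : ℕ} (lam : Fin n → ℝ) : Set (CotSO n → ℝ) :=
  {f | ∃ i j, i < j ∧ lam i = lam j ∧ f = fun m => PL m i j} ∪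
    {f | ∃ i j, i < j ∧ f = fun m => PR m i j}

/-- The distinct values `μ_1, …, μ_u` of the generalized moments of inertia. -/
def moments {n : ℕ} (lam : Fin n → ℝ) : Finset ℝ := Finset.univ.image lam

/-- The multiplicity `q` of a value `μ` among the moments of inertia. -/
def mult {n : ℕ} (lam : Fin n → ℝ) (μ : ℝ) : ℕ :=
  (Finset.univ.filter fun i => lam i = μ).card

/-- The sum `∑_{i<j} q_i q_j` over pairs of distinct moments of inertia. -/
def pairSum {n : ℕ} (lam : Fin n → ℝ) : ℕ :=
  ∑ p ∈ (moments lam ×ˢ moments lam).filter (fun p => p.1 < p.2), mult lam p.1 * mult lam p.2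

/-- The number `d(q)` of odd multiplicities. -/
def oddCount {n : ℕ} (lam : Fin n → ℝ) : ℕ :=
  ((moments lam).filter fun μ => Odd (mult lam μ)).card

/-- The number `z^λ = [n/2] + ∑_i [q_i/2]`. -/
def zNumber {n : ℕ} (lam : Fin n → ℝ) : ℕ := n / 2 + ∑ μ ∈ moments lam, mult lam μ / 2

/-- The standard Casimir function `C_h`: the coefficient of `t^{q - 2h}` in `det(t - A)`, for `A`
of size `q`. The standard set consists of those with `1 ≤ h ≤ [q/2]`. -/
def casimir {ι : Type} [Fintype ι] [DecidableEq ι] (h : ℕ) (A : Matrix ι ι ℝ) : ℝ :=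
  A.charpoly.coeff (Fintype.card ι - 2 * h)

/-- The diagonal block of a matrix belonging to the indices `i` with `λ_i = μ`. -/
def momentBlock {n : ℕ} (lam : Fin n → ℝ) (μ : ℝ) (A : Matrix (Fin n) (Fin n) ℝ) :
    Matrix {i // lam i = μ} {i // lam i = μ} ℝ :=
  A.submatrix Subtype.val Subtype.val

/-- The set `C̄ = C(P^L)` of standard Casimir functions of the matrix `P^L`. -/
def CbarSet (n : ℕ) : Set (CotSO n → ℝ) :=
  {f | ∃ h : ℕ, 1 ≤ h ∧ h ≤ n / 2 ∧ f = fun m => casimir h (PL m)}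

/-- The set `C^{Lλ}` of standard Casimir functions of the diagonal blocks of `P^L`. -/
def CLSet {n : ℕ} (lam : Fin n → ℝ) : Set (CotSO n → ℝ) :=
  {f | ∃ μ ∈ moments lam, ∃ h : ℕ, 1 ≤ h ∧ h ≤ mult lam μ / 2 ∧
    f = fun m => casimir h (momentBlock lam μ (PL m))}

/-- The set `Z^λ`: it is `C̄ ∪ C^{Lλ}` if there are at least two distinct moments of inertia, and
`C̄` otherwise. -/
def ZSet {n : ℕ} (lam : Fin n → ℝ) : Set (CotSO n → ℝ) :=
  if 1 < (moments lam).card then CbarSet n ∪ CLSet lam else CbarSet n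

end

open scoped Manifold ContDiff Matrix

noncomputable section

/-! The proof is linear algebra in one cotangent space `T_m^*M`, followed by genericity. Trivialise
`T^*SO(n)` on the left, write `P` for `PL m`, and let `c(a, b) = p([a, b])` be the Lie-Poisson form
on `so(n)`. In the canonical Cayley coordinates centred at `m`, the differential of the left
momentum of `a` is `(x, π) ↦ π(a) + c(x, a)/2`, and that of the right momentum is the same with
`-c`. Hence left covectors pair to `c(a, b)`, left and right covectors are orthogonal, everything
orthogonal to all right covectors is a left covector, and the left covector of `a` is also a right
one exactly when `a ∈ ker c`.

Let `H ⊆ so(n)` be the block-diagonal part. By `spanD_BSet`, `Span dB^λ` is the sum of the left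
covectors of `H` and all right covectors, so `inf_skewOrth_eq` identifies `Span dB^λ ∩ (Span
dB^λ)^∠` with the left covectors of `rad(c|_H) + ker c`. Since `c(a, b) = -tr(b [P, a])/2` and the
trace form is definite on skew matrices, `ker c` is the commutant of `P` in `so(n)`, and `rad(c|_H)`
consists of the `a ∈ H` whose blocks commute with those of `P`. If a skew matrix has a cyclic
vector, the skew matrices commuting with it are its odd polynomials, and these are spanned by the
gradients of the standard Casimir functions (`IsCyclicMat.mem_span_casimirGrad`). This gives `Span
dZ^λ` wherever `P` and its blocks are cyclic.

If `u > 1`, generically no nonzero element of `H` commutes with `P`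
(`almostEverywhere_block_commute`). Then the left covectors of `H` and the right covectors form a
direct sum, so the rank is `dim H + N`, and the differentials of the `z^λ` Casimir functions are
independent. These functions are central, as the Casimir functions of `P^L` are also those of the
conjugate matrix `P^R`. No family of central functions is larger: where `B^λ` has independent
differentials, a smooth function of its elements has its differential in `Span dB^λ`
(`fderiv_mem_span_of_factor`), and involution puts it in `Span dZ^λ`.

The generic conditions are nonvanishing conditions on homogeneous polynomials in `P`, so one skew
matrix satisfying each is enough. A tridiagonal matrix serves for both. -/

/-! ### Invariant vector fields in the Cayley charts. -/

theorem skewMat_smul {n : ℕ} (t : ℝ) (a : SOModel n) : skewMat (t • a) = t • skewMat a := by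
  ext i j
  simp only [skewMat, Matrix.of_apply, Matrix.smul_apply, Pi.smul_apply, smul_eq_mul]
  split_ifs <;> simp

theorem skewMat_add {n : ℕ} (a b : SOModel n) : skewMat (a + b) = skewMat a + skewMat b := by
  ext i j
  simp only [skewMat, Matrix.of_apply, Matrix.add_apply, Pi.add_apply]
  split_ifs <;> ring

/-- `skewCoord` as a linear map. -/
def skewCoordₗ (n : ℕ) : Matrix (Fin n) (Fin n) ℝ →ₗ[ℝ] SOModel n where
  toFun := skewCoord
  map_add' _ _ := rfl
  map_smul' _ _ := rfl

/-- `skewMat` as a linear map. -/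
def skewMatₗ (n : ℕ) : SOModel n →ₗ[ℝ] Matrix (Fin n) (Fin n) ℝ where
  toFun := skewMat
  map_add' := skewMat_add
  map_smul' := skewMat_smul

theorem cayleyChart_apply {n : ℕ} (X₀ X : SOGroup n) :
    cayleyChart X₀ X = skewCoord (cayleyInv (X₀.1ᵀ * X.1)) := rfl

theorem skewMat_zero {n : ℕ} : skewMat (0 : SOModel n) = 0 := map_zero (skewMatₗ n)

theorem cayleyMat_zero {n : ℕ} : cayleyMat (0 : SOModel n) = 1 := by
  simp [cayleyMat, skewMat_zero]

theorem cayleyInv_one {n : ℕ} : cayleyInv (1 : Matrix (Fin n) (Fin n) ℝ) = 0 := by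
  simp [cayleyInv]

theorem cayleyChart_self {n : ℕ} (X : SOGroup n) : cayleyChart X X = 0 := by
  rw [cayleyChart_apply, SOGroup.transpose_mul_self, cayleyInv_one]; rfl

/-- The chart at `X` is the left translate of the chart at `1`, so in these two charts left
translation by `X` is the identity map. -/
theorem leftField_eq {n : ℕ} (A : Matrix (Fin n) (Fin n) ℝ) (X : SOGroup n) :
    leftField A X = skewCoord A := by
  have h : HasMFDerivAt 𝓘(ℝ, SOModel n) 𝓘(ℝ, SOModel n) (fun Y : SOGroup n => X * Y) 1
      (ContinuousLinearMap.id ℝ (SOModel n)) := by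
    refine ⟨(continuous_const.mul continuous_id).continuousAt, ?_⟩
    have : writtenInExtChartAt 𝓘(ℝ, SOModel n) 𝓘(ℝ, SOModel n) 1 (fun Y : SOGroup n => X * Y) =
        id := by
      funext a
      change cayleyChart (X * 1) (X * (cayleyChart 1).symm a) = a
      rw [cayleyChart_apply]
      rw [show X * 1 = X from mul_one X, show (X * (cayleyChart 1).symm a).1 =
        X.1 * ((1 : Matrix (Fin n) (Fin n) ℝ) * cayleyMat a) from rfl, ← Matrix.mul_assoc,
        SOGroup.transpose_mul_self, Matrix.one_mul, Matrix.one_mul, cayleyInv_cayleyMat,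
        skewCoord_skewMat]
    rw [this]
    exact (hasFDerivAt_id _).hasFDerivWithinAt
  exact congrArg (fun L : SOModel n →L[ℝ] SOModel n => L (skewCoord A)) h.mfderiv

theorem cayleyInv_conj {n : ℕ} (X : SOGroup n) (Y : Matrix (Fin n) (Fin n) ℝ) :
    cayleyInv (X.1ᵀ * Y * X.1) =
      X.1ᵀ * cayleyInv Y * X.1 := by
  have h1 := SOGroup.transpose_mul_self X
  have h2 := SOGroup.mul_transpose_self X
  set x : Matrix (Fin n) (Fin n) ℝ := X.1
  have e1 : xᵀ * Y * x - 1 = xᵀ * (Y - 1) * x := by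
    rw [Matrix.mul_sub, Matrix.sub_mul, Matrix.mul_one, h1]
  have e2 : 1 + xᵀ * Y * x = xᵀ * (1 + Y) * x := by
    rw [Matrix.mul_add, Matrix.add_mul, Matrix.mul_one, h1]
  have hx : x⁻¹ = xᵀ := Matrix.inv_eq_left_inv h1
  have hxt : xᵀ⁻¹ = x := Matrix.inv_eq_left_inv h2
  rw [cayleyInv, cayleyInv, e1, e2, Matrix.mul_inv_rev, Matrix.mul_inv_rev, hx, hxt,
    Matrix.mul_smul, Matrix.smul_mul]
  congr 1
  calc xᵀ * (Y - 1) * x * (xᵀ * ((1 + Y)⁻¹ * x))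
      = xᵀ * (Y - 1) * (x * xᵀ) * ((1 + Y)⁻¹ * x) := by simp only [Matrix.mul_assoc]
    _ = _ := by rw [h2, Matrix.mul_one]; simp only [Matrix.mul_assoc]

/-- `a ↦ Xᵀ a X` in coordinates. -/
def conjModel {n : ℕ} (X : Matrix (Fin n) (Fin n) ℝ) : SOModel n →ₗ[ℝ] SOModel n :=
  skewCoordₗ n ∘ₗ LinearMap.mulRight ℝ X ∘ₗ LinearMap.mulLeft ℝ Xᵀ ∘ₗ skewMatₗ n

/-- Since `Y X = X (Xᵀ Y X)` and the Cayley map commutes with orthogonal conjugation, right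
translation is exactly linear in the charts at `1` and `X`. -/
theorem rightField_eq {n : ℕ} {A : Matrix (Fin n) (Fin n) ℝ} (hA : Aᵀ = -A) (X : SOGroup n) :
    rightField A X = skewCoord (X.1ᵀ * A * X.1) := by
  have h : HasMFDerivAt 𝓘(ℝ, SOModel n) 𝓘(ℝ, SOModel n) (fun Y : SOGroup n => Y * X) 1
      (LinearMap.toContinuousLinearMap (conjModel X.1) : SOModel n →L[ℝ] SOModel n) := by
    refine ⟨(continuous_id.mul continuous_const).continuousAt, ?_⟩
    have : writtenInExtChartAt 𝓘(ℝ, SOModel n) 𝓘(ℝ, SOModel n) 1 (fun Y : SOGroup n => Y * X) =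
        (LinearMap.toContinuousLinearMap (conjModel X.1) : SOModel n →L[ℝ] SOModel n) := by
      funext a
      change cayleyChart (1 * X) ((cayleyChart 1).symm a * X) = _
      rw [cayleyChart_apply]
      rw [show 1 * X = X from one_mul X, show ((cayleyChart 1).symm a * X).1 =
        ((1 : Matrix (Fin n) (Fin n) ℝ) * cayleyMat a) * X.1 from rfl, Matrix.one_mul,
        ← Matrix.mul_assoc, cayleyInv_conj, cayleyInv_cayleyMat]
      rfl
    rw [this]
    exact (ContinuousLinearMap.hasFDerivAt _).hasFDerivWithinAt
  refine (congrArg (fun L : SOModel n →L[ℝ] SOModel n => L (skewCoord A)) h.mfderiv).trans ?_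
  change skewCoord (X.1ᵀ * skewMat (skewCoord A) * X.1) = _
  rw [skewMat_skewCoord hA]

theorem basisD_transpose {n : ℕ} (i j : Fin n) : (basisD i j)ᵀ = -basisD i j := by
  simp [basisD]

/-! ### Momenta in canonical coordinates on `T^*SO(n)`. -/

/-- The momentum `p` of `m = (X, p)`, as a linear form on the model space. -/
def covec {n : ℕ} (m : CotSO n) : SOModel n →L[ℝ] ℝ := m.2

theorem PL_apply {n : ℕ} (m : CotSO n) (i j : Fin n) :
    PL m i j = covec m (skewCoord (basisD i j)) := by
  change covec m (leftField (basisD i j) m.1) = _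
  rw [leftField_eq]

theorem PR_apply {n : ℕ} (m : CotSO n) (i j : Fin n) :
    PR m i j = covec m (skewCoord (m.1.1ᵀ * basisD i j * m.1.1)) := by
  change covec m (rightField (basisD i j) m.1) = _
  rw [rightField_eq (basisD_transpose i j)]

theorem extChartAt_target_cot {n : ℕ} (m : CotSO n) : (extChartAt (cotI n) m).target = Set.univ := by
  rw [FiberBundle.extChartAt_target]
  ext z
  simp only [Set.mem_prod, Set.mem_univ, and_true, iff_true]
  refine ⟨?_, ?_, ?_⟩
  · rw [extChartAt_target]; exact ⟨Set.mem_univ _, Set.mem_range_self _⟩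
  · exact (cayleyChart m.1).map_target (Set.mem_univ _)
  · trivial

/-- `covec` is read in the chart centred at the point itself, whereas `z.2` is read in the chart
centred at `m`; the two differ by the tangent coordinate change. -/
theorem cot_symm_snd {n : ℕ} (m : CotSO n) (z : CotModel n) (v : SOModel n) :
    covec ((extChartAt (cotI n) m).symm z) v = z.2 (tangentCoordChange 𝓘(ℝ, SOModel n)
      ((cayleyChart m.1).symm z.1) m.1 ((cayleyChart m.1).symm z.1) v) := by
  have h : (cayleyChart m.1).symm z.1 ∈ (chartAt (SOModel n) m.1).source :=
    (cayleyChart m.1).map_target (Set.mem_univ _)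
  have := TangentBundle.continuousLinearMapAt_trivializationAt_eq_core (I := 𝓘(ℝ, SOModel n)) h
  have key : covec ((extChartAt (cotI n) m).symm z) = z.2.comp ((trivializationAt (SOModel n) (TangentSpace 𝓘(ℝ, SOModel n)) m.1).continuousLinearMapAt ℝ ((cayleyChart m.1).symm z.1)) := by
    ext v
    change ((Bundle.Trivial.trivialization (SOGroup n) ℝ).symmL ℝ ((cayleyChart m.1).symm z.1))
      (z.2 _) = _
    rw [Bundle.Trivial.symmL_trivialization]
    rfl
  rw [key, this]
  rfl

/-- In this form differences of `cayleyInv` obey a resolvent identity, as used in `cayleyInv_sub`.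
-/
theorem cayleyInv_eq_sub {n : ℕ} {Y : Matrix (Fin n) (Fin n) ℝ} (h : IsUnit (1 + Y).det) :
    cayleyInv Y = (2 : ℝ) • 1 - (4 : ℝ) • (1 + Y)⁻¹ := by
  have h1 : Y - 1 = (1 + Y) - (2 : ℝ) • 1 := by rw [two_smul]; abel
  rw [cayleyInv, h1, Matrix.sub_mul, Matrix.mul_nonsing_inv _ h, smul_sub, Matrix.smul_mul,
    Matrix.one_mul, smul_smul]
  norm_num

theorem cayleyMat_smul_eq {n : ℕ} (b : SOModel n) (t : ℝ) :
    cayleyMat (t • b) = 1 + t • ((1 / 2 : ℝ) • (skewMat b * (1 + cayleyMat (t • b)))) := by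
  have h2 : (1 - (1 / 2 : ℝ) • skewMat (t • b)) * cayleyMat (t • b) =
      1 + (1 / 2 : ℝ) • skewMat (t • b) := by
    rw [cayleyMat, ← Matrix.mul_assoc, Matrix.mul_nonsing_inv _ (isUnit_det_sub _),
      Matrix.one_mul]
  rw [Matrix.sub_mul, Matrix.one_mul, sub_eq_iff_eq_add, skewMat_smul] at h2
  conv_lhs => rw [h2]
  rw [Matrix.mul_add, Matrix.mul_one, smul_add, smul_add, add_assoc, Matrix.smul_mul,
    Matrix.smul_mul, smul_comm t, smul_comm t]

theorem cayleyInv_sub {n : ℕ} {Y Z : Matrix (Fin n) (Fin n) ℝ} (hY : IsUnit (1 + Y).det)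
    (hZ : IsUnit (1 + Z).det) :
    cayleyInv Y - cayleyInv Z = (4 : ℝ) • ((1 + Y)⁻¹ * (Y - Z) * (1 + Z)⁻¹) := by
  have h1 : (1 + Y)⁻¹ * (Y - Z) * (1 + Z)⁻¹ = (1 + Z)⁻¹ - (1 + Y)⁻¹ := by
    rw [show Y - Z = (1 + Y) - (1 + Z) by abel, Matrix.mul_sub, Matrix.sub_mul,
      Matrix.nonsing_inv_mul _ hY, Matrix.one_mul, Matrix.mul_assoc, Matrix.mul_nonsing_inv _ hZ,
      Matrix.mul_one]
  rw [h1, cayleyInv_eq_sub hY, cayleyInv_eq_sub hZ, smul_sub]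
  abel

theorem inv_one_add_cayleyMat {n : ℕ} (a : SOModel n) :
    (1 + cayleyMat a)⁻¹ = (1 / 2 : ℝ) • (1 - (1 / 2 : ℝ) • skewMat a) :=
  Matrix.inv_eq_right_inv (one_add_cayleyMat_mul a)

theorem sub_half_mul_cayleyMat {n : ℕ} (a : SOModel n) :
    (1 - (1 / 2 : ℝ) • skewMat a) * cayleyMat a = 1 + (1 / 2 : ℝ) • skewMat a := by
  rw [cayleyMat, ← Matrix.mul_assoc, Matrix.mul_nonsing_inv _ (isUnit_det_sub _), Matrix.one_mul]

/-- The derivative at `t = 0` of the Cayley coordinates of `cay(a) cay(t b)`. -/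
theorem hasDerivAt_cayleyInv_mul {n : ℕ} (a b : SOModel n) (i j : Fin n) :
    HasDerivAt (fun t : ℝ => cayleyInv (cayleyMat a * cayleyMat (t • b)) i j)
      (((1 + (1 / 2 : ℝ) • skewMat a) * skewMat b * (1 - (1 / 2 : ℝ) • skewMat a)) i j) 0 := by
  set Y : ℝ → Matrix (Fin n) (Fin n) ℝ := fun t => cayleyMat a * cayleyMat (t • b) with hYdef
  -- `K t` is the difference quotient of `cayleyInv (Y t)`, obtained from the resolvent identity and
  -- `cayleyMat_smul_eq`. Its continuity at `0` alone gives the derivative `K 0`.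
  set K : ℝ → Matrix (Fin n) (Fin n) ℝ := fun t =>
    (4 : ℝ) • ((1 + Y t)⁻¹ * (cayleyMat a * ((1 / 2 : ℝ) • (skewMat b * (1 + cayleyMat (t • b))))) *
      (1 + Y 0)⁻¹) with hKdef
  have hc : Continuous fun t : ℝ => cayleyMat (t • b) :=
    continuous_cayleyMat.comp (continuous_id.smul continuous_const)
  have hY : Continuous Y := continuous_const.matrix_mul hc
  have hY0 : Y 0 = cayleyMat a := by simp [hYdef, cayleyMat_zero]
  have hdet : Continuous fun t => (1 + Y t).det := (continuous_const.add hY).matrix_det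
  have hu0 : (1 + Y 0).det ≠ 0 := by rw [hY0]; exact det_one_add_cayleyMat a
  have hu : ∀ᶠ t in nhds (0 : ℝ), (1 + Y t).det ≠ 0 := hdet.continuousAt.eventually_ne hu0
  have hinv : ContinuousAt (fun t => (1 + Y t)⁻¹) 0 := by
    simp only [Matrix.inv_def, Ring.inverse_eq_inv']
    exact (hdet.continuousAt.inv₀ hu0).smul (continuous_const.add hY).matrix_adjugate.continuousAt
  have hK : ContinuousAt K 0 := by
    have hb : Continuous fun t => skewMat b * (1 + cayleyMat (t • b)) :=
      continuous_const.matrix_mul (continuous_const.add hc)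
    have hb' : Continuous fun t => (1 / 2 : ℝ) • (skewMat b * (1 + cayleyMat (t • b))) :=
      hb.const_smul (1 / 2 : ℝ)
    have h1 : Continuous fun t =>
        cayleyMat a * ((1 / 2 : ℝ) • (skewMat b * (1 + cayleyMat (t • b)))) :=
      continuous_const.matrix_mul hb'
    exact ((hinv.mul h1.continuousAt).mul continuousAt_const).const_smul (4 : ℝ)
  have hK0 : K 0 = (1 + (1 / 2 : ℝ) • skewMat a) * skewMat b * (1 - (1 / 2 : ℝ) • skewMat a) := by
    have h2 : (1 : Matrix (Fin n) (Fin n) ℝ) + 1 = (2 : ℝ) • 1 := by rw [two_smul]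
    simp only [hKdef, hY0, zero_smul, cayleyMat_zero, inv_one_add_cayleyMat, h2]
    rw [← sub_half_mul_cayleyMat a]
    simp only [Matrix.mul_smul, Matrix.smul_mul, smul_smul, Matrix.mul_one, Matrix.mul_assoc]
    norm_num
  have hW : ∀ᶠ t in nhds (0 : ℝ), cayleyInv (Y t) i j = cayleyInv (Y 0) i j + t * K t i j := by
    filter_upwards [hu] with t ht
    have h1 := cayleyInv_sub (isUnit_iff_ne_zero.2 ht) (isUnit_iff_ne_zero.2 hu0)
    have h3 : Y t - Y 0 = t • (cayleyMat a *
        ((1 / 2 : ℝ) • (skewMat b * (1 + cayleyMat (t • b))))) := by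
      rw [hY0]
      simp only [hYdef]
      conv_lhs => rw [cayleyMat_smul_eq]
      rw [Matrix.mul_add, Matrix.mul_one, add_sub_cancel_left, Matrix.mul_smul]
    rw [h3, Matrix.mul_smul, Matrix.smul_mul, smul_comm] at h1
    have := congrFun (congrFun h1 i) j
    rw [Matrix.sub_apply] at this
    rw [← sub_eq_iff_eq_add', this]
    rfl
  rw [hasDerivAt_iff_tendsto_slope_zero, ← hK0]
  have hKe : ContinuousAt (fun t => K t i j) 0 :=
    (continuous_apply j).continuousAt.comp ((continuous_apply i).continuousAt.comp hK)
  refine (hKe.tendsto.mono_left (nhdsWithin_le_nhds (s := {0}ᶜ))).congr' ?_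
  filter_upwards [self_mem_nhdsWithin, hW.filter_mono nhdsWithin_le_nhds] with t ht hWt
  have ht' : t ≠ 0 := ht
  rw [zero_add, hWt, smul_eq_mul]
  field_simp
  ring

/-- The transition map from the chart at `X₀ cay(a)` to the chart at `X₀` sends `c` to the
coordinates of `cay(a) cay(c)`; its derivative at `c = 0` is found along the lines `t b`. -/
theorem tangentCoordChange_cayley {n : ℕ} (X₀ : SOGroup n) (a b : SOModel n) :
    tangentCoordChange 𝓘(ℝ, SOModel n) ((cayleyChart X₀).symm a) X₀ ((cayleyChart X₀).symm a) b =
      skewCoord ((1 + (1 / 2 : ℝ) • skewMat a) * skewMat b * (1 - (1 / 2 : ℝ) • skewMat a)) := by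
  set X := (cayleyChart X₀).symm a with hX
  have h0 := hasFDerivWithinAt_tangentCoordChange (I := 𝓘(ℝ, SOModel n)) (x := X) (y := X₀) (z := X)
    ⟨mem_extChartAt_source X, by
      rw [extChartAt_source]; exact (cayleyChart X₀).map_target (Set.mem_univ _)⟩
  have h1 : HasFDerivAt (fun c : SOModel n => cayleyChart X₀ ((cayleyChart X).symm c))
      (tangentCoordChange 𝓘(ℝ, SOModel n) X X₀ X) (0 : SOModel n) := by
    have : extChartAt 𝓘(ℝ, SOModel n) X X = (0 : SOModel n) := cayleyChart_self X
    rw [this, modelWithCornersSelf_coe, Set.range_id, hasFDerivWithinAt_univ] at h0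
    exact h0
  have hl : HasDerivAt (fun t : ℝ => t • b) b 0 := by
    simpa using (hasDerivAt_id (0 : ℝ)).smul_const b
  have h2 := HasFDerivAt.comp_hasDerivAt (0 : ℝ) (f := fun t : ℝ => t • b) (f' := b)
    (by rw [zero_smul]; exact h1) hl
  funext p
  have h3 := (hasDerivAt_pi.1 h2) p
  have h4 := hasDerivAt_cayleyInv_mul a b p.1.1 p.1.2
  have h5 : (fun t : ℝ => cayleyInv (cayleyMat a * cayleyMat (t • b)) p.1.1 p.1.2) =
      fun t : ℝ => ((fun c : SOModel n => cayleyChart X₀ ((cayleyChart X).symm c)) ∘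
        fun t : ℝ => t • b) t p := by
    funext t
    have : X₀.1ᵀ * (X₀.1 * cayleyMat a * cayleyMat (t • b)) =
        cayleyMat a * cayleyMat (t • b) := by
      rw [← Matrix.mul_assoc, ← Matrix.mul_assoc, SOGroup.transpose_mul_self, Matrix.one_mul]
    rw [← this]
    rfl
  rw [h5] at h4
  exact h3.unique h4

/-- The point of `T^*SO(n)` with coordinates `z` in the chart centred at `m`. -/
abbrev cotPt {n : ℕ} (m : CotSO n) (z : CotModel n) : CotSO n := (extChartAt (cotI n) m).symm z

theorem covec_cotPt {n : ℕ} (m : CotSO n) (z : CotModel n) (b : SOModel n) :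
    covec (cotPt m z) b = z.2 (skewCoord
      ((1 + (1 / 2 : ℝ) • skewMat z.1) * skewMat b * (1 - (1 / 2 : ℝ) • skewMat z.1))) := by
  rw [cot_symm_snd, tangentCoordChange_cayley]

theorem PL_cotPt {n : ℕ} (m : CotSO n) (z : CotModel n) (i j : Fin n) :
    PL (cotPt m z) i j = z.2 (skewCoord
      ((1 + (1 / 2 : ℝ) • skewMat z.1) * basisD i j * (1 - (1 / 2 : ℝ) • skewMat z.1))) := by
  rw [PL_apply, covec_cotPt, skewMat_skewCoord (basisD_transpose i j)]

theorem conj_transpose_neg {n : ℕ} (X : Matrix (Fin n) (Fin n) ℝ) {A : Matrix (Fin n) (Fin n) ℝ}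
    (hA : Aᵀ = -A) : (Xᵀ * A * X)ᵀ = -(Xᵀ * A * X) := by
  simp [Matrix.transpose_mul, hA, Matrix.mul_assoc]

theorem add_half_mul_cayleyMat_transpose {n : ℕ} (a : SOModel n) :
    (1 + (1 / 2 : ℝ) • skewMat a) * (cayleyMat a)ᵀ = 1 - (1 / 2 : ℝ) • skewMat a := by
  have h : (cayleyMat a)ᵀ = (1 - (1 / 2 : ℝ) • skewMat a) * (1 + (1 / 2 : ℝ) • skewMat a)⁻¹ := by
    rw [cayleyMat, Matrix.transpose_mul, Matrix.transpose_nonsing_inv, transpose_add_half,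
      transpose_sub_half]
  rw [h, ← Matrix.mul_assoc, half_comm, Matrix.mul_assoc, Matrix.mul_nonsing_inv _ (isUnit_det_add a),
    Matrix.mul_one]

theorem cayleyMat_mul_sub_half {n : ℕ} (a : SOModel n) :
    cayleyMat a * (1 - (1 / 2 : ℝ) • skewMat a) = 1 + (1 / 2 : ℝ) • skewMat a := by
  rw [← transpose_add_half, ← Matrix.transpose_transpose (cayleyMat a), ← Matrix.transpose_mul,
    add_half_mul_cayleyMat_transpose, transpose_sub_half]

/-- Passing to right momenta conjugates by the moving point, and the Cayley factors cancel by `(1 +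
s) cay(x)ᵀ = 1 - s` with `s = x/2`. Only the sign of `s` changes in comparison with `PL_cotPt`; this
sign is the source of `-c` in the right differentials. -/
theorem PR_cotPt {n : ℕ} (m : CotSO n) (z : CotModel n) (i j : Fin n) :
    PR (cotPt m z) i j = z.2 (skewCoord ((1 - (1 / 2 : ℝ) • skewMat z.1) *
      (m.1.1ᵀ * basisD i j * m.1.1) * (1 + (1 / 2 : ℝ) • skewMat z.1))) := by
  rw [PR_apply, covec_cotPt, skewMat_skewCoord (conj_transpose_neg _ (basisD_transpose i j))]
  change z.2 (skewCoord (_ * ((m.1.1 * cayleyMat z.1)ᵀ * _ * (m.1.1 * cayleyMat z.1)) * _)) = _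
  rw [Matrix.transpose_mul]
  have h1 := add_half_mul_cayleyMat_transpose z.1
  have h2 := cayleyMat_mul_sub_half z.1
  set s := (1 / 2 : ℝ) • skewMat z.1
  congr 2
  calc (1 + s) * ((cayleyMat z.1)ᵀ * m.1.1ᵀ * basisD i j * (m.1.1 * cayleyMat z.1)) * (1 - s)
      = ((1 + s) * (cayleyMat z.1)ᵀ) * (m.1.1ᵀ * basisD i j * m.1.1) *
          (cayleyMat z.1 * (1 - s)) := by simp only [Matrix.mul_assoc]
    _ = _ := by rw [h1, h2]

theorem extChartAt_cot_self {n : ℕ} (m : CotSO n) : extChartAt (cotI n) m m = (0, covec m) := by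
  have h1 : (extChartAt (cotI n) m m).1 = 0 := cayleyChart_self m.1
  refine Prod.ext h1 ?_
  have h2 : cotPt m (extChartAt (cotI n) m m) = m := extChartAt_to_inv m
  ext b
  have h3 := covec_cotPt m (extChartAt (cotI n) m m) b
  rw [h2, h1] at h3
  simpa [skewMat_zero, skewCoord_skewMat] using h3.symm

/-! ### Smoothness and differentials read in the centred charts. -/

theorem continuousAt_of_cotPt {n : ℕ} {f : CotSO n → ℝ} {m : CotSO n}
    (h : ContinuousAt (fun z => f (cotPt m z)) (extChartAt (cotI n) m m)) : ContinuousAt f m := by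
  have h1 : ContinuousAt (fun x => f (cotPt m (extChartAt (cotI n) m x))) m :=
    ContinuousAt.comp (f := extChartAt (cotI n) m) (g := fun z => f (cotPt m z)) h
      (continuousAt_extChartAt m)
  refine h1.congr ?_
  filter_upwards [extChartAt_source_mem_nhds (I := cotI n) m] with x hx
  exact congrArg f ((extChartAt (cotI n) m).left_inv hx)

theorem hasMFDerivAt_of_cotPt {n : ℕ} {f : CotSO n → ℝ} {m : CotSO n} {f' : CotModel n →L[ℝ] ℝ}
    (h : HasFDerivAt (fun z => f (cotPt m z)) f' (0, covec m)) :
    HasMFDerivAt (cotI n) 𝓘(ℝ, ℝ) f m f' := by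
  rw [← extChartAt_cot_self m] at h
  exact ⟨continuousAt_of_cotPt h.continuousAt, h.hasFDerivWithinAt⟩

theorem dAt_eq_fderiv {n : ℕ} {f : CotSO n → ℝ} {m : CotSO n}
    (h : DifferentiableAt ℝ (fun z => f (cotPt m z)) (0, covec m)) :
    dAt f m = fderiv ℝ (fun z => f (cotPt m z)) (0, covec m) :=
  (hasMFDerivAt_of_cotPt h.hasFDerivAt).mfderiv

theorem contMDiff_of_cotPt {n : ℕ} {f : CotSO n → ℝ}
    (h : ∀ m, ContDiff ℝ ∞ (fun z => f (cotPt m z))) :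
    ContMDiff (cotI n) 𝓘(ℝ, ℝ) ∞ f := by
  intro m
  rw [contMDiffAt_iff]
  exact ⟨continuousAt_of_cotPt (h m).continuous.continuousAt, (h m).contDiffWithinAt⟩

theorem differentiableAt_cotPt {n : ℕ} {f : CotSO n → ℝ}
    (h : ContMDiff (cotI n) 𝓘(ℝ, ℝ) ∞ f) (m : CotSO n) :
    DifferentiableAt ℝ (fun z => f (cotPt m z)) (0, covec m) := by
  have h1 := (contMDiffAt_iff.1 (h m)).2.differentiableWithinAt (by simp)
  rw [extChartAt_cot_self] at h1
  have h2 : Set.range (cotI n) = Set.univ := by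
    rw [ModelWithCorners.range_eq_univ]
  rw [h2, differentiableWithinAt_univ] at h1
  exact h1

theorem fderiv_eq_of_line {E : Type*} [NormedAddCommGroup E] [NormedSpace ℝ E] {F : E → ℝ} {x w : E}
    {d : ℝ} (hF : DifferentiableAt ℝ F x) (h : HasDerivAt (fun t : ℝ => F (x + t • w)) d 0) :
    fderiv ℝ F x w = d := by
  have hl : HasDerivAt (fun t : ℝ => x + t • w) w 0 := by
    simpa using ((hasDerivAt_id (0 : ℝ)).smul_const w).const_add x
  have h2 := HasFDerivAt.comp_hasDerivAt (0 : ℝ) (f := fun t : ℝ => x + t • w) (f' := w)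
    (by rw [zero_smul, add_zero]; exact hF.hasFDerivAt) hl
  exact h2.unique h

/-! ### The Lie-Poisson form and the differentials of the momenta. -/

/-- The form `(a, b) ↦ p([a, b])` on `so(n)`. -/
def liePoisson {n : ℕ} (p : SOModel n →L[ℝ] ℝ) : SOModel n →ₗ[ℝ] SOModel n →ₗ[ℝ] ℝ :=
  LinearMap.mk₂ ℝ (fun a b => p (skewCoordₗ n (skewMatₗ n a * skewMatₗ n b - skewMatₗ n b * skewMatₗ n a)))
    (fun a b c => by rw [← map_add, ← map_add, map_add (skewMatₗ n)]; congr 2; noncomm_ring)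
    (fun r a b => by
      rw [← map_smul, ← map_smul, map_smul (skewMatₗ n), smul_sub, Matrix.smul_mul, Matrix.mul_smul])
    (fun a b c => by rw [← map_add, ← map_add, map_add (skewMatₗ n)]; congr 2; noncomm_ring)
    (fun r a b => by
      rw [← map_smul, ← map_smul, map_smul (skewMatₗ n), smul_sub, Matrix.smul_mul, Matrix.mul_smul])

theorem liePoisson_apply {n : ℕ} (p : SOModel n →L[ℝ] ℝ) (a b : SOModel n) :
    liePoisson p a b = p (skewCoord (skewMat a * skewMat b - skewMat b * skewMat a)) := rfl

/-- The covector `(x, π) ↦ π(a) + c(x, a) / 2` at `m`. -/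
def covector {n : ℕ} (m : CotSO n) (c : SOModel n →ₗ[ℝ] SOModel n →ₗ[ℝ] ℝ) :
    SOModel n →ₗ[ℝ] CotangentAt m where
  toFun a := (LinearMap.toContinuousLinearMap
    ((ContinuousLinearMap.coeLM ℝ ∘ₗ LinearMap.snd ℝ (SOModel n) (SOModel n →L[ℝ] ℝ)).flip a +
      (1 / 2 : ℝ) • (c ∘ₗ LinearMap.fst ℝ (SOModel n) (SOModel n →L[ℝ] ℝ)).flip a) :
      CotModel n →L[ℝ] ℝ)
  map_add' a b := by
    refine ContinuousLinearMap.ext fun z => ?_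
    change z.2 (a + b) + (1 / 2 : ℝ) * c z.1 (a + b) =
      (z.2 a + (1 / 2 : ℝ) * c z.1 a) + (z.2 b + (1 / 2 : ℝ) * c z.1 b)
    rw [map_add, map_add]; ring
  map_smul' r a := by
    refine ContinuousLinearMap.ext fun z => ?_
    change z.2 (r • a) + (1 / 2 : ℝ) * c z.1 (r • a) = r * (z.2 a + (1 / 2 : ℝ) * c z.1 a)
    rw [map_smul, map_smul, smul_eq_mul, smul_eq_mul]; ring

theorem hasDerivAt_cubic (a b c d : ℝ) :
    HasDerivAt (fun t : ℝ => a + t * b + t ^ 2 * c + t ^ 3 * d) b 0 := by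
  have h1 : HasDerivAt (fun t : ℝ => t) 1 0 := hasDerivAt_id 0
  have h := ((((hasDerivAt_const (0 : ℝ) a).add (h1.mul_const b))).add
    ((hasDerivAt_pow 2 (0 : ℝ)).mul_const c)).add ((hasDerivAt_pow 3 (0 : ℝ)).mul_const d)
  refine h.congr_deriv ?_
  simp

/-- The momentum function of the (skew) matrix `A` in canonical coordinates:
`(x, π) ↦ π((1 + x/2) A (1 - x/2))`. -/
def momentumChart {n : ℕ} (A : Matrix (Fin n) (Fin n) ℝ) (s : ℝ) (z : CotModel n) : ℝ :=
  z.2 (skewCoord ((1 + s • skewMat z.1) * A * (1 - s • skewMat z.1)))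

theorem contDiff_momentumChart {n : ℕ} (A : Matrix (Fin n) (Fin n) ℝ) (s : ℝ) (k : WithTop ℕ∞) :
    ContDiff ℝ k (momentumChart A s) := by
  refine contDiff_snd.clm_apply ?_
  have h : EntryContDiffOn k (fun a : SOModel n => (1 + s • skewMat a) * A * (1 - s • skewMat a))
      Set.univ :=
    (((EntryContDiffOn.const 1).add ((entryContDiffOn_skewMat k _).smul s)).mul
      (EntryContDiffOn.const A)).mul
      ((EntryContDiffOn.const 1).sub ((entryContDiffOn_skewMat k _).smul s))
  have h2 : ContDiff ℝ k fun a : SOModel n =>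
      skewCoord ((1 + s • skewMat a) * A * (1 - s • skewMat a)) :=
    contDiff_pi.2 fun q => contDiffOn_univ.1 (h q.1.1 q.1.2)
  exact h2.comp contDiff_fst

theorem fderiv_momentumChart {n : ℕ} {A : Matrix (Fin n) (Fin n) ℝ} (hA : Aᵀ = -A) (s : ℝ)
    (p : SOModel n →L[ℝ] ℝ) (w : CotModel n) :
    fderiv ℝ (momentumChart A s) (0, p) w =
      w.2 (skewCoord A) + s * liePoisson p w.1 (skewCoord A) := by
  refine fderiv_eq_of_line ((contDiff_momentumChart A s 1).differentiable (by simp) _) ?_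
  -- The function is quadratic in `x` and linear in `π`, so on a line it is a cubic in `t`, and only
  -- the linear coefficient matters.
  have key : ∀ t : ℝ, momentumChart A s ((0, p) + t • w) =
      (p (skewCoord A)) + t * (w.2 (skewCoord A) + s * liePoisson p w.1 (skewCoord A)) +
      t ^ 2 * (s * liePoisson w.2 w.1 (skewCoord A) +
        (-s ^ 2) * p (skewCoord (skewMat w.1 * A * skewMat w.1))) +
      t ^ 3 * ((-s ^ 2) * w.2 (skewCoord (skewMat w.1 * A * skewMat w.1))) := by
    intro t
    have e : (1 + s • skewMat (t • w.1)) * A * (1 - s • skewMat (t • w.1)) =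
        A + (t * s) • (skewMat w.1 * A - A * skewMat w.1) +
          (-(t * s) ^ 2) • (skewMat w.1 * A * skewMat w.1) := by
      rw [skewMat_smul, smul_smul, mul_comm s t, neg_smul, pow_two, ← smul_smul (t * s)]
      simp only [add_mul, mul_sub, one_mul, mul_one, Matrix.smul_mul, Matrix.mul_smul, smul_sub]
      abel
    have e2 : skewCoord ((1 + s • skewMat (t • w.1)) * A * (1 - s • skewMat (t • w.1))) =
        skewCoord A + (t * s) • skewCoord (skewMat w.1 * A - A * skewMat w.1) +
          (-(t * s) ^ 2) • skewCoord (skewMat w.1 * A * skewMat w.1) := by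
      rw [e]; rfl
    rw [liePoisson_apply, liePoisson_apply, skewMat_skewCoord hA]
    change (p + t • w.2) (skewCoord ((1 + s • skewMat (0 + t • w.1)) * A *
      (1 - s • skewMat (0 + t • w.1)))) = _
    rw [zero_add, e2]
    simp only [_root_.add_apply, _root_.smul_apply, map_add, map_smul,
      smul_eq_mul]
    ring
  rw [funext key]
  exact hasDerivAt_cubic _ _ _ _

theorem PL_cotPt_eq {n : ℕ} (m : CotSO n) (i j : Fin n) :
    (fun z => PL (cotPt m z) i j) = momentumChart (basisD i j) (1 / 2) :=
  funext fun z => PL_cotPt m z i j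

theorem PR_cotPt_eq {n : ℕ} (m : CotSO n) (i j : Fin n) :
    (fun z => PR (cotPt m z) i j) = momentumChart (m.1.1ᵀ * basisD i j * m.1.1) (-(1 / 2)) := by
  funext z
  rw [PR_cotPt, momentumChart, neg_smul, sub_neg_eq_add, ← sub_eq_add_neg]

theorem dAt_PL {n : ℕ} (m : CotSO n) (i j : Fin n) :
    dAt (fun m => PL m i j) m = covector m (liePoisson (covec m)) (skewCoord (basisD i j)) := by
  rw [dAt_eq_fderiv]
  · rw [PL_cotPt_eq]
    exact ContinuousLinearMap.ext fun w => fderiv_momentumChart (basisD_transpose i j) _ _ _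
  · rw [PL_cotPt_eq]
    exact (contDiff_momentumChart _ _ 1).differentiable (by simp) _

theorem dAt_PR {n : ℕ} (m : CotSO n) (i j : Fin n) :
    dAt (fun m => PR m i j) m = covector m (-liePoisson (covec m))
      (skewCoord (m.1.1ᵀ * basisD i j * m.1.1)) := by
  rw [dAt_eq_fderiv]
  · rw [PR_cotPt_eq]
    refine ContinuousLinearMap.ext fun w => ?_
    refine (fderiv_momentumChart (conj_transpose_neg _ (basisD_transpose i j)) _ _ _).trans ?_
    change _ = w.2 _ + (1 / 2 : ℝ) * (-(liePoisson (covec m) w.1 _))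
    ring
  · rw [PR_cotPt_eq]
    exact (contDiff_momentumChart _ _ 1).differentiable (by simp) _

/-! ### Poisson linear algebra of left and right covectors. -/

/-- The elements of `H` orthogonal to `H` with respect to the bilinear form `c`. -/
def radicalOn {E : Type*} [AddCommGroup E] [Module ℝ E] (c : E →ₗ[ℝ] E →ₗ[ℝ] ℝ)
    (H : Submodule ℝ E) : Submodule ℝ E where
  carrier := {a | a ∈ H ∧ ∀ b ∈ H, c a b = 0}
  zero_mem' := ⟨H.zero_mem, by simp⟩
  add_mem' := fun ⟨h1, h2⟩ ⟨h3, h4⟩ => ⟨H.add_mem h1 h3, fun b hb => by simp [h2 b hb, h4 b hb]⟩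
  smul_mem' := fun r _ ⟨h1, h2⟩ => ⟨H.smul_mem r h1, fun b hb => by simp [h2 b hb]⟩

theorem mem_skewOrth {n : ℕ} {m : CotSO n} {L : Submodule ℝ (CotangentAt m)} {α : CotangentAt m} :
    α ∈ skewOrth L ↔ ∀ β ∈ L, poissonTensor m α β = 0 := Iff.rfl

section
variable {n : ℕ} (m : CotSO n) (c : SOModel n →ₗ[ℝ] SOModel n →ₗ[ℝ] ℝ)

theorem covector_vecP (a : SOModel n) (r : SOPair n) : covector m c a (vecP m r) = a r := by
  change a r + (1 / 2 : ℝ) * c 0 a = a r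
  simp

theorem covector_vecX (a : SOModel n) (r : SOPair n) :
    covector m c a (vecX m r) = (1 / 2 : ℝ) * c (Pi.single r 1) a := by
  change (0 : ℝ) + _ = _
  rw [zero_add]; rfl

theorem sum_mul_form (a b : SOModel n) : ∑ r, a r * c (Pi.single r 1) b = c a b := by
  have h := LinearMap.pi_apply_eq_sum_univ (c.flip b) a
  simp only [LinearMap.flip_apply, smul_eq_mul] at h
  rw [h]
  refine Finset.sum_congr rfl fun r _ => ?_
  congr 3
  funext j
  simp [Pi.single_apply, eq_comm]

theorem poissonTensor_covector_right (α : CotangentAt m) (b : SOModel n) :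
    poissonTensor m α (covector m c b) =
      (1 / 2 : ℝ) * c (fun r => α (vecP m r)) b - ∑ r, α (vecX m r) * b r := by
  rw [poissonTensor, ← sum_mul_form c, Finset.mul_sum, ← Finset.sum_sub_distrib]
  refine Finset.sum_congr rfl fun r _ => ?_
  rw [covector_vecP, covector_vecX]
  ring

theorem poissonTensor_covector (c' : SOModel n →ₗ[ℝ] SOModel n →ₗ[ℝ] ℝ) (a b : SOModel n) :
    poissonTensor m (covector m c a) (covector m c' b) =
      (1 / 2 : ℝ) * c' a b - (1 / 2 : ℝ) * c b a := by
  rw [poissonTensor_covector_right]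
  congr 1
  · congr 2
    have : (fun r => covector m c a (vecP m r)) = a := funext fun r => covector_vecP m c a r
    rw [this]
  · rw [← sum_mul_form c, Finset.mul_sum]
    refine Finset.sum_congr rfl fun r _ => ?_
    rw [covector_vecX]
    ring

theorem cotangent_ext {α β : CotangentAt m} (hP : ∀ r, α (vecP m r) = β (vecP m r))
    (hX : ∀ r, α (vecX m r) = β (vecX m r)) : α = β := by
  have key : ∀ (γ : CotModel n →L[ℝ] ℝ) (z : CotModel n), γ z =
      (∑ r, z.1 r * γ (Pi.single r 1, 0)) +
        ∑ r, z.2 (Pi.single r 1) * γ (0, ContinuousLinearMap.proj r) := by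
    intro γ z
    have h1 : z = (∑ r, z.1 r • ((Pi.single r 1, 0) : CotModel n)) +
        ∑ r, z.2 (Pi.single r 1) • ((0, ContinuousLinearMap.proj r) : CotModel n) := by
      refine Prod.ext ?_ ?_
      · simp only [Prod.fst_add, Prod.fst_sum, Prod.smul_fst, smul_zero, Finset.sum_const_zero,
          add_zero]
        funext q
        simp [Finset.sum_apply, Pi.single_apply]
      · simp only [Prod.snd_add, Prod.snd_sum, Prod.smul_snd, smul_zero, Finset.sum_const_zero,
          zero_add]
        ext v
        have h := LinearMap.pi_apply_eq_sum_univ z.2.toLinearMap v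
        simp only [smul_eq_mul] at h
        refine h.trans ?_
        rw [_root_.sum_apply]
        refine Finset.sum_congr rfl fun r _ => ?_
        change _ = z.2 _ * v r
        have : (fun j => if r = j then (1 : ℝ) else 0) = Pi.single r 1 := by
          funext j
          simp [Pi.single_apply, eq_comm]
        rw [mul_comm, this]
        rfl
    conv_lhs => rw [h1]
    simp only [map_add, map_sum, map_smul, smul_eq_mul]
  refine ContinuousLinearMap.ext fun z => ?_
  refine (key α z).trans (Eq.trans ?_ (key β z).symm)
  congr 1
  · exact Finset.sum_congr rfl fun r _ => congrArg _ (hX r)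
  · exact Finset.sum_congr rfl fun r _ => congrArg _ (hP r)

variable {c}

/-- This is how `ker c` enters `Span dB^λ`: the left covector of a kernel element is also a right
covector, even if the element lies outside `H`. -/
theorem covector_neg_eq {k : SOModel n} (hc : ∀ a b, c a b = -c b a) (hk : c k = 0) :
    covector m (-c) k = covector m c k := by
  have : ∀ a, c a k = 0 := fun a => by rw [hc, hk]; simp
  refine cotangent_ext m (fun r => ?_) fun r => ?_
  · rw [covector_vecP, covector_vecP]
  · rw [covector_vecX, covector_vecX]; simp [this]

theorem poissonTensor_left_left (hc : ∀ a b, c a b = -c b a) (a b : SOModel n) :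
    poissonTensor m (covector m c a) (covector m c b) = c a b := by
  rw [poissonTensor_covector, hc b a]; ring

theorem poissonTensor_left_right (hc : ∀ a b, c a b = -c b a) (a b : SOModel n) :
    poissonTensor m (covector m c a) (covector m (-c) b) = 0 := by
  rw [poissonTensor_covector, hc b a]
  simp

/-- The values of `α` on the vectors `∂/∂p_r` determine `a`; orthogonality to the right covector of
each basis vector then fixes the values on `∂/∂x_r`. -/
theorem exists_covector_of_orth_right (hc : ∀ a b, c a b = -c b a) {α : CotangentAt m}
    (h : ∀ b, poissonTensor m α (covector m (-c) b) = 0) : ∃ a, α = covector m c a := by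
  refine ⟨fun r => α (vecP m r), cotangent_ext m (fun r => ?_) fun r => ?_⟩
  · rw [covector_vecP]
  · have h1 := h (Pi.single r 1)
    rw [poissonTensor_covector_right] at h1
    rw [covector_vecX, hc]
    simp only [LinearMap.neg_apply, Pi.single_apply, mul_ite, mul_one, mul_zero,
      Finset.sum_ite_eq', Finset.mem_univ, if_true] at h1
    linarith

/-- The `∂/∂p_r` components give `b = -a`. The two terms of the `∂/∂x_r` components then add up
instead of cancelling, because both the form and the argument change sign. -/
theorem covector_add_covector_eq_zero (hc : ∀ a b, c a b = -c b a) {a b : SOModel n}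
    (h : covector m c a + covector m (-c) b = 0) : b = -a ∧ c a = 0 := by
  have h1 : ∀ v, covector m c a v + covector m (-c) b v = 0 := fun v =>
    congrArg (fun L : CotangentAt m => L v) h
  have hb : b = -a := by
    funext r
    have := h1 (vecP m r)
    rw [covector_vecP, covector_vecP] at this
    simp only [Pi.neg_apply]
    linarith
  refine ⟨hb, ?_⟩
  have h2 : ∀ r, c (Pi.single r 1) a = 0 := by
    intro r
    have := h1 (vecX m r)
    rw [covector_vecX, covector_vecX, hb] at this
    simp only [LinearMap.neg_apply, map_neg] at this
    linarith
  refine LinearMap.ext fun v => ?_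
  rw [hc, ← sum_mul_form]
  simp [h2]

theorem mem_skewOrth_sup {H : Submodule ℝ (SOModel n)} {α : CotangentAt m}
    (hL : ∀ b ∈ H, poissonTensor m α (covector m c b) = 0)
    (hR : ∀ b, poissonTensor m α (covector m (-c) b) = 0) :
    α ∈ skewOrth (H.map (covector m c) ⊔ LinearMap.range (covector m (-c))) := by
  rw [mem_skewOrth]
  intro β hβ
  obtain ⟨_, ⟨b, hb, rfl⟩, _, ⟨b', rfl⟩, rfl⟩ := Submodule.mem_sup.1 hβ
  have h1 := hL b hb
  have h2 := hR b'
  have h3 : ∀ v, (covector m c b + covector m (-c) b') v =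
    covector m c b v + covector m (-c) b' v := fun _ => rfl
  rw [poissonTensor] at h1 h2 ⊢
  simp only [h3]
  rw [← add_zero (0 : ℝ)]
  nth_rewrite 1 [← h1]
  rw [← h2, ← Finset.sum_add_distrib]
  exact Finset.sum_congr rfl fun r _ => by ring

/-- An element orthogonal to the right covectors is a left covector of some `a`. Belonging to the
sum makes `a` congruent modulo `ker c` to some `a' ∈ H`, and orthogonality to the left covectors of
`H` puts `a'` in the radical, kernel elements being invisible to `c`. -/
theorem inf_skewOrth_eq (hc : ∀ a b, c a b = -c b a) (H : Submodule ℝ (SOModel n)) :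
    (H.map (covector m c) ⊔ LinearMap.range (covector m (-c))) ⊓
        skewOrth (H.map (covector m c) ⊔ LinearMap.range (covector m (-c))) =
      (radicalOn c H ⊔ LinearMap.ker c).map (covector m c) := by
  apply le_antisymm
  · rintro α ⟨hα, ho⟩
    rw [SetLike.mem_coe, mem_skewOrth] at ho
    obtain ⟨a, rfl⟩ := exists_covector_of_orth_right m hc fun b =>
      ho _ (Submodule.mem_sup_right ⟨b, rfl⟩)
    obtain ⟨_, ⟨a', ha', rfl⟩, _, ⟨b, rfl⟩, hab⟩ := Submodule.mem_sup.1 hα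
    have h1 : covector m c (a' - a) + covector m (-c) b = 0 := by
      rw [map_sub, ← hab]; abel
    have hk := (covector_add_covector_eq_zero m hc h1).2
    refine ⟨a, ?_, rfl⟩
    have ha : a = a' + -(a' - a) := by abel
    rw [ha]
    refine Submodule.add_mem_sup ⟨ha', fun b' hb' => ?_⟩ (Submodule.neg_mem _ hk)
    have h2 := ho _ (Submodule.mem_sup_left ⟨b', hb', rfl⟩)
    rw [poissonTensor_left_left m hc] at h2
    have h3 : c a' = c a := sub_eq_zero.1 (by rw [← map_sub]; exact hk)
    rw [h3, h2]
  · rw [Submodule.map_le_iff_le_comap, sup_le_iff]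
    constructor
    · rintro a ⟨ha, hab⟩
      refine ⟨Submodule.mem_sup_left ⟨a, ha, rfl⟩, mem_skewOrth_sup m (fun b hb => ?_) fun b => ?_⟩
      · rw [poissonTensor_left_left m hc, hab b hb]
      · exact poissonTensor_left_right m hc a b
    · intro k hk
      have hk' : c k = 0 := hk
      refine ⟨Submodule.mem_sup_right ⟨k, covector_neg_eq m hc hk'⟩,
        mem_skewOrth_sup m (fun b hb => ?_) fun b => ?_⟩
      · rw [poissonTensor_left_left m hc, hk', LinearMap.zero_apply]
      · exact poissonTensor_left_right m hc k b

theorem covector_injective : Function.Injective (covector m c) := by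
  intro a b h
  funext r
  rw [← covector_vecP m c a r, ← covector_vecP m c b r, h]

/-- The map `(a, b) ↦ covector m c a + covector m (-c) b` is injective on `H × so(n)` when no nonzero element
of `H` is in the kernel of `c`. -/
theorem finrank_sup_covector (hc : ∀ a b, c a b = -c b a) {H : Submodule ℝ (SOModel n)}
    (hH : ∀ a ∈ H, c a = 0 → a = 0) :
    Module.finrank ℝ
        (H.map (covector m c) ⊔ LinearMap.range (covector m (-c)) : Submodule ℝ (CotangentAt m)) =
      Module.finrank ℝ H + Module.finrank ℝ (SOModel n) := by
  have h1 : H.map (covector m c) ⊔ LinearMap.range (covector m (-c)) =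
      LinearMap.range (((covector m c).domRestrict H).coprod (covector m (-c))) := by
    rw [LinearMap.range_coprod, LinearMap.range_domRestrict]
  rw [h1, LinearMap.finrank_range_of_inj, Module.finrank_prod]
  rw [injective_iff_map_eq_zero]
  rintro ⟨a, b⟩ hab
  rw [LinearMap.coprod_apply, LinearMap.domRestrict_apply] at hab
  obtain ⟨hb, ha⟩ := covector_add_covector_eq_zero m hc hab
  have := hH a a.2 ha
  refine Prod.ext (Subtype.ext this) ?_
  have hb' : b = -(a : SOModel n) := hb
  change b = 0
  rw [hb', this, neg_zero]

end

/-! ### Derivatives of the coefficients of the characteristic polynomial. -/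

section
open Polynomial
variable {ι : Type} [Fintype ι] [DecidableEq ι]

/-- Jacobi's formula for matrices of polynomials. -/
theorem derivative_det_eq_trace {R : Type*} [CommRing R] (M : Matrix ι ι R[X]) :
    derivative M.det = (M.adjugate * M.map derivative).trace := by
  -- By Cramer's rule each diagonal entry is a determinant with one column differentiated, so the
  -- formula becomes the Leibniz rule.
  have h : (M.adjugate * M.map derivative).trace =
      ∑ i, (M.updateCol i fun k => derivative (M k i)).det := by
    rw [Matrix.trace]
    refine Finset.sum_congr rfl fun i _ => ?_
    rw [← Matrix.cramer_apply, Matrix.cramer_eq_adjugate_mulVec]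
    rfl
  rw [h, Matrix.det_apply, derivative_sum]
  simp only [Matrix.det_apply]
  rw [Finset.sum_comm]
  refine Finset.sum_congr rfl fun σ _ => ?_
  rw [← Finset.smul_sum, derivative_smul, derivative_prod_finset]
  congr 1
  refine Finset.sum_congr rfl fun i _ => ?_
  rw [← Finset.mul_prod_erase Finset.univ _ (Finset.mem_univ i), mul_comm]
  congr 1
  · simp
  · refine Finset.prod_congr rfl fun j hj => ?_
    rw [Matrix.updateCol_ne (Finset.ne_of_mem_erase hj)]

/-- The matrix `∑_k c_{j+k} A^k`, where `det (t - A) = ∑_i c_i t^i`: the quotient of the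
characteristic polynomial by `t^j`, evaluated at `A`. -/
def charpolyTail (A : Matrix ι ι ℝ) (j : ℕ) : Matrix ι ι ℝ :=
  ∑ k ∈ Finset.range (Fintype.card ι + 1 - j), A.charpoly.coeff (j + k) • A ^ k

/-- Horner's recursion for the characteristic polynomial evaluated at `A`. -/
theorem charpolyTail_eq_add (A : Matrix ι ι ℝ) (j : ℕ) :
    charpolyTail A j = A.charpoly.coeff j • 1 + A * charpolyTail A (j + 1) := by
  rcases Nat.lt_or_ge (Fintype.card ι) j with h | h
  · have h0 : A.charpoly.coeff j = 0 :=
      coeff_eq_zero_of_natDegree_lt (by rw [Matrix.charpoly_natDegree_eq_dim]; exact h)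
    simp [charpolyTail, h0, show Fintype.card ι + 1 - j = 0 by omega,
      show Fintype.card ι + 1 - (j + 1) = 0 by omega]
  · rw [charpolyTail, show Fintype.card ι + 1 - j = (Fintype.card ι + 1 - (j + 1)) + 1 by omega,
      Finset.sum_range_succ', charpolyTail, Finset.mul_sum, add_zero, pow_zero, add_comm]
    refine congrArg _ (Finset.sum_congr rfl fun k _ => ?_)
    rw [Matrix.mul_smul, pow_succ', show j + (k + 1) = j + 1 + k by ring]

theorem charpolyTail_zero (A : Matrix ι ι ℝ) : charpolyTail A 0 = 0 := by
  have h := Matrix.aeval_self_charpoly A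
  rw [aeval_eq_sum_range, Matrix.charpoly_natDegree_eq_dim] at h
  simpa [charpolyTail] using h

theorem charpolyTail_of_lt (A : Matrix ι ι ℝ) {j : ℕ} (h : Fintype.card ι < j) :
    charpolyTail A j = 0 := by
  simp [charpolyTail, show Fintype.card ι + 1 - j = 0 by omega]

/-- Horner's recursion replaces `A T_{j+1}` by `T_j - c_j`, so the product with `t - A` telescopes;
the lower end vanishes by Cayley-Hamilton. -/
theorem charmatrix_mul_sum (A : Matrix ι ι ℝ) (r : ℕ) :
    A.charmatrix * ∑ j ∈ Finset.range r, (X ^ j : ℝ[X]) • (charpolyTail A (j + 1)).map C =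
      (X ^ r : ℝ[X]) • (charpolyTail A r).map C +
        (∑ j ∈ Finset.range r, C (A.charpoly.coeff j) * X ^ j) • 1 := by
  induction r with
  | zero => simp [charpolyTail_zero]
  | succ r ih =>
    have h1 : (charpolyTail A r).map C =
        C (A.charpoly.coeff r) • (1 : Matrix ι ι ℝ[X]) + A.map C * (charpolyTail A (r + 1)).map C := by
      rw [charpolyTail_eq_add, ← Matrix.map_mul]
      ext i k : 2
      simp only [Matrix.map_apply, Matrix.add_apply, Matrix.smul_apply, Matrix.one_apply, C_add,
        smul_eq_mul, C_mul]
      split_ifs <;> simp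
    have h2 : A.charmatrix = (X : ℝ[X]) • (1 : Matrix ι ι ℝ[X]) - A.map C := by
      rw [Matrix.charmatrix]
      congr 1
      simp [Matrix.smul_one_eq_diagonal]
    rw [Finset.sum_range_succ, Matrix.mul_add, ih, Finset.sum_range_succ, h1, h2, add_smul,
      Matrix.mul_smul, Matrix.sub_mul, Matrix.smul_mul, Matrix.one_mul, smul_sub, smul_add,
      smul_smul, smul_smul, ← pow_succ, mul_comm (C _)]
    abel

/-- For `r = card ι + 1` the remaining tail is zero, so `t - A` times the sum is the characteristic
polynomial times `1`. Multiplying by the adjugate, one cancels this monic polynomial. -/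
theorem adjugate_charmatrix (A : Matrix ι ι ℝ) :
    A.charmatrix.adjugate =
      ∑ j ∈ Finset.range (Fintype.card ι + 1), (X ^ j : ℝ[X]) • (charpolyTail A (j + 1)).map C := by
  have h := charmatrix_mul_sum A (Fintype.card ι + 1)
  rw [charpolyTail_of_lt A (Nat.lt_succ_self _)] at h
  have h3 : ∑ j ∈ Finset.range (Fintype.card ι + 1), C (A.charpoly.coeff j) * X ^ j =
      A.charpoly := by
    conv_rhs => rw [A.charpoly.as_sum_range_C_mul_X_pow, Matrix.charpoly_natDegree_eq_dim]
  rw [h3] at h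
  have h1 := congrArg (fun N => A.charmatrix.adjugate * N) h
  simp only [← Matrix.mul_assoc, Matrix.adjugate_mul] at h1
  have h2 : A.charpoly • (∑ j ∈ Finset.range (Fintype.card ι + 1),
      (X ^ j : ℝ[X]) • (charpolyTail A (j + 1)).map C) = A.charpoly • A.charmatrix.adjugate := by
    have : (0 : Matrix ι ι ℝ).map (C : ℝ → ℝ[X]) = 0 := by ext i j : 2; simp
    rw [this] at h1
    simpa [Matrix.charpoly] using h1
  exact (smul_right_injective _ A.charpoly_monic.ne_zero h2).symm

/-- The derivative of a coefficient of the characteristic polynomial. -/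
theorem hasDerivAt_charpoly_coeff (A B : Matrix ι ι ℝ) (j : ℕ) :
    HasDerivAt (fun s : ℝ => (A + s • B).charpoly.coeff j)
      (-(charpolyTail A (j + 1) * B).trace) 0 := by
  -- `M` is the characteristic matrix of `A + s B` with `s` as the outer polynomial variable. The
  -- wanted derivative is the coefficient of `s` in `det M`, which Jacobi's formula computes.
  set M : Matrix ι ι ℝ[X][X] := A.charmatrix.map C - (X : ℝ[X][X]) • (B.map C).map C with hM
  have hev : ∀ s : ℝ, (A + s • B).charpoly = M.det.eval (C s) := by
    intro s
    rw [Matrix.charpoly, ← coe_evalRingHom, RingHom.map_det]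
    congr 1
    ext i k : 2
    simp only [hM, Matrix.charmatrix_apply, RingHom.mapMatrix_apply, Matrix.map_apply,
      Matrix.sub_apply, Matrix.smul_apply, Matrix.add_apply, coe_evalRingHom, eval_sub, eval_C,
      smul_eq_mul, eval_mul, eval_X, C_add, C_mul]
    ring_nf
  have hcoe : ∀ s : ℝ, (A + s • B).charpoly.coeff j =
      ∑ k ∈ Finset.range (M.det.natDegree + 1), (M.det.coeff k).coeff j * s ^ k := by
    intro s
    rw [hev, eval_eq_sum_range, finsetSum_coeff]
    refine Finset.sum_congr rfl fun k _ => ?_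
    rw [← C_pow, coeff_mul_C]
  have hone : (M.det.coeff 1).coeff j = -(charpolyTail A (j + 1) * B).trace := by
    have h1 : M.det.coeff 1 = (derivative M.det).eval 0 := by
      rw [← coeff_zero_eq_eval_zero, coeff_derivative]; simp
    have h2 : M.map (derivative : ℝ[X][X] → ℝ[X][X]) = -(B.map C).map C := by
      ext i k : 2
      simp only [hM, Matrix.map_apply, Matrix.sub_apply, Matrix.smul_apply, smul_eq_mul,
        derivative_sub, derivative_C, derivative_mul, derivative_X, one_mul, mul_zero, add_zero,
        zero_sub, Matrix.neg_apply]
    have h3 : (evalRingHom (0 : ℝ[X])).mapMatrix M = A.charmatrix := by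
      ext i k : 2
      simp [hM]
    have h4 : (evalRingHom (0 : ℝ[X])).mapMatrix ((B.map C).map C) = B.map C := by
      ext i k : 2
      simp
    have h5 : ∀ N : Matrix ι ι ℝ[X][X],
        (evalRingHom (0 : ℝ[X])) N.trace = ((evalRingHom (0 : ℝ[X])).mapMatrix N).trace := by
      intro N
      simp [Matrix.trace, map_sum]
    rw [h1, derivative_det_eq_trace, h2, ← coe_evalRingHom, h5, map_mul, RingHom.map_adjugate, h3,
      map_neg, h4, mul_neg, Matrix.trace_neg, coeff_neg, adjugate_charmatrix, Matrix.sum_mul,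
      Matrix.trace_sum, finsetSum_coeff]
    congr 1
    have h6 : ∀ k, ((X ^ k : ℝ[X]) • (charpolyTail A (k + 1)).map C * B.map C).trace.coeff j =
        if j = k then (charpolyTail A (k + 1) * B).trace else 0 := by
      intro k
      have : (charpolyTail A (k + 1)).map C * B.map C = (charpolyTail A (k + 1) * B).map C :=
        Matrix.map_mul.symm
      rw [Matrix.smul_mul, this, Matrix.trace_smul, smul_eq_mul, mul_comm]
      have h7 : ((charpolyTail A (k + 1) * B).map C).trace =
          C (charpolyTail A (k + 1) * B).trace := by
        rw [Matrix.trace, Matrix.trace, map_sum]; rfl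
      rw [h7, coeff_C_mul_X_pow]
    simp only [h6, Finset.sum_ite_eq, Finset.mem_range]
    split_ifs with hj
    · rfl
    · rw [charpolyTail_of_lt A (by omega)]; simp
  rw [funext hcoe, ← hone]
  have hd : HasDerivAt (fun s : ℝ => ∑ k ∈ Finset.range (M.det.natDegree + 1),
      (M.det.coeff k).coeff j * s ^ k) (∑ k ∈ Finset.range (M.det.natDegree + 1),
      (M.det.coeff k).coeff j * (k * 0 ^ (k - 1))) 0 :=
    HasDerivAt.fun_sum fun k _ => (hasDerivAt_pow k (0 : ℝ)).const_mul _
  refine hd.congr_deriv ?_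
  rw [Finset.sum_eq_single 1]
  · simp
  · intro k _ hk
    rcases k with _ | _ | k
    · simp
    · exact absurd rfl hk
    · simp
  · intro h
    have : M.det.natDegree < 1 := by simpa using h
    rw [coeff_eq_zero_of_natDegree_lt this]; simp
end

/-! ### Cyclic skew matrices and the gradients of the Casimir functions. -/

section
variable {ι : Type} [Fintype ι] [DecidableEq ι]

/-- A matrix with a cyclic vector. -/
def IsCyclicMat (A : Matrix ι ι ℝ) : Prop :=
  ∃ v : ι → ℝ, LinearIndependent ℝ fun k : Fin (Fintype.card ι) => (A ^ (k : ℕ)) *ᵥ v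

theorem IsCyclicMat.linearIndependent_pow {A : Matrix ι ι ℝ} (hA : IsCyclicMat A) :
    LinearIndependent ℝ fun k : Fin (Fintype.card ι) => A ^ (k : ℕ) := by
  obtain ⟨v, hv⟩ := hA
  exact LinearIndependent.of_comp ((Matrix.mulVecBilin ℝ ℝ).flip v) hv

/-- A matrix commuting with `A` is determined by its value on the cyclic vector `v`, and a
polynomial in `A` can be chosen with the same value there. -/
theorem IsCyclicMat.eq_sum_pow {A X : Matrix ι ι ℝ} (hA : IsCyclicMat A) (hX : X * A = A * X) :
    ∃ f : Fin (Fintype.card ι) → ℝ, X = ∑ k, f k • A ^ (k : ℕ) := by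
  obtain ⟨v, hv⟩ := hA
  have hspan : Submodule.span ℝ (Set.range fun k : Fin (Fintype.card ι) => (A ^ (k : ℕ)) *ᵥ v) = ⊤ :=
    hv.span_eq_top_of_card_eq_finrank' (by simp)
  have hmem : X *ᵥ v ∈
      Submodule.span ℝ (Set.range fun k : Fin (Fintype.card ι) => (A ^ (k : ℕ)) *ᵥ v) := by
    rw [hspan]; trivial
  obtain ⟨f, hf⟩ := (Submodule.mem_span_range_iff_exists_fun ℝ).1 hmem
  refine ⟨f, ?_⟩
  have hc : Commute X A := hX
  have hc' : Commute (∑ k, f k • A ^ (k : ℕ)) A :=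
    Commute.sum_left _ _ _ fun k _ => ((Commute.refl A).pow_left k).smul_left _
  have h0 : (∑ k, f k • A ^ (k : ℕ)) *ᵥ v = X *ᵥ v := by
    rw [← hf, Matrix.sum_mulVec]
    exact Finset.sum_congr rfl fun k _ => Matrix.smul_mulVec _ _ _
  apply Matrix.toLin'.injective
  refine LinearMap.ext_on_range hspan fun k => ?_
  rw [Matrix.toLin'_apply, Matrix.toLin'_apply, Matrix.mulVec_mulVec, Matrix.mulVec_mulVec,
    (hc.pow_right k).eq, (hc'.pow_right k).eq, ← Matrix.mulVec_mulVec, ← Matrix.mulVec_mulVec, h0]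

theorem transpose_pow_of_skew {A : Matrix ι ι ℝ} (hA : Aᵀ = -A) (k : ℕ) :
    (A ^ k)ᵀ = (-1 : ℝ) ^ k • A ^ k := by
  rw [Matrix.transpose_pow, hA]
  rcases Nat.even_or_odd k with h | h
  · rw [h.neg_pow, h.neg_one_pow, one_smul]
  · rw [h.neg_pow, h.neg_one_pow, neg_smul, one_smul]

/-- The gradient of the standard Casimir function `C_h` at `A`, up to a factor. -/
def casimirGrad (A : Matrix ι ι ℝ) (h : ℕ) : Matrix ι ι ℝ :=
  charpolyTail A (Fintype.card ι - 2 * h + 1) - (charpolyTail A (Fintype.card ι - 2 * h + 1))ᵀ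

theorem casimirGrad_transpose (A : Matrix ι ι ℝ) (h : ℕ) :
    (casimirGrad A h)ᵀ = -casimirGrad A h := by
  simp [casimirGrad]

theorem commute_charpolyTail (A : Matrix ι ι ℝ) (j : ℕ) : Commute (charpolyTail A j) A :=
  Commute.sum_left _ _ _ fun k _ => ((Commute.refl A).pow_left k).smul_left _

theorem commute_casimirGrad {A : Matrix ι ι ℝ} (hA : Aᵀ = -A) (h : ℕ) :
    Commute (casimirGrad A h) A := by
  have h1 := commute_charpolyTail A (Fintype.card ι - 2 * h + 1)
  refine h1.sub_left ?_
  have h2 := congrArg Matrix.transpose h1.eq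
  rw [Matrix.transpose_mul, Matrix.transpose_mul, hA, neg_mul, mul_neg] at h2
  exact (neg_injective h2).symm

/-- Transposition multiplies `A ^ k` by `(-1) ^ k`, so only odd powers up to `2 h - 1` survive. The
bound on `h` makes the truncated subtraction exact. -/
theorem casimirGrad_eq {A : Matrix ι ι ℝ} (hA : Aᵀ = -A) {h : ℕ} (hh : h ≤ Fintype.card ι / 2) :
    casimirGrad A h = ∑ k ∈ Finset.range (2 * h),
      (A.charpoly.coeff (Fintype.card ι - 2 * h + 1 + k) * (1 - (-1) ^ k)) • A ^ k := by
  have h1 : charpolyTail A (Fintype.card ι - 2 * h + 1) = ∑ k ∈ Finset.range (2 * h),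
      A.charpoly.coeff (Fintype.card ι - 2 * h + 1 + k) • A ^ k := by
    rw [charpolyTail, show Fintype.card ι + 1 - (Fintype.card ι - 2 * h + 1) = 2 * h by omega]
  rw [casimirGrad, h1, Matrix.transpose_sum, ← Finset.sum_sub_distrib]
  refine Finset.sum_congr rfl fun k _ => ?_
  rw [Matrix.transpose_smul, transpose_pow_of_skew hA, mul_smul, sub_smul, one_smul, smul_sub]

/-- The gradients are triangular in the odd powers of `A`, with leading coefficient `2` because the
characteristic polynomial is monic. -/
theorem odd_pow_mem_span_casimirGrad {A : Matrix ι ι ℝ} (hA : Aᵀ = -A) (h : ℕ)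
    (hh : h < Fintype.card ι / 2) :
    A ^ (2 * h + 1) ∈ Submodule.span ℝ
      (Set.range fun i : Fin (Fintype.card ι / 2) => casimirGrad A (i + 1)) := by
  induction h using Nat.strong_induction_on with
  | _ h ih =>
    have h1 := casimirGrad_eq hA (h := h + 1) hh
    have hlead : A.charpoly.coeff (Fintype.card ι - 2 * (h + 1) + 1 + (2 * h + 1)) = 1 := by
      rw [show Fintype.card ι - 2 * (h + 1) + 1 + (2 * h + 1) = Fintype.card ι by omega,
        ← Matrix.charpoly_natDegree_eq_dim A]
      exact A.charpoly_monic.coeff_natDegree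
    rw [show 2 * (h + 1) = 2 * h + 1 + 1 by ring, Finset.sum_range_succ,
      show Fintype.card ι - (2 * h + 1 + 1) = Fintype.card ι - 2 * (h + 1) by omega, hlead,
      Odd.neg_one_pow ⟨h, rfl⟩, one_mul, sub_neg_eq_add, one_add_one_eq_two] at h1
    have h2 : A ^ (2 * h + 1) = (1 / 2 : ℝ) • (casimirGrad A (h + 1) -
        ∑ k ∈ Finset.range (2 * h + 1),
          (A.charpoly.coeff (Fintype.card ι - 2 * (h + 1) + 1 + k) * (1 - (-1) ^ k)) • A ^ k) := by
      rw [h1, add_sub_cancel_left, smul_smul]; norm_num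
    rw [h2]
    refine Submodule.smul_mem _ _ (Submodule.sub_mem _ (Submodule.subset_span ⟨⟨h, hh⟩, rfl⟩)
      (Submodule.sum_mem _ fun k hk => ?_))
    rw [Finset.mem_range] at hk
    rcases Nat.even_or_odd' k with ⟨l, rfl | rfl⟩
    · simp
    · exact Submodule.smul_mem _ _ (ih l (by omega) (by omega))

/-- The skew matrices commuting with a cyclic skew matrix are spanned by the gradients of the
standard Casimir functions. -/
theorem IsCyclicMat.mem_span_casimirGrad {A X : Matrix ι ι ℝ} (hc : IsCyclicMat A) (hA : Aᵀ = -A)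
    (hX : X * A = A * X) (hXs : Xᵀ = -X) :
    X ∈ Submodule.span ℝ
      (Set.range fun i : Fin (Fintype.card ι / 2) => casimirGrad A (i + 1)) := by
  obtain ⟨f, hf⟩ := hc.eq_sum_pow hX
  have h1 : X = (1 / 2 : ℝ) • (X - Xᵀ) := by
    rw [hXs, sub_neg_eq_add, ← two_smul ℝ, smul_smul]; norm_num
  have h2 : X - Xᵀ = ∑ k, (f k * (1 - (-1) ^ (k : ℕ))) • A ^ (k : ℕ) := by
    conv_lhs => rw [hf]
    rw [Matrix.transpose_sum, ← Finset.sum_sub_distrib]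
    refine Finset.sum_congr rfl fun k _ => ?_
    rw [Matrix.transpose_smul, transpose_pow_of_skew hA, mul_smul, sub_smul, one_smul, smul_sub]
  rw [h1, h2]
  refine Submodule.smul_mem _ _ (Submodule.sum_mem _ fun k _ => ?_)
  rcases Nat.even_or_odd' (k : ℕ) with ⟨l, hl | hl⟩
  · rw [hl]; simp
  · rw [hl]
    exact Submodule.smul_mem _ _ (odd_pow_mem_span_casimirGrad hA l (by have := k.2; omega))

/-- The `[q/2]` gradients span the `[q/2]` odd powers, which are independent for a cyclic matrix; a
count of dimensions finishes. -/
theorem IsCyclicMat.linearIndependent_casimirGrad {A : Matrix ι ι ℝ} (hc : IsCyclicMat A)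
    (hA : Aᵀ = -A) :
    LinearIndependent ℝ fun i : Fin (Fintype.card ι / 2) => casimirGrad A (i + 1) := by
  have h1 : LinearIndependent ℝ fun i : Fin (Fintype.card ι / 2) => A ^ (2 * (i : ℕ) + 1) :=
    hc.linearIndependent_pow.comp
      (fun i : Fin (Fintype.card ι / 2) =>
        (⟨2 * (i : ℕ) + 1, by have := i.2; omega⟩ : Fin (Fintype.card ι)))
      fun i j hij => by
        have := congrArg Fin.val hij
        exact Fin.ext (by simpa using this)
  rw [linearIndependent_iff_card_le_finrank_span]
  have h2 := finrank_span_eq_card h1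
  rw [← h2]
  refine Submodule.finrank_mono (Submodule.span_le.2 ?_)
  rintro _ ⟨i, rfl⟩
  exact odd_pow_mem_span_casimirGrad hA i i.2

end

/-! ### Null sets in the charts of `T^*SO(n)`. -/

section
open MeasureTheory Filter

/-- An analytic function on a finite-dimensional space whose zero set is a cone and which is not
identically zero vanishes only on a null set. -/
theorem ae_ne_zero_of_homogeneous {E : Type*} [NormedAddCommGroup E] [NormedSpace ℝ E]
    [FiniteDimensional ℝ E] [MeasurableSpace E] [BorelSpace E] (μ : Measure E)
    [μ.IsAddHaarMeasure] {F : E → ℝ} (hF : ContDiff ℝ ω F)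
    (hom : ∀ c : ℝ, c ≠ 0 → ∀ x, F (c • x) = 0 → F x = 0) {v : E} (hv : F v ≠ 0) :
    ∀ᵐ x ∂μ, F x ≠ 0 := by
  have hmeas : MeasurableSet {x | F x ≠ 0} :=
    (isOpen_ne_fun hF.continuous continuous_const).measurableSet
  refine ae_mem_of_ae_add_linearMap_mem (LinearMap.toSpanSingleton ℝ E v) volume μ hmeas fun y => ?_
  have hg : ContDiff ℝ ω fun t : ℝ => F (y + t • v) :=
    hF.comp (contDiff_const.add (contDiff_id.smul contDiff_const))
  have han : AnalyticOnNhd ℝ (fun t : ℝ => F (y + t • v)) Set.univ :=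
    contDiff_omega_iff_analyticOnNhd.1 hg
  -- If `F` vanished on the whole line `y + t v`, homogeneity would make it vanish at `s y + v` for
  -- `s ≠ 0`, and `s → 0` would give `F v = 0`.
  have hex : ∃ t : ℝ, F (y + t • v) ≠ 0 := by
    by_contra hall
    push Not at hall
    have hc : Continuous fun s : ℝ => F (s • y + v) :=
      hF.continuous.comp ((continuous_id.smul continuous_const).add continuous_const)
    have h0 : ∀ s : ℝ, s ≠ 0 → F (s • y + v) = 0 := by
      intro s hs
      refine hom s⁻¹ (inv_ne_zero hs) _ ?_
      rw [smul_add, smul_smul, inv_mul_cancel₀ hs, one_smul]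
      exact hall s⁻¹
    have h1 : Tendsto (fun s : ℝ => F (s • y + v)) (nhdsWithin 0 {0}ᶜ) (nhds (F v)) := by
      have := hc.tendsto 0
      simp only [zero_smul, zero_add] at this
      exact this.mono_left nhdsWithin_le_nhds
    have h2 : Tendsto (fun s : ℝ => F (s • y + v)) (nhdsWithin 0 {0}ᶜ) (nhds 0) := by
      refine tendsto_const_nhds.congr' ?_
      filter_upwards [self_mem_nhdsWithin] with s hs
      exact (h0 s hs).symm
    exact hv (tendsto_nhds_unique h1 h2)
  obtain ⟨t, ht⟩ := hex
  have h3 := han.preimage_zero_mem_codiscrete ht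
  -- The zeros of a nonzero analytic function on a line are isolated, hence form a null set.
  have h4 := ae_restrict_le_codiscreteWithin (μ := (volume : Measure ℝ)) MeasurableSet.univ h3
  rw [Measure.restrict_univ] at h4
  exact h4

theorem almostEverywhere_iff {n : ℕ} {P : CotSO n → Prop} :
    AlmostEverywhere P ↔ ∀ m : CotSO n,
      ∀ᵐ z ∂(Measure.addHaar : Measure (CotModel n)), P (cotPt m z) := by
  refine forall_congr' fun m => ?_
  rw [extChartAt_target_cot, Set.univ_inter]
  rfl

theorem AlmostEverywhere.mono {n : ℕ} {P Q : CotSO n → Prop} (hP : AlmostEverywhere P)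
    (h : ∀ m, P m → Q m) : AlmostEverywhere Q := by
  rw [almostEverywhere_iff] at hP ⊢
  exact fun m => (hP m).mono fun z hz => h _ hz

theorem AlmostEverywhere.and {n : ℕ} {P Q : CotSO n → Prop} (hP : AlmostEverywhere P)
    (hQ : AlmostEverywhere Q) : AlmostEverywhere fun m => P m ∧ Q m := by
  rw [almostEverywhere_iff] at hP hQ ⊢
  exact fun m => (hP m).and (hQ m)

theorem AlmostEverywhere.finset_forall {n : ℕ} {κ : Type*} (s : Finset κ) {P : κ → CotSO n → Prop}
    (hP : ∀ k ∈ s, AlmostEverywhere (P k)) : AlmostEverywhere fun m => ∀ k ∈ s, P k m := by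
  rw [almostEverywhere_iff]
  intro m
  rw [Filter.eventually_all_finset]
  exact fun k hk => almostEverywhere_iff.1 (hP k hk) m

instance instNonemptyCotSO (n : ℕ) : Nonempty (CotSO n) := ⟨⟨1, (0 : SOModel n →L[ℝ] ℝ)⟩⟩

theorem AlmostEverywhere.exists {n : ℕ} {P : CotSO n → Prop} (hP : AlmostEverywhere P) :
    ∃ m, P m := by
  obtain ⟨m⟩ := instNonemptyCotSO n
  obtain ⟨z, hz⟩ := (almostEverywhere_iff.1 hP m).exists
  exact ⟨_, hz⟩

theorem skewMat_injective {n : ℕ} : Function.Injective (skewMat (n := n)) := fun a b h => by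
  rw [← skewCoord_skewMat a, h, skewCoord_skewMat]

theorem skewCoord_injective {n : ℕ} {A B : Matrix (Fin n) (Fin n) ℝ} (hA : Aᵀ = -A) (hB : Bᵀ = -B)
    (h : skewCoord A = skewCoord B) : A = B := by
  rw [← skewMat_skewCoord hA, h, skewMat_skewCoord hB]

theorem sum_mul_basisD {n : ℕ} (P : Matrix (Fin n) (Fin n) ℝ) (i j : Fin n) (hP : Pᵀ = -P) :
    ∑ r : SOPair n, basisD i j r.1.1 r.1.2 * P r.1.1 r.1.2 = P i j := by
  have hij : P j i = -P i j := congrFun (congrFun hP i) j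
  have hb : ∀ r : SOPair n, basisD i j r.1.1 r.1.2 =
      (if r.1 = (i, j) then 1 else 0) - (if r.1 = (j, i) then 1 else 0) := by
    intro r
    simp only [basisD, Matrix.sub_apply, Matrix.single_apply, Prod.ext_iff, eq_comm]
  simp only [hb]
  rcases lt_trichotomy i j with h | h | h
  · rw [Finset.sum_eq_single (⟨(i, j), h⟩ : SOPair n)]
    · simp [h.ne]
    · intro r _ hr
      have h1 : r.1 ≠ (i, j) := fun e => hr (Subtype.ext e)
      have h2 : r.1 ≠ (j, i) := fun e => by
        have := r.2; rw [e] at this; exact absurd this h.not_gt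
      simp [h1, h2]
    · simp
  · subst h
    simp only [sub_self, zero_mul, Finset.sum_const_zero]
    linarith
  · rw [Finset.sum_eq_single (⟨(j, i), h⟩ : SOPair n)]
    · simp [h.ne, hij]
    · intro r _ hr
      have h1 : r.1 ≠ (j, i) := fun e => hr (Subtype.ext e)
      have h2 : r.1 ≠ (i, j) := fun e => by
        have := r.2; rw [e] at this; exact absurd this h.not_gt
      simp [h1, h2]
    · simp

/-- The linear form on `so(n)` whose momentum matrix is `P`. -/
def formOfMatrix {n : ℕ} (P : Matrix (Fin n) (Fin n) ℝ) : SOModel n →ₗ[ℝ] ℝ where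
  toFun a := ∑ r : SOPair n, a r * P r.1.1 r.1.2
  map_add' a b := by simp [add_mul, Finset.sum_add_distrib]
  map_smul' c a := by simp [Finset.mul_sum, mul_assoc]

theorem formOfMatrix_basisD {n : ℕ} {P : Matrix (Fin n) (Fin n) ℝ} (hP : Pᵀ = -P) (i j : Fin n) :
    formOfMatrix P (skewCoord (basisD i j)) = P i j :=
  sum_mul_basisD P i j hP

/-- In every fibre of a chart, every skew matrix is the value of the momentum matrix. -/
theorem exists_PL_cotPt_eq {n : ℕ} (m : CotSO n) (a : SOModel n) {P : Matrix (Fin n) (Fin n) ℝ}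
    (hP : Pᵀ = -P) : ∃ π : SOModel n →L[ℝ] ℝ, PL (cotPt m (a, π)) = P := by
  set h : Matrix (Fin n) (Fin n) ℝ := (1 / 2 : ℝ) • skewMat a with hh
  let T : SOModel n →ₗ[ℝ] SOModel n :=
    skewCoordₗ n ∘ₗ LinearMap.mulRight ℝ (1 - h) ∘ₗ LinearMap.mulLeft ℝ (1 + h) ∘ₗ skewMatₗ n
  have hT : ∀ b, T b = skewCoord ((1 + h) * skewMat b * (1 - h)) := fun b => rfl
  have hsk : ∀ b : SOModel n, ((1 + h) * skewMat b * (1 - h))ᵀ = -((1 + h) * skewMat b * (1 - h)) := by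
    intro b
    have hh' : hᵀ = -h := half_skew _ a
    simp [Matrix.transpose_mul, hh', skewMat_transpose, Matrix.mul_assoc, sub_eq_add_neg]
  have hinj : Function.Injective T := by
    intro b b' hb
    have h1 := skewCoord_injective (hsk b) (hsk b') hb
    have hp := isUnit_det_add a
    have hm := isUnit_det_sub a
    have h2 := congrArg (fun N => (1 + h)⁻¹ * N * (1 - h)⁻¹) h1
    have h3 : ∀ N : Matrix (Fin n) (Fin n) ℝ,
        (1 + h)⁻¹ * ((1 + h) * N * (1 - h)) * (1 - h)⁻¹ = N := by
      intro N
      rw [Matrix.mul_assoc, Matrix.mul_assoc, Matrix.mul_assoc, Matrix.mul_nonsing_inv _ hm,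
        Matrix.mul_one, ← Matrix.mul_assoc, Matrix.nonsing_inv_mul _ hp, Matrix.one_mul]
    simp only [h3] at h2
    exact skewMat_injective h2
  let e := LinearEquiv.ofInjectiveEndo T hinj
  refine ⟨LinearMap.toContinuousLinearMap (formOfMatrix P ∘ₗ e.symm.toLinearMap), ?_⟩
  ext i j
  rw [PL_cotPt]
  change formOfMatrix P (e.symm _) = _
  rw [← formOfMatrix_basisD hP i j]
  congr 1
  rw [LinearEquiv.symm_apply_eq]
  change _ = T _
  rw [hT, skewMat_skewCoord (basisD_transpose i j)]

theorem PL_smul_cotPt {n : ℕ} (m : CotSO n) (a : SOModel n) (π : SOModel n →L[ℝ] ℝ) (c : ℝ) :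
    PL (cotPt m (a, c • π)) = c • PL (cotPt m (a, π)) := by
  ext i j
  rw [PL_cotPt, Matrix.smul_apply, PL_cotPt]
  rfl

/-- Fubini along the cotangent fibres: in every fibre the momentum matrix depends linearly on `π`
and takes every skew value, so a single skew `P` with `F P ≠ 0` controls all fibres at once. -/
theorem almostEverywhere_of_ne_zero {n : ℕ} {F : Matrix (Fin n) (Fin n) ℝ → ℝ}
    (hF : ∀ f : CotModel n → Matrix (Fin n) (Fin n) ℝ,
      (∀ i j, ContDiff ℝ ω fun z => f z i j) → ContDiff ℝ ω fun z => F (f z))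
    (hom : ∀ c : ℝ, c ≠ 0 → ∀ A, F (c • A) = 0 → F A = 0) {P : Matrix (Fin n) (Fin n) ℝ}
    (hP : Pᵀ = -P) (hFP : F P ≠ 0) : AlmostEverywhere fun m : CotSO n => F (PL m) ≠ 0 := by
  rw [almostEverywhere_iff]
  intro m
  have hΦ : ContDiff ℝ ω fun z => F (PL (cotPt m z)) :=
    hF _ fun i j => by rw [PL_cotPt_eq]; exact contDiff_momentumChart _ _ _
  have hmeas : MeasurableSet {z : CotModel n | F (PL (cotPt m z)) ≠ 0} :=
    (isOpen_ne_fun hΦ.continuous continuous_const).measurableSet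
  refine ae_mem_of_ae_add_linearMap_mem (LinearMap.inr ℝ (SOModel n) (SOModel n →L[ℝ] ℝ))
    Measure.addHaar Measure.addHaar hmeas fun y => ?_
  obtain ⟨π, hπ⟩ := exists_PL_cotPt_eq m y.1 hP
  have h1 : ∀ᵐ q ∂(Measure.addHaar : Measure (SOModel n →L[ℝ] ℝ)),
      F (PL (cotPt m (y.1, q))) ≠ 0 := by
    refine ae_ne_zero_of_homogeneous Measure.addHaar (F := fun q => F (PL (cotPt m (y.1, q))))
      (hΦ.comp (contDiff_const.prodMk contDiff_id)) (fun c hc q hq => ?_) (v := π) ?_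
    · rw [PL_smul_cotPt] at hq
      exact hom c hc _ hq
    · rw [hπ]; exact hFP
  have h2 := (measurePreserving_add_left (Measure.addHaar : Measure (SOModel n →L[ℝ] ℝ))
    y.2).quasiMeasurePreserving.ae h1
  refine h2.mono fun q hq => ?_
  have : y + LinearMap.inr ℝ (SOModel n) (SOModel n →L[ℝ] ℝ) q = (y.1, y.2 + q) := by
    refine Prod.ext ?_ rfl
    simp
  rw [this]
  exact hq
end

section
variable {W : Type*} [NormedAddCommGroup W] [NormedSpace ℝ W] {k : WithTop ℕ∞}

theorem contDiff_det {κ : Type*} [Fintype κ] [DecidableEq κ] {f : W → Matrix κ κ ℝ}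
    (hf : ∀ i j, ContDiff ℝ k fun w => f w i j) : ContDiff ℝ k fun w => (f w).det := by
  simp only [Matrix.det_apply']
  exact ContDiff.sum fun σ _ => contDiff_const.mul (contDiff_prod fun i _ => hf (σ i) i)

theorem contDiff_pow_mulVec {κ : Type*} [Fintype κ] [DecidableEq κ] {f : W → Matrix κ κ ℝ}
    (hf : ∀ i j, ContDiff ℝ k fun w => f w i j) (v : κ → ℝ) (r : ℕ) (i : κ) :
    ContDiff ℝ k fun w => ((f w ^ r) *ᵥ v) i := by
  induction r generalizing i with
  | zero => simp only [pow_zero, Matrix.one_mulVec]; exact contDiff_const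
  | succ r ih =>
    simp only [pow_succ', ← Matrix.mulVec_mulVec]
    simp only [Matrix.mulVec, dotProduct] at ih ⊢
    exact ContDiff.sum fun j _ => (hf i j).mul (ih j)

theorem contDiff_linear_comp {κ : Type*} [Fintype κ] [DecidableEq κ] {f : W → Matrix κ κ ℝ}
    (hf : ∀ i j, ContDiff ℝ k fun w => f w i j) (l : Matrix κ κ ℝ →ₗ[ℝ] ℝ) :
    ContDiff ℝ k fun w => l (f w) := by
  have : ∀ w, l (f w) = ∑ i, ∑ j, f w i j * l (Matrix.single i j 1) := by
    intro w
    conv_lhs => rw [Matrix.matrix_eq_sum_single (f w)]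
    simp only [map_sum]
    refine Finset.sum_congr rfl fun i _ => Finset.sum_congr rfl fun j _ => ?_
    rw [← smul_eq_mul, ← map_smul, Matrix.smul_single, smul_eq_mul, mul_one]
  simp only [this]
  exact ContDiff.sum fun i _ => ContDiff.sum fun j _ => (hf i j).mul contDiff_const
end

/-! ### Generic cyclicity of the momentum matrix and of its blocks. -/

/-- The skew matrix with `-1` above and `1` below the diagonal. -/
def tridiag (q : ℕ) : Matrix (Fin q) (Fin q) ℝ :=
  Matrix.of fun i j => if (i : ℕ) = j + 1 then 1 else if (j : ℕ) = i + 1 then -1 else 0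

theorem tridiag_transpose (q : ℕ) : (tridiag q)ᵀ = -tridiag q := by
  ext i j
  simp only [tridiag, Matrix.transpose_apply, Matrix.of_apply, Matrix.neg_apply]
  split_ifs <;> first | omega | simp

/-- The first basis vector. -/
def firstVec (q : ℕ) : Fin q → ℝ := fun i => if (i : ℕ) = 0 then 1 else 0

/-- Each application of `tridiag` moves the support of the vector at most one index further, with
new entry `1`; the Krylov matrix is therefore unitriangular. -/
theorem tridiag_pow_mulVec (q k : ℕ) (i : Fin q) :
    (k < i → ((tridiag q ^ k) *ᵥ firstVec q) i = 0) ∧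
      ((i : ℕ) = k → ((tridiag q ^ k) *ᵥ firstVec q) i = 1) := by
  induction k generalizing i with
  | zero =>
    simp only [pow_zero, Matrix.one_mulVec, firstVec]
    exact ⟨fun h => if_neg (by omega), fun h => if_pos h⟩
  | succ k ih =>
    rw [pow_succ', ← Matrix.mulVec_mulVec]
    set x := (tridiag q ^ k) *ᵥ firstVec q
    constructor
    · intro h
      change ∑ j, tridiag q i j * x j = 0
      refine Finset.sum_eq_zero fun j _ => ?_
      simp only [tridiag, Matrix.of_apply]
      split_ifs with h1 h2
      · rw [(ih j).1 (by omega), mul_zero]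
      · rw [(ih j).1 (by omega), mul_zero]
      · rw [zero_mul]
    · intro h
      change ∑ j, tridiag q i j * x j = 1
      rw [Finset.sum_eq_single (⟨k, by have := i.2; omega⟩ : Fin q)]
      · rw [(ih _).2 rfl, mul_one]
        simp [tridiag, h]
      · intro j _ hj
        simp only [tridiag, Matrix.of_apply]
        split_ifs with h1 h2
        · exact absurd (Fin.ext (by simp only; omega)) hj
        · rw [(ih j).1 (by omega), mul_zero]
        · rw [zero_mul]
      · simp

theorem det_krylov_tridiag (q : ℕ) :
    (Matrix.of fun i k : Fin q => ((tridiag q ^ (k : ℕ)) *ᵥ firstVec q) i).det = 1 := by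
  rw [Matrix.det_of_isUpperTriangular]
  · exact Finset.prod_eq_one fun i _ => (tridiag_pow_mulVec q i i).2 rfl
  · intro i k hik
    exact (tridiag_pow_mulVec q k i).1 hik

section
variable {ι : Type} [Fintype ι] [DecidableEq ι] {n : ℕ}

/-- The matrix whose columns are the basis vectors selected by `s`. -/
def selMat (s : ι → Fin n) : Matrix (Fin n) ι ℝ := (1 : Matrix (Fin n) (Fin n) ℝ).submatrix id s

/-- The extension by zero of a square matrix indexed by `ι` along `s : ι → Fin n`. -/
def extendMat (s : ι → Fin n) (N : Matrix ι ι ℝ) : Matrix (Fin n) (Fin n) ℝ :=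
  selMat s * N * (selMat s)ᵀ

theorem extendMat_transpose (s : ι → Fin n) (N : Matrix ι ι ℝ) :
    (extendMat s N)ᵀ = extendMat s Nᵀ := by
  simp [extendMat, Matrix.transpose_mul, Matrix.mul_assoc]

theorem extendMat_neg (s : ι → Fin n) (N : Matrix ι ι ℝ) :
    extendMat s (-N) = -extendMat s N := by
  rw [extendMat, extendMat, Matrix.mul_neg, Matrix.neg_mul]

theorem submatrix_eq_selMat (s : ι → Fin n) (P : Matrix (Fin n) (Fin n) ℝ) :
    P.submatrix s s = (selMat s)ᵀ * P * selMat s := by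
  ext i j
  simp [selMat, Matrix.mul_apply, Matrix.one_apply]

theorem selMat_transpose_mul {s : ι → Fin n} (hs : Function.Injective s) :
    (selMat s)ᵀ * selMat s = 1 := by
  ext i j
  simp [selMat, Matrix.mul_apply, Matrix.one_apply, hs.eq_iff]

theorem submatrix_extendMat {s : ι → Fin n} (hs : Function.Injective s) (N : Matrix ι ι ℝ) :
    (extendMat s N).submatrix s s = N := by
  rw [submatrix_eq_selMat, extendMat]
  calc (selMat s)ᵀ * (selMat s * N * (selMat s)ᵀ) * selMat s
      = ((selMat s)ᵀ * selMat s) * N * ((selMat s)ᵀ * selMat s) := by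
        simp only [Matrix.mul_assoc]
    _ = N := by rw [selMat_transpose_mul hs, Matrix.one_mul, Matrix.mul_one]

/-- The matrix of the vectors `A^k v`. -/
def krylovMat (A : Matrix ι ι ℝ) : Matrix (Fin (Fintype.card ι)) (Fin (Fintype.card ι)) ℝ :=
  Matrix.of fun i k =>
    ((A ^ (k : ℕ)) *ᵥ (firstVec (Fintype.card ι) ∘ Fintype.equivFin ι)) ((Fintype.equivFin ι).symm i)

theorem isCyclicMat_of_det {A : Matrix ι ι ℝ} (h : (krylovMat A).det ≠ 0) : IsCyclicMat A :=
  ⟨_, LinearIndependent.of_comp (LinearMap.funLeft ℝ ℝ (Fintype.equivFin ι).symm)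
    (Matrix.linearIndependent_cols_of_det_ne_zero h)⟩

theorem krylovMat_smul (A : Matrix ι ι ℝ) (c : ℝ) :
    (krylovMat (c • A)).det = (∏ k : Fin (Fintype.card ι), c ^ (k : ℕ)) * (krylovMat A).det := by
  rw [← Matrix.det_mul_row]
  congr 1
  ext i k
  simp only [krylovMat, Matrix.of_apply, smul_pow, Matrix.smul_mulVec]
  rfl

theorem det_krylovMat_tridiag :
    (krylovMat ((tridiag (Fintype.card ι)).submatrix (Fintype.equivFin ι) (Fintype.equivFin ι))).det =
      1 := by
  rw [← det_krylov_tridiag (Fintype.card ι)]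
  congr 1
  ext i k
  simp only [krylovMat, Matrix.of_apply]
  generalize (k : ℕ) = k
  have h : ((tridiag (Fintype.card ι)).submatrix (Fintype.equivFin ι) (Fintype.equivFin ι)) ^ k =
      (tridiag (Fintype.card ι) ^ k).submatrix (Fintype.equivFin ι) (Fintype.equivFin ι) := by
    have := map_pow (Matrix.reindexAlgEquiv ℝ ℝ (Fintype.equivFin ι).symm)
      (tridiag (Fintype.card ι)) k
    exact this.symm
  rw [h, Matrix.submatrix_mulVec_equiv]
  simp [Function.comp_def]

/-- Almost everywhere, a principal submatrix of the momentum matrix has a cyclic vector. -/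
theorem almostEverywhere_isCyclicMat {s : ι → Fin n} (hs : Function.Injective s) :
    AlmostEverywhere fun m : CotSO n => IsCyclicMat ((PL m).submatrix s s) := by
  refine (almostEverywhere_of_ne_zero (F := fun P => (krylovMat (P.submatrix s s)).det)
    (fun f hf => ?_) (fun c hc A hA => ?_)
    (P := extendMat s ((tridiag (Fintype.card ι)).submatrix (Fintype.equivFin ι) (Fintype.equivFin ι)))
    ?_ ?_).mono fun m hm => isCyclicMat_of_det hm
  · exact contDiff_det fun i k => contDiff_pow_mulVec (fun i j => hf (s i) (s j)) _ _ _
  · rw [show (c • A).submatrix s s = c • A.submatrix s s from rfl, krylovMat_smul] at hA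
    refine (mul_eq_zero.1 hA).resolve_left (Finset.prod_ne_zero_iff.2 fun k _ => pow_ne_zero _ hc)
  · rw [extendMat_transpose, Matrix.transpose_submatrix, tridiag_transpose]
    exact extendMat_neg s _
  · rw [submatrix_extendMat hs, det_krylovMat_tridiag]
    exact one_ne_zero
end

/-! ### Generically no block-diagonal skew matrix commutes with the momentum matrix. -/

/-- The elements of `so(n)` with `a_{ij} = 0` whenever `λ_i ≠ λ_j`. -/
def blockModel {n : ℕ} (lam : Fin n → ℝ) : Submodule ℝ (SOModel n) where
  carrier := {a | ∀ r : SOPair n, lam r.1.1 ≠ lam r.1.2 → a r = 0}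
  zero_mem' _ _ := rfl
  add_mem' ha hb r hr := by simp [ha r hr, hb r hr]
  smul_mem' c _ ha r hr := by simp [ha r hr]

theorem skewMat_apply_eq_zero {n : ℕ} {lam : Fin n → ℝ} {a : SOModel n} (ha : a ∈ blockModel lam)
    {i j : Fin n} (h : lam i ≠ lam j) : skewMat a i j = 0 := by
  rcases lt_trichotomy i j with hij | rfl | hij
  · simpa [skewMat, hij] using ha ⟨(i, j), hij⟩ h
  · exact absurd rfl h
  · simpa [skewMat, hij, hij.not_gt] using ha ⟨(j, i), hij⟩ h.symm

/-- A skew matrix commuting with `tridiag n` and preserving the splitting of the indices into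
`i ≤ q` and `i > q` is zero. -/
theorem eq_zero_of_commute_tridiag {n q : ℕ} (hq : q + 1 < n) {A : Matrix (Fin n) (Fin n) ℝ}
    (hA : Aᵀ = -A) (hc : A * tridiag n = tridiag n * A)
    (hb : ∀ i j : Fin n, (i : ℕ) ≤ q → q < j → A i j = 0) : A = 0 := by
  -- The extension of `A` by zero to all integer indices removes the boundary cases from the
  -- recurrence.
  let α : ℤ → ℤ → ℝ := fun i j =>
    if h : (0 ≤ i ∧ i < n) ∧ 0 ≤ j ∧ j < n then
      A ⟨i.toNat, by omega⟩ ⟨j.toNat, by omega⟩ else 0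
  have hα : ∀ i j : Fin n, α i j = A i j := by
    intro i j
    have hi := i.2
    have hj := j.2
    simp only [α]
    rw [dif_pos (by omega)]
    rfl
  have hout : ∀ i j : ℤ, ¬((0 ≤ i ∧ i < n) ∧ 0 ≤ j ∧ j < n) → α i j = 0 := fun i j h => dif_neg h
  have hlift : ∀ i : ℤ, 0 ≤ i → i < n → ∃ k : Fin n, (k : ℤ) = i := fun i h1 h2 =>
    ⟨⟨i.toNat, by omega⟩, by simp only; omega⟩
  have hskew : ∀ i j, α i j = -α j i := by
    intro i j
    by_cases h : (0 ≤ i ∧ i < n) ∧ 0 ≤ j ∧ j < n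
    · obtain ⟨i, rfl⟩ := hlift i h.1.1 h.1.2
      obtain ⟨j, rfl⟩ := hlift j h.2.1 h.2.2
      rw [hα, hα]
      have := congrFun (congrFun hA j) i
      simpa using this
    · rw [hout i j h, hout j i (by omega), neg_zero]
  have hblock : ∀ i j : ℤ, i ≤ q → q < j → α i j = 0 := by
    intro i j hi hj
    by_cases h : (0 ≤ i ∧ i < n) ∧ 0 ≤ j ∧ j < n
    · obtain ⟨i, rfl⟩ := hlift i h.1.1 h.1.2
      obtain ⟨j, rfl⟩ := hlift j h.2.1 h.2.2
      rw [hα]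
      exact hb i j (by omega) (by omega)
    · exact hout i j h
  -- The commutation relation in entries, valid also on the border of the matrix.
  have hrec : ∀ i j : ℤ, 0 ≤ i → i < n → 0 ≤ j → j < n →
      α i (j + 1) - α i (j - 1) = α (i - 1) j - α (i + 1) j := by
    have hsum : ∀ (x : ℤ → ℝ) (j : Fin n), (∀ l : ℤ, ¬(0 ≤ l ∧ l < n) → x l = 0) →
        ∑ l : Fin n, x l * tridiag n l j = x (j + 1) - x (j - 1) := by
      intro x j hx
      have h1 : ∀ l : Fin n, x l * tridiag n l j =
          (if (l : ℕ) = j + 1 then x (j + 1) else 0) -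
            (if (l : ℕ) + 1 = j then x (j - 1) else 0) := by
        intro l
        simp only [tridiag, Matrix.of_apply]
        split_ifs with h1 h2 h3 h3 h4 h4
        · omega
        · rw [show ((j : ℕ) : ℤ) + 1 = ((l : ℕ) : ℤ) by omega]; ring
        · rw [show ((j : ℕ) : ℤ) - 1 = ((l : ℕ) : ℤ) by omega]; ring
        · omega
        · omega
        · ring
      simp only [h1, Finset.sum_sub_distrib]
      congr 1
      · by_cases h : (j : ℕ) + 1 < n
        · rw [Finset.sum_eq_single (⟨(j : ℕ) + 1, h⟩ : Fin n)]
          · simp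
          · intro l _ hl
            exact if_neg fun e => hl (Fin.ext e)
          · simp
        · rw [hx _ (by omega)]
          simp
      · by_cases h : 1 ≤ (j : ℕ)
        · rw [Finset.sum_eq_single (⟨(j : ℕ) - 1, by omega⟩ : Fin n)]
          · exact if_pos (by simp only; omega)
          · intro l _ hl
            exact if_neg fun e => hl (Fin.ext (by simp only; omega))
          · simp
        · rw [hx _ (by omega)]
          simp
    intro i j hi hi' hj hj'
    obtain ⟨i, rfl⟩ := hlift i hi hi'
    obtain ⟨j, rfl⟩ := hlift j hj hj'
    have h1 := congrFun (congrFun hc i) j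
    rw [Matrix.mul_apply, Matrix.mul_apply] at h1
    have h2 := hsum (fun l => α i l) j fun l hl => hout _ _ (by omega)
    have h3 := hsum (fun l => α l j) i fun l hl => hout _ _ (by omega)
    simp only [hα] at h2 h3
    rw [h2] at h1
    have h4 : ∑ l, tridiag n i l * A l j = -∑ l, A l j * tridiag n l i := by
      rw [← Finset.sum_neg_distrib]
      refine Finset.sum_congr rfl fun l _ => ?_
      have := congrFun (congrFun (tridiag_transpose n) l) i
      rw [Matrix.transpose_apply, Matrix.neg_apply] at this
      rw [this]; ring
    rw [h4, h3] at h1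
    linarith
  have hdiag : ∀ i, α i i = 0 := fun i => by linarith [hskew i i]
  have hblock' : ∀ i j : ℤ, q < i → j ≤ q → α i j = 0 := fun i j hi hj => by
    rw [hskew, hblock j i hj hi, neg_zero]
  -- For `i < q`, every term other than `α i q` of the recurrence at `(i, q + 1)` lies across the
  -- cut and vanishes; for `i = q` skewness suffices.
  have hq0 : ∀ i, α i q = 0 := by
    intro i
    rcases lt_or_ge (q : ℤ) i with h | h
    · exact hblock' i q h le_rfl
    rcases lt_or_ge i 0 with h0 | h0
    · exact hout _ _ (by omega)
    have h1 := hrec i (q + 1) h0 (by omega) (by omega) (by omega)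
    rw [hblock i (q + 1 + 1) h (by omega), hblock (i - 1) (q + 1) (by omega) (by omega),
      add_sub_cancel_right] at h1
    rcases h.lt_or_eq with h | h
    · rw [hblock (i + 1) (q + 1) (by omega) (by omega)] at h1
      linarith
    · rw [h, hdiag]
  have hq1 : ∀ i, α i (q + 1) = 0 := by
    intro i
    rcases le_or_gt i (q : ℤ) with h | h
    · exact hblock i _ h (by omega)
    rcases le_or_gt (n : ℤ) i with h0 | h0
    · exact hout _ _ (by omega)
    have h1 := hrec i q (by omega) h0 (by omega) (by omega)
    rw [hblock' i (q - 1) h (by omega), hq0, hq0] at h1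
    linarith
  -- Two adjacent zero columns propagate through the recurrence, here to the right and in `hdown` to
  -- the left.
  have hup : ∀ d : ℕ, ∀ i, α i (q + d) = 0 ∧ α i (q + d + 1) = 0 := by
    intro d
    induction d with
    | zero => exact fun i => by simpa using ⟨hq0 i, hq1 i⟩
    | succ d ih =>
      intro i
      push_cast
      rw [← add_assoc]
      refine ⟨(ih i).2, ?_⟩
      by_cases h : (0 ≤ i ∧ i < n) ∧ (q : ℤ) + d + 1 < n
      · have h1 := hrec i (q + d + 1) h.1.1 h.1.2 (by omega) h.2
        rw [(ih _).2, (ih _).2, add_sub_cancel_right, (ih i).1] at h1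
        linarith
      · exact hout _ _ (by omega)
  have hdown : ∀ d : ℕ, ∀ i, α i (q - d) = 0 ∧ α i (q - d + 1) = 0 := by
    intro d
    induction d with
    | zero => exact fun i => by simpa using ⟨hq0 i, hq1 i⟩
    | succ d ih =>
      intro i
      push_cast
      have e : (q : ℤ) - (d + 1) = q - d - 1 := by ring
      rw [e, sub_add_cancel]
      refine ⟨?_, (ih i).1⟩
      by_cases h : (0 ≤ i ∧ i < n) ∧ 0 ≤ (q : ℤ) - d
      · have h1 := hrec i (q - d) h.1.1 h.1.2 h.2 (by omega)
        rw [(ih _).1, (ih _).1, (ih i).2] at h1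
        linarith
      · exact hout _ _ (by omega)
  ext i j
  rw [← hα, Matrix.zero_apply]
  rcases le_total (q : ℤ) j with h | h
  · have := (hup (j - q : ℤ).toNat i).1
    rwa [Int.toNat_of_nonneg (by omega), add_sub_cancel] at this
  · have := (hdown (q - j : ℤ).toNat i).1
    rwa [Int.toNat_of_nonneg (by omega), sub_sub_cancel] at this

/-- `a ↦ [a, P]` on the block-diagonal part of `so(n)`. -/
def blockBracket {n : ℕ} (lam : Fin n → ℝ) :
    Matrix (Fin n) (Fin n) ℝ →ₗ[ℝ] blockModel lam →ₗ[ℝ] Matrix (Fin n) (Fin n) ℝ :=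
  LinearMap.mk₂ ℝ (fun P a => skewMatₗ n a * P - P * skewMatₗ n a)
    (fun P Q a => by noncomm_ring)
    (fun c P a => by rw [Matrix.mul_smul, Matrix.smul_mul, smul_sub])
    (fun P a b => by rw [Submodule.coe_add, map_add]; noncomm_ring)
    (fun c P a => by
      rw [Submodule.coe_smul, map_smul, Matrix.mul_smul, Matrix.smul_mul, smul_sub])

theorem exists_adjacent_ne {n : ℕ} {l : Fin n → ℝ} (hl : ∃ i j, l i ≠ l j) :
    ∃ (q : ℕ) (hq : q + 1 < n), l ⟨q, by omega⟩ ≠ l ⟨q + 1, hq⟩ := by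
  by_contra hall
  push Not at hall
  obtain ⟨i, j, hij⟩ := hl
  have h : ∀ k (hk : k < n), l ⟨k, hk⟩ = l ⟨0, by omega⟩ := by
    intro k
    induction k with
    | zero => exact fun _ => rfl
    | succ k ih => exact fun hk => by rw [← hall k hk, ih]
  exact hij ((h i i.2).trans (h j j.2).symm)

/-- After sorting the `λ_i`, some two consecutive values differ, and block-diagonal matrices vanish
across the cut between them. The tridiagonal matrix, carried back by the sorting permutation, is the
required `P`. -/
theorem exists_injective_blockBracket {n : ℕ} {lam : Fin n → ℝ} (hu : 1 < (moments lam).card) :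
    ∃ P : Matrix (Fin n) (Fin n) ℝ, Pᵀ = -P ∧ Function.Injective (blockBracket lam P) := by
  set σ := Tuple.sort lam with hσ
  have hmono : Monotone (lam ∘ σ) := Tuple.monotone_sort lam
  have hne : ∃ i j, (lam ∘ σ) i ≠ (lam ∘ σ) j := by
    obtain ⟨x, hx, y, hy, hxy⟩ := Finset.one_lt_card.1 hu
    obtain ⟨i, _, rfl⟩ := Finset.mem_image.1 hx
    obtain ⟨j, _, rfl⟩ := Finset.mem_image.1 hy
    exact ⟨σ.symm i, σ.symm j, by simpa using hxy⟩
  obtain ⟨q, hq, hlq⟩ := exists_adjacent_ne hne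
  refine ⟨(tridiag n).submatrix σ.symm σ.symm, ?_, ?_⟩
  · rw [Matrix.transpose_submatrix, tridiag_transpose]; rfl
  · rw [injective_iff_map_eq_zero]
    intro a ha
    have h1 : skewMat a.1 * (tridiag n).submatrix σ.symm σ.symm =
        (tridiag n).submatrix σ.symm σ.symm * skewMat a.1 := sub_eq_zero.1 ha
    have h2 : (skewMat a.1).submatrix σ σ = 0 := by
      refine eq_zero_of_commute_tridiag hq ?_ ?_ fun i j hi hj => ?_
      · rw [Matrix.transpose_submatrix, skewMat_transpose]; rfl
      · have h3 := congrArg (fun N => N.submatrix σ σ) h1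
        simp only [← Matrix.submatrix_mul_equiv _ _ _ σ _, Matrix.submatrix_submatrix] at h3
        simpa only [Equiv.symm_comp_self, Matrix.submatrix_id_id] using h3
      · refine skewMat_apply_eq_zero a.2 (ne_of_lt ?_)
        have hlt : (lam ∘ σ) ⟨q, by omega⟩ < (lam ∘ σ) ⟨q + 1, hq⟩ :=
          lt_of_le_of_ne (hmono (Fin.mk_le_mk.2 (Nat.le_succ q))) hlq
        exact (hmono (show i ≤ ⟨q, by omega⟩ from hi)).trans_lt
          (hlt.trans_le (hmono (show ⟨q + 1, hq⟩ ≤ j from hj)))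
    refine Subtype.ext (skewMat_injective ?_)
    rw [Submodule.coe_zero, skewMat_zero]
    ext i j
    have := congrFun (congrFun h2 (σ.symm i)) (σ.symm j)
    simpa using this

/-- Composition with a left inverse `g` of the bracket at one good `P` turns injectivity into
nonvanishing of a determinant, which is a homogeneous polynomial in the momentum matrix and equals
`1` at `P`. -/
theorem almostEverywhere_block_commute {n : ℕ} {lam : Fin n → ℝ} (hu : 1 < (moments lam).card) :
    AlmostEverywhere fun m : CotSO n => ∀ a ∈ blockModel lam,
      skewMat a * PL m = PL m * skewMat a → a = 0 := by
  obtain ⟨P, hP, hinj⟩ := exists_injective_blockBracket hu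
  obtain ⟨g, hg⟩ := LinearMap.exists_leftInverse_of_injective _ (LinearMap.ker_eq_bot.2 hinj)
  let b := Module.finBasis ℝ (blockModel lam)
  refine (almostEverywhere_of_ne_zero
    (F := fun Q => (LinearMap.toMatrix b b (g ∘ₗ blockBracket lam Q)).det)
    (fun f hf => ?_) (fun c hc A hA => ?_) hP ?_).mono fun m hm a ha hac => ?_
  · refine contDiff_det fun i j => ?_
    simp only [LinearMap.toMatrix_apply, LinearMap.comp_apply]
    exact contDiff_linear_comp hf
      ((b.coord i ∘ₗ g) ∘ₗ (blockBracket lam).flip (b j))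
  · simp only [map_smul, LinearMap.comp_smul, Matrix.det_smul] at hA
    exact (mul_eq_zero.1 hA).resolve_left (pow_ne_zero _ hc)
  · rw [hg, LinearMap.toMatrix_id, Matrix.det_one]
    exact one_ne_zero
  · rw [LinearMap.det_toMatrix] at hm
    have h1 : blockBracket lam (PL m) ⟨a, ha⟩ = 0 := sub_eq_zero.2 hac
    have h2 := (LinearMap.equivOfDetNeZero _ hm).map_eq_zero_iff (x := ⟨a, ha⟩)
    have h3 : (⟨a, ha⟩ : blockModel lam) = 0 := h2.1 (by
      change g (blockBracket lam (PL m) ⟨a, ha⟩) = 0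
      rw [h1, map_zero])
    exact congrArg Subtype.val h3

/-! ### The Lie-Poisson form through the trace form. -/

theorem basisD_swap {n : ℕ} (i j : Fin n) : basisD j i = -basisD i j := by
  simp [basisD]

theorem PL_transpose {n : ℕ} (m : CotSO n) : (PL m)ᵀ = -PL m := by
  ext i j
  rw [Matrix.transpose_apply, Matrix.neg_apply, PL_apply, PL_apply, basisD_swap i j, ← map_neg]
  rfl

theorem skewCoord_basisD {n : ℕ} (r : SOPair n) :
    skewCoord (basisD r.1.1 r.1.2) = Pi.single r 1 := by
  funext p
  have hp := p.2
  have hr := r.2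
  simp only [skewCoord, basisD, Matrix.sub_apply, Matrix.single_apply, Pi.single_apply,
    Subtype.ext_iff, Prod.ext_iff]
  have h2 : ¬(r.1.2 = p.1.1 ∧ r.1.1 = p.1.2) := fun ⟨h1, h2⟩ => by
    rw [h1, h2] at hr; exact absurd hr hp.not_gt
  rw [if_neg h2, sub_zero]
  simp only [eq_comm]

theorem skewMat_single {n : ℕ} (r : SOPair n) :
    skewMat (Pi.single r 1 : SOModel n) = basisD r.1.1 r.1.2 := by
  rw [← skewCoord_basisD, skewMat_skewCoord (basisD_transpose _ _)]

theorem trace_basisD_mul {n : ℕ} (i j : Fin n) (P : Matrix (Fin n) (Fin n) ℝ) :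
    (basisD i j * P).trace = P j i - P i j := by
  simp [basisD, Matrix.sub_mul, Matrix.trace_sub, Matrix.trace_single_mul]

theorem covec_eq_trace {n : ℕ} (m : CotSO n) (a : SOModel n) :
    covec m a = -(1 / 2 : ℝ) * (skewMat a * PL m).trace := by
  have h : (covec m).toLinearMap = (-(1 / 2 : ℝ)) •
      ((Matrix.traceLinearMap (Fin n) ℝ ℝ) ∘ₗ LinearMap.mulRight ℝ (PL m) ∘ₗ skewMatₗ n) := by
    refine LinearMap.pi_ext' fun r => LinearMap.ext_ring ?_
    change covec m (Pi.single r 1) = -(1 / 2 : ℝ) * (skewMat (Pi.single r 1) * PL m).trace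
    have hs : PL m r.1.2 r.1.1 = -PL m r.1.1 r.1.2 := congrFun (congrFun (PL_transpose m) _) _
    rw [skewMat_single, trace_basisD_mul, hs, PL_apply, skewCoord_basisD]
    ring
  exact congrArg (fun L : SOModel n →ₗ[ℝ] ℝ => L a) h

theorem commutator_transpose {κ : Type*} [Fintype κ] {A B : Matrix κ κ ℝ} (hA : Aᵀ = -A)
    (hB : Bᵀ = -B) : (A * B - B * A)ᵀ = -(A * B - B * A) := by
  simp [Matrix.transpose_sub, Matrix.transpose_mul, hA, hB]

theorem liePoisson_eq_trace {n : ℕ} (m : CotSO n) (a b : SOModel n) :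
    liePoisson (covec m) a b =
      -(1 / 2 : ℝ) * (skewMat b * (PL m * skewMat a - skewMat a * PL m)).trace := by
  rw [liePoisson_apply, covec_eq_trace,
    skewMat_skewCoord (commutator_transpose (skewMat_transpose a) (skewMat_transpose b)),
    Matrix.sub_mul, Matrix.mul_sub, Matrix.trace_sub, Matrix.trace_sub, Matrix.mul_assoc,
    Matrix.trace_mul_comm, Matrix.mul_assoc (skewMat b) (skewMat a), Matrix.mul_assoc]

theorem liePoisson_antisymm {n : ℕ} (p : SOModel n →L[ℝ] ℝ) (a b : SOModel n) :
    liePoisson p a b = -liePoisson p b a := by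
  rw [liePoisson_apply, liePoisson_apply, ← map_neg]
  congr 1
  rw [← neg_sub]
  rfl

theorem eq_zero_of_trace_mul_self {κ : Type*} [Fintype κ] {N : Matrix κ κ ℝ} (hN : Nᵀ = -N)
    (h : (N * N).trace = 0) : N = 0 := by
  rw [← Matrix.trace_conjTranspose_mul_self_eq_zero_iff, Matrix.conjTranspose_eq_transpose_of_trivial,
    hN, Matrix.neg_mul, Matrix.trace_neg, h, neg_zero]

/-- Testing `c(a, ·)` against the commutator `[P, a]` itself gives `tr [P, a]² = 0`, and the trace
form is definite on skew matrices. -/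
theorem mem_ker_liePoisson {n : ℕ} {m : CotSO n} {a : SOModel n} :
    a ∈ LinearMap.ker (liePoisson (covec m)) ↔ skewMat a * PL m = PL m * skewMat a := by
  rw [LinearMap.mem_ker]
  constructor
  · intro h
    have hs := commutator_transpose (PL_transpose m) (skewMat_transpose a)
    have h1 := liePoisson_eq_trace m a (skewCoord (PL m * skewMat a - skewMat a * PL m))
    rw [h, skewMat_skewCoord hs, LinearMap.zero_apply] at h1
    exact (sub_eq_zero.1 (eq_zero_of_trace_mul_self hs (by linarith))).symm
  · intro h
    refine LinearMap.ext fun b => ?_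
    rw [liePoisson_eq_trace, h, sub_self, Matrix.mul_zero, Matrix.trace_zero, mul_zero,
      LinearMap.zero_apply]

/-! ### Extension of blocks by zero and its pairing with block-diagonal elements. -/

section blocks
variable {ι : Type} [Fintype ι] [DecidableEq ι] {n : ℕ}

theorem extendMat_apply (s : ι → Fin n) (N : Matrix ι ι ℝ) (a b : Fin n) :
    extendMat s N a b = ∑ j, (∑ i, (if a = s i then N i j else 0)) * if b = s j then 1 else 0 := by
  simp only [extendMat, selMat, Matrix.mul_apply, Matrix.one_apply, Matrix.submatrix_apply,
    Matrix.transpose_apply, id_eq, ite_mul, one_mul, zero_mul]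

theorem extendMat_eq_sum (s : ι → Fin n) (N : Matrix ι ι ℝ) :
    extendMat s N = ∑ i, ∑ j, N i j • Matrix.single (s i) (s j) (1 : ℝ) := by
  ext a b
  rw [extendMat_apply, Finset.sum_comm]
  simp only [Matrix.sum_apply, Matrix.smul_apply, Matrix.single_apply, smul_eq_mul]
  refine Finset.sum_congr rfl fun j _ => ?_
  rw [Finset.sum_mul]
  refine Finset.sum_congr rfl fun i _ => ?_
  simp only [eq_comm (a := a), eq_comm (a := b)]
  split_ifs <;> simp_all

theorem extendMat_sub_transpose (s : ι → Fin n) (N : Matrix ι ι ℝ) :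
    extendMat s (N - Nᵀ) = ∑ i, ∑ j, N i j • basisD (s i) (s j) := by
  have h : extendMat s (N - Nᵀ) = extendMat s N - (extendMat s N)ᵀ := by
    rw [extendMat_transpose, extendMat, Matrix.mul_sub, Matrix.sub_mul]; rfl
  rw [h, extendMat_eq_sum, Matrix.transpose_sum, ← Finset.sum_sub_distrib]
  refine Finset.sum_congr rfl fun i _ => ?_
  rw [Matrix.transpose_sum, ← Finset.sum_sub_distrib]
  refine Finset.sum_congr rfl fun j _ => ?_
  rw [Matrix.transpose_smul, Matrix.transpose_single, basisD, smul_sub]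

/-- The pairing of an extended matrix with an element preserving the range of `s`. -/
theorem liePoisson_extendMat (m : CotSO n) (s : ι → Fin n) {N : Matrix ι ι ℝ}
    (hN : Nᵀ = -N) {b : SOModel n}
    (hb : (selMat s)ᵀ * skewMat b = (skewMat b).submatrix s s * (selMat s)ᵀ) :
    liePoisson (covec m) (skewCoord (extendMat s N)) b = -(1 / 2 : ℝ) *
      ((skewMat b).submatrix s s *
        ((PL m).submatrix s s * N - N * (PL m).submatrix s s)).trace := by
  have hE : (extendMat s N)ᵀ = -extendMat s N := by rw [extendMat_transpose, hN, extendMat_neg]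
  have hb' : skewMat b * selMat s = selMat s * (skewMat b).submatrix s s := by
    have := congrArg Matrix.transpose hb
    rw [Matrix.transpose_mul, Matrix.transpose_mul, Matrix.transpose_transpose, skewMat_transpose,
      Matrix.transpose_submatrix, skewMat_transpose, Matrix.neg_mul] at this
    rw [← neg_inj, this]
    change _ = -(selMat s * _)
    rw [← Matrix.mul_neg]; rfl
  rw [liePoisson_eq_trace, skewMat_skewCoord hE]
  congr 1
  set B := skewMat b
  set P := PL m
  rw [submatrix_eq_selMat s P, extendMat]
  set V := selMat s
  set Bs := B.submatrix s s
  rw [Matrix.mul_sub, Matrix.trace_sub, Matrix.mul_sub, Matrix.trace_sub]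
  congr 1
  · calc (B * (P * (V * N * Vᵀ))).trace = ((B * P * V * N) * Vᵀ).trace := by
          simp only [Matrix.mul_assoc]
      _ = ((Vᵀ * B) * (P * V * N)).trace := by
          rw [Matrix.trace_mul_comm]; simp only [Matrix.mul_assoc]
      _ = _ := by rw [hb]; simp only [Matrix.mul_assoc]
  · calc (B * (V * N * Vᵀ * P)).trace = ((B * V) * (N * Vᵀ * P)).trace := by
          simp only [Matrix.mul_assoc]
      _ = (V * (Bs * N * Vᵀ * P)).trace := by rw [hb']; simp only [Matrix.mul_assoc]
      _ = _ := by rw [Matrix.trace_mul_comm]; simp only [Matrix.mul_assoc]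

end blocks

/-! ### Differentials of the Casimir functions. -/

section charpoly
variable {W : Type*} [NormedAddCommGroup W] [NormedSpace ℝ W] {k : WithTop ℕ∞}
variable {ι : Type} [Fintype ι] [DecidableEq ι]

theorem contDiff_mvPolynomial_eval {σ : Type*} {f : W → σ → ℝ}
    (hf : ∀ i, ContDiff ℝ k fun w => f w i) (p : MvPolynomial σ ℝ) :
    ContDiff ℝ k fun w => MvPolynomial.eval (f w) p := by
  induction p using MvPolynomial.induction_on with
  | C a => simp only [MvPolynomial.eval_C]; exact contDiff_const
  | add p q hp hq => simp only [map_add]; exact hp.add hq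
  | mul_X p i hp => simp only [map_mul, MvPolynomial.eval_X]; exact hp.mul (hf i)

theorem charpoly_coeff_eq_eval (A : Matrix ι ι ℝ) (r : ℕ) :
    A.charpoly.coeff r = MvPolynomial.eval (fun ij : ι × ι => A ij.1 ij.2)
      ((Matrix.charpoly.univ ℝ ι).coeff r) := by
  have h1 := Matrix.charpoly.univ_coeff_eval₂Hom ι (RingHom.id ℝ)
    (fun ij : ι × ι => A ij.1 ij.2) r
  rw [show MvPolynomial.eval₂Hom (RingHom.id ℝ) (fun ij : ι × ι => A ij.1 ij.2) =
    MvPolynomial.eval (fun ij : ι × ι => A ij.1 ij.2) from rfl] at h1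
  exact h1.symm

theorem contDiff_charpoly_coeff {f : W → Matrix ι ι ℝ} (hf : ∀ i j, ContDiff ℝ k fun w => f w i j)
    (r : ℕ) : ContDiff ℝ k fun w => (f w).charpoly.coeff r := by
  rw [funext fun w => charpoly_coeff_eq_eval (f w) r]
  generalize (Matrix.charpoly.univ ℝ ι).coeff r = p
  exact contDiff_mvPolynomial_eval (f := fun w (ij : ι × ι) => f w ij.1 ij.2)
    (fun ij => hf ij.1 ij.2) p

variable {n : ℕ}

theorem contDiff_casimir_cotPt (m : CotSO n) (s : ι → Fin n) (h : ℕ) :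
    ContDiff ℝ k fun z => casimir h ((PL (cotPt m z)).submatrix s s) :=
  contDiff_charpoly_coeff (fun i j => by
    simp only [Matrix.submatrix_apply]; rw [PL_cotPt_eq]; exact contDiff_momentumChart _ _ _) _

/-- The differential of a standard Casimir function of a principal submatrix of `P^L`. -/
theorem dAt_casimir (m : CotSO n) (s : ι → Fin n) (h : ℕ) :
    dAt (fun m => casimir h ((PL m).submatrix s s)) m =
      covector m (liePoisson (covec m))
        (skewCoord (extendMat s (casimirGrad ((PL m).submatrix s s) h))) := by
  have hd := (contDiff_casimir_cotPt (k := 1) m s h).differentiable (by simp) (0, covec m)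
  rw [dAt_eq_fderiv hd]
  set r := Fintype.card ι - 2 * h with hr
  set A := (PL m).submatrix s s with hA
  -- Chain rule: `Φ` is the coefficient as a function of arbitrary matrix entries, `G` the entries
  -- of the block in the chart.
  let Φ : (ι × ι → ℝ) → ℝ := fun x => (Matrix.of fun i j => x (i, j)).charpoly.coeff r
  have hΦ : ContDiff ℝ 1 Φ :=
    contDiff_charpoly_coeff (fun i j => contDiff_apply ℝ ℝ (i, j)) r
  let G : CotModel n → ι × ι → ℝ := fun z ij => momentumChart (basisD (s ij.1) (s ij.2)) (1 / 2) z
  have hG : DifferentiableAt ℝ G (0, covec m) := by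
    rw [differentiableAt_pi]
    exact fun ij => (contDiff_momentumChart _ _ 1).differentiable (by simp) _
  have hcomp : (fun z => casimir h ((PL (cotPt m z)).submatrix s s)) = Φ ∘ G := by
    funext z
    simp only [casimir, Φ, G, Function.comp_apply]
    congr 2
    ext i j
    simp only [Matrix.submatrix_apply, Matrix.of_apply]
    exact congrFun (PL_cotPt_eq m (s i) (s j)) z
  have hG0 : (Matrix.of fun i j => G (0, covec m) (i, j)) = A := by
    ext i j
    have h1 := congrFun (PL_cotPt_eq m (s i) (s j)) (0, covec m)
    have h2 : cotPt m (0, covec m) = m := by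
      rw [← extChartAt_cot_self]; exact extChartAt_to_inv m
    simp only [h2] at h1
    exact h1.symm
  have hΦ' : ∀ y : ι × ι → ℝ, fderiv ℝ Φ (G (0, covec m)) y =
      -(charpolyTail A (r + 1) * Matrix.of fun i j => y (i, j)).trace := by
    intro y
    refine fderiv_eq_of_line (hΦ.differentiable (by simp) _) ?_
    have h3 := hasDerivAt_charpoly_coeff A (Matrix.of fun i j => y (i, j)) r
    rw [← hG0] at h3 ⊢
    exact h3
  refine ContinuousLinearMap.ext fun w => ?_
  rw [hcomp, fderiv_comp _ (hΦ.differentiable (by simp) _) hG]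
  refine (hΦ' _).trans ?_
  have hGw : ∀ i j, fderiv ℝ G (0, covec m) w (i, j) =
      covector m (liePoisson (covec m)) (skewCoord (basisD (s i) (s j))) w := by
    intro i j
    have h4 := (hasFDerivAt_pi'.1 hG.hasFDerivAt (i, j)).fderiv
    have h5 := congrArg (fun L : CotModel n →L[ℝ] ℝ => L w) h4
    exact h5.symm.trans (fderiv_momentumChart (basisD_transpose _ _) _ _ _)
  rw [casimirGrad, ← hr, extendMat_sub_transpose]
  let Lw : Matrix (Fin n) (Fin n) ℝ →ₗ[ℝ] ℝ :=
    { toFun := fun B => covector m (liePoisson (covec m)) (skewCoord B) w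
      map_add' := fun B B' => by
        rw [show skewCoord (B + B') = skewCoord B + skewCoord B' from rfl, map_add]; rfl
      map_smul' := fun c B => by
        rw [show skewCoord (c • B) = c • skewCoord B from rfl, map_smul]; rfl }
  have hL : -(charpolyTail A (r + 1) * Matrix.of fun i j => fderiv ℝ G (0, covec m) w (i, j)).trace =
      Lw (∑ i, ∑ j, charpolyTail A (r + 1) i j • basisD (s i) (s j)) := by
    simp only [map_sum, map_smul]
    rw [Matrix.trace, ← Finset.sum_neg_distrib]
    refine Finset.sum_congr rfl fun i _ => ?_
    rw [Matrix.diag_apply, Matrix.mul_apply, ← Finset.sum_neg_distrib]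
    refine Finset.sum_congr rfl fun j _ => ?_
    -- The trace pairs entry `(i, j)` of the tail with entry `(j, i)` of the derivative;
    -- antisymmetry of the momenta absorbs the minus sign.
    have h6 : fderiv ℝ G (0, covec m) w (j, i) = Lw (basisD (s j) (s i)) := hGw j i
    rw [Matrix.of_apply, h6, basisD_swap (s i) (s j), map_neg, mul_neg, neg_neg, smul_eq_mul]
  exact hL

end charpoly

/-! ### Spans of the differentials of `B^λ` and of the Casimir functions. -/

theorem spanD_union {n : ℕ} (F G : Set (CotSO n → ℝ)) (m : CotSO n) :
    spanD (F ∪ G) m = spanD F m ⊔ spanD G m := by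
  rw [spanD, Set.image_union, Submodule.span_union]; rfl

theorem spanD_biUnion {n : ℕ} {κ : Type*} (s : Finset κ) (F : κ → Set (CotSO n → ℝ)) (m : CotSO n) :
    spanD (⋃ k ∈ s, F k) m = ⨆ k ∈ s, spanD (F k) m := by
  simp only [spanD, Set.image_iUnion, Submodule.span_iUnion]

theorem single_mem_blockModel {n : ℕ} {lam : Fin n → ℝ} {r : SOPair n}
    (h : lam r.1.1 = lam r.1.2) : (Pi.single r 1 : SOModel n) ∈ blockModel lam := by
  intro q hq
  rw [Pi.single_apply, if_neg]
  rintro rfl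
  exact hq h

theorem span_single_eq_blockModel {n : ℕ} (lam : Fin n → ℝ) :
    Submodule.span ℝ {a : SOModel n | ∃ r : SOPair n, lam r.1.1 = lam r.1.2 ∧ a = Pi.single r 1} =
      blockModel lam := by
  apply le_antisymm
  · rw [Submodule.span_le]
    rintro _ ⟨r, hr, rfl⟩
    exact single_mem_blockModel hr
  · intro a ha
    have h : a = ∑ r, a r • (Pi.single r 1 : SOModel n) := by
      funext q
      simp [Finset.sum_apply, Pi.single_apply]
    rw [h]
    refine Submodule.sum_mem _ fun r _ => ?_
    by_cases hr : lam r.1.1 = lam r.1.2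
    · exact Submodule.smul_mem _ _ (Submodule.subset_span ⟨r, hr, rfl⟩)
    · rw [ha r hr, zero_smul]; exact Submodule.zero_mem _

theorem span_single_eq_top (n : ℕ) :
    Submodule.span ℝ (Set.range fun r : SOPair n => (Pi.single r 1 : SOModel n)) = ⊤ := by
  rw [eq_top_iff]
  intro a _
  have h : a = ∑ r, a r • (Pi.single r 1 : SOModel n) := by
    funext q
    simp [Finset.sum_apply, Pi.single_apply]
  rw [h]
  exact Submodule.sum_mem _ fun r _ => Submodule.smul_mem _ _ (Submodule.subset_span ⟨r, rfl⟩)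

theorem conjModel_surjective {n : ℕ} (X : SOGroup n) :
    Function.Surjective (conjModel X.1) := by
  intro b
  have h1 : (X.1 * skewMat b * X.1ᵀ)ᵀ = -(X.1 * skewMat b * X.1ᵀ) := by
    simp [Matrix.transpose_mul, skewMat_transpose, Matrix.mul_assoc]
  refine ⟨skewCoord (X.1 * skewMat b * X.1ᵀ), ?_⟩
  change skewCoord (X.1ᵀ * skewMat (skewCoord _) * X.1) = b
  rw [skewMat_skewCoord h1]
  have h2 : X.1ᵀ * (X.1 * skewMat b * X.1ᵀ) * X.1 = skewMat b := by
    calc X.1ᵀ * (X.1 * skewMat b * X.1ᵀ) * X.1 = (X.1ᵀ * X.1) * skewMat b * (X.1ᵀ * X.1) := by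
          simp only [Matrix.mul_assoc]
      _ = _ := by rw [SOGroup.transpose_mul_self, Matrix.one_mul, Matrix.mul_one]
  rw [h2, skewCoord_skewMat]

theorem spanD_BSet {n : ℕ} (lam : Fin n → ℝ) (m : CotSO n) :
    spanD (BSet lam) m = (blockModel lam).map (covector m (liePoisson (covec m))) ⊔
      LinearMap.range (covector m (-liePoisson (covec m))) := by
  rw [BSet, spanD_union]
  congr 1
  · rw [← span_single_eq_blockModel, Submodule.map_span, spanD]
    congr 1
    ext α
    constructor
    · rintro ⟨_, ⟨i, j, hij, hl, rfl⟩, rfl⟩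
      refine ⟨_, ⟨⟨(i, j), hij⟩, hl, rfl⟩, ?_⟩
      exact (congrArg _ (skewCoord_basisD ⟨(i, j), hij⟩)).symm.trans (dAt_PL m i j).symm
    · rintro ⟨_, ⟨r, hl, rfl⟩, rfl⟩
      refine ⟨_, ⟨r.1.1, r.1.2, r.2, hl, rfl⟩, ?_⟩
      exact (dAt_PL m r.1.1 r.1.2).trans (congrArg _ (skewCoord_basisD r))
  -- Conjugation by the base point is onto `so(n)`, so the right momenta still contribute all right
  -- covectors.
  · have h : LinearMap.range (covector m (-liePoisson (covec m))) =
        Submodule.map (covector m (-liePoisson (covec m)) ∘ₗ conjModel m.1.1) ⊤ := by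
      rw [Submodule.map_comp, Submodule.map_top,
        LinearMap.range_eq_top.2 (conjModel_surjective m.1), Submodule.map_top]
    rw [h, ← span_single_eq_top, Submodule.map_span, spanD]
    have hconj : ∀ r : SOPair n, conjModel m.1.1 (Pi.single r 1) =
        skewCoord (m.1.1ᵀ * basisD r.1.1 r.1.2 * m.1.1) := by
      intro r
      change skewCoord (m.1.1ᵀ * skewMat (Pi.single r 1) * m.1.1) = _
      rw [skewMat_single]
    congr 1
    ext α
    constructor
    · rintro ⟨_, ⟨i, j, hij, rfl⟩, rfl⟩
      refine ⟨_, ⟨⟨(i, j), hij⟩, rfl⟩, ?_⟩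
      exact (congrArg _ (hconj ⟨(i, j), hij⟩)).trans (dAt_PR m i j).symm
    · rintro ⟨_, ⟨r, rfl⟩, rfl⟩
      refine ⟨_, ⟨r.1.1, r.1.2, r.2, rfl⟩, ?_⟩
      exact (dAt_PR m r.1.1 r.1.2).trans (congrArg _ (hconj r)).symm

section
variable {ι : Type} [Fintype ι] [DecidableEq ι] {n : ℕ}

/-- The coordinates of the extension by zero of a square matrix. -/
def extendModel (s : ι → Fin n) : Matrix ι ι ℝ →ₗ[ℝ] SOModel n where
  toFun N := skewCoord (extendMat s N)
  map_add' N N' := by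
    rw [extendMat, Matrix.mul_add, Matrix.add_mul]; rfl
  map_smul' c N := by
    rw [extendMat, Matrix.mul_smul, Matrix.smul_mul]; rfl

/-- The standard Casimir functions of a principal submatrix of `P^L`. -/
def casimirSet (s : ι → Fin n) : Set (CotSO n → ℝ) :=
  {f | ∃ h : ℕ, 1 ≤ h ∧ h ≤ Fintype.card ι / 2 ∧ f = fun m => casimir h ((PL m).submatrix s s)}

/-- The gradients of the standard Casimir functions of a principal submatrix of `P^L`. -/
def casimirVec (s : ι → Fin n) (m : CotSO n) (i : Fin (Fintype.card ι / 2)) : SOModel n :=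
  extendModel s (casimirGrad ((PL m).submatrix s s) (i + 1))

theorem spanD_casimirSet (s : ι → Fin n) (m : CotSO n) :
    spanD (casimirSet s) m = (Submodule.span ℝ (Set.range (casimirVec s m))).map
      (covector m (liePoisson (covec m))) := by
  rw [Submodule.map_span, spanD]
  congr 1
  ext α
  constructor
  · rintro ⟨_, ⟨h, h1, h2, rfl⟩, rfl⟩
    refine ⟨_, ⟨⟨h - 1, by omega⟩, rfl⟩, ?_⟩
    refine Eq.trans ?_ (dAt_casimir m s h).symm
    rw [casimirVec]
    simp only [Nat.sub_add_cancel h1]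
    rfl
  · rintro ⟨_, ⟨i, rfl⟩, rfl⟩
    exact ⟨_, ⟨i + 1, by omega, by omega, rfl⟩, dAt_casimir m s (i + 1)⟩

theorem extendMat_id (N : Matrix (Fin n) (Fin n) ℝ) : extendMat id N = N := by
  simp [extendMat, selMat]

theorem transpose_submatrix_PL (s : ι → Fin n) (m : CotSO n) :
    ((PL m).submatrix s s)ᵀ = -(PL m).submatrix s s := by
  rw [Matrix.transpose_submatrix, PL_transpose]; rfl

theorem ker_liePoisson_ge (m : CotSO n) :
    Submodule.span ℝ (Set.range (casimirVec (id : Fin n → Fin n) m)) ≤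
      LinearMap.ker (liePoisson (covec m)) := by
  rw [Submodule.span_le]
  rintro _ ⟨i, rfl⟩
  rw [SetLike.mem_coe, mem_ker_liePoisson]
  have h : skewMat (casimirVec id m i) = casimirGrad (PL m) ((i : ℕ) + 1) := by
    change skewMat (skewCoord (extendMat id (casimirGrad _ _))) = _
    rw [extendMat_id, skewMat_skewCoord (casimirGrad_transpose _ _)]
    rfl
  rw [h]
  exact commute_casimirGrad (PL_transpose m) _

theorem ker_liePoisson_eq {m : CotSO n} (hc : IsCyclicMat ((PL m).submatrix id id)) :
    LinearMap.ker (liePoisson (covec m)) =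
      Submodule.span ℝ (Set.range (casimirVec (id : Fin n → Fin n) m)) := by
  refine le_antisymm (fun a ha => ?_) (ker_liePoisson_ge m)
  have h1 := hc.mem_span_casimirGrad (PL_transpose m) (mem_ker_liePoisson.1 ha)
    (skewMat_transpose a)
  have h2 := Submodule.mem_map_of_mem (f := extendModel (id : Fin n → Fin n)) h1
  rw [Submodule.map_span, ← Set.range_comp] at h2
  have h3 : extendModel (id : Fin n → Fin n) (skewMat a) = a := by
    change skewCoord (extendMat id _) = a
    rw [extendMat_id, skewCoord_skewMat]
  rw [h3] at h2
  exact h2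

theorem submatrix_casimirVec {s : ι → Fin n} (hs : Function.Injective s) {N : Matrix ι ι ℝ}
    (hN : Nᵀ = -N) : (skewMat (extendModel s N)).submatrix s s = N := by
  change (skewMat (skewCoord (extendMat s N))).submatrix s s = N
  rw [skewMat_skewCoord (by rw [extendMat_transpose, hN, extendMat_neg]), submatrix_extendMat hs]

end

/-! ### The radical of the block-diagonal part and the span of `dZ^λ`. -/

section
variable {n : ℕ} (lam : Fin n → ℝ)

/-- The inclusion of the set of indices with `λ_i = μ`. -/
abbrev momentIncl (μ : ℝ) : {i // lam i = μ} → Fin n := Subtype.val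

theorem CbarSet_eq (n : ℕ) : CbarSet n = casimirSet (id : Fin n → Fin n) := by
  simp only [CbarSet, casimirSet, Fintype.card_fin, Matrix.submatrix_id_id]

theorem card_moment (μ : ℝ) : Fintype.card {i // lam i = μ} = mult lam μ :=
  Fintype.card_subtype _

theorem CLSet_eq : CLSet lam = ⋃ μ ∈ moments lam, casimirSet (momentIncl lam μ) := by
  ext f
  simp only [CLSet, casimirSet, card_moment, Set.mem_iUnion, exists_prop]
  rfl

variable {lam}

theorem selMat_transpose_mul_block {a : SOModel n} (ha : a ∈ blockModel lam) (μ : ℝ) :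
    (selMat (momentIncl lam μ))ᵀ * skewMat a =
      (skewMat a).submatrix (momentIncl lam μ) (momentIncl lam μ) * (selMat (momentIncl lam μ))ᵀ := by
  ext k j
  have h1 : ((selMat (momentIncl lam μ))ᵀ * skewMat a) k j = skewMat a k j := by
    simp [selMat, Matrix.mul_apply, Matrix.one_apply]
  rw [h1, Matrix.mul_apply]
  simp only [selMat, Matrix.transpose_apply, Matrix.submatrix_apply, Matrix.one_apply, id_eq,
    mul_ite, mul_one, mul_zero]
  by_cases hj : lam j = μ
  · rw [Finset.sum_eq_single (⟨j, hj⟩ : {i // lam i = μ})]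
    · simp
    · intro l _ hl
      exact if_neg fun e => hl (Subtype.ext e.symm)
    · simp
  · rw [Finset.sum_eq_zero, skewMat_apply_eq_zero ha (by rw [k.2]; exact fun e => hj e.symm)]
    intro l _
    exact if_neg fun e => hj (by rw [e]; exact l.2)

theorem extendMat_momentIncl_eq_zero (lam : Fin n → ℝ) (μ : ℝ)
    (N : Matrix {i // lam i = μ} {i // lam i = μ} ℝ) {i j : Fin n} (h : ¬(lam i = μ ∧ lam j = μ)) :
    extendMat (momentIncl lam μ) N i j = 0 := by
  rw [extendMat_apply]
  refine Finset.sum_eq_zero fun k _ => ?_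
  by_cases hj : j = momentIncl lam μ k
  · rw [Finset.sum_eq_zero, zero_mul]
    intro l _
    refine if_neg fun hi => h ⟨?_, ?_⟩
    · rw [hi]; exact l.2
    · rw [hj]; exact k.2
  · rw [if_neg hj, mul_zero]

theorem extendMat_momentIncl (lam : Fin n → ℝ) (μ : ℝ) (N : Matrix (Fin n) (Fin n) ℝ) (i j : Fin n) :
    extendMat (momentIncl lam μ) (N.submatrix (momentIncl lam μ) (momentIncl lam μ)) i j =
      if lam i = μ ∧ lam j = μ then N i j else 0 := by
  split_ifs with h
  · exact congrFun (congrFun (submatrix_extendMat Subtype.val_injective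
      (N.submatrix (momentIncl lam μ) (momentIncl lam μ))) ⟨i, h.1⟩) ⟨j, h.2⟩
  · exact extendMat_momentIncl_eq_zero lam μ _ h

theorem extendModel_mem_blockModel (μ : ℝ) (N : Matrix {i // lam i = μ} {i // lam i = μ} ℝ) :
    extendModel (momentIncl lam μ) N ∈ blockModel lam := fun _ hr =>
  extendMat_momentIncl_eq_zero lam μ N fun h => hr (h.1.trans h.2.symm)

theorem span_casimirVec_le_radicalOn (m : CotSO n) (μ : ℝ) :
    Submodule.span ℝ (Set.range (casimirVec (momentIncl lam μ) m)) ≤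
      radicalOn (liePoisson (covec m)) (blockModel lam) := by
  rw [Submodule.span_le]
  rintro _ ⟨i, rfl⟩
  refine ⟨extendModel_mem_blockModel μ _, fun b hb => ?_⟩
  refine (liePoisson_extendMat m _ (casimirGrad_transpose _ _) (selMat_transpose_mul_block hb μ)).trans ?_
  have := (commute_casimirGrad (transpose_submatrix_PL (momentIncl lam μ) m) ((i : ℕ) + 1)).eq
  rw [this, sub_self, Matrix.mul_zero, Matrix.trace_zero, mul_zero]

theorem eq_sum_extendModel {a : SOModel n} (ha : a ∈ blockModel lam) :
    a = ∑ μ ∈ moments lam, extendModel (momentIncl lam μ)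
      ((skewMat a).submatrix (momentIncl lam μ) (momentIncl lam μ)) := by
  funext r
  rw [Finset.sum_apply]
  have h : ∀ μ, extendModel (momentIncl lam μ)
      ((skewMat a).submatrix (momentIncl lam μ) (momentIncl lam μ)) r =
      if lam r.1.1 = μ ∧ lam r.1.2 = μ then a r else 0 := by
    intro μ
    refine (extendMat_momentIncl lam μ _ _ _).trans ?_
    rw [show skewMat a r.1.1 r.1.2 = a r from congrFun (skewCoord_skewMat a) r]
  simp only [h]
  by_cases hr : lam r.1.1 = lam r.1.2
  · rw [Finset.sum_eq_single (lam r.1.1)]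
    · rw [if_pos ⟨rfl, hr.symm⟩]
    · exact fun μ _ hμ => if_neg fun e => hμ e.1.symm
    · exact fun h => absurd (Finset.mem_image_of_mem lam (Finset.mem_univ _)) h
  · rw [ha r hr, Finset.sum_eq_zero]
    exact fun μ _ => ite_self 0

/-- Pairing `a` with the extension by zero of the commutator `N` of the blocks of `P` and `a`,
itself an element of `H`, gives `tr N² = 0`. So each block of `a` commutes with that of `P`, and
cyclicity makes it a combination of Casimir gradients. -/
theorem radicalOn_eq {m : CotSO n}
    (hc : ∀ μ ∈ moments lam,
      IsCyclicMat ((PL m).submatrix (momentIncl lam μ) (momentIncl lam μ))) :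
    radicalOn (liePoisson (covec m)) (blockModel lam) =
      ⨆ μ ∈ moments lam, Submodule.span ℝ (Set.range (casimirVec (momentIncl lam μ) m)) := by
  refine le_antisymm ?_ (iSup₂_le fun μ _ => span_casimirVec_le_radicalOn m μ)
  rintro a ⟨ha, hab⟩
  rw [eq_sum_extendModel ha]
  refine Submodule.sum_mem _ fun μ hμ => ?_
  refine Submodule.mem_iSup_of_mem μ (Submodule.mem_iSup_of_mem hμ ?_)
  set s := momentIncl lam μ
  set Am := (skewMat a).submatrix s s with hAm
  set Pm := (PL m).submatrix s s with hPm
  have hAs : Amᵀ = -Am := by rw [hAm, Matrix.transpose_submatrix, skewMat_transpose]; rfl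
  have hPs : Pmᵀ = -Pm := transpose_submatrix_PL s m
  have hcomm : Am * Pm = Pm * Am := by
    set N := Pm * Am - Am * Pm with hN
    have hNs : Nᵀ = -N := commutator_transpose hPs hAs
    have h1 := liePoisson_extendMat m s hNs (selMat_transpose_mul_block ha μ)
    rw [liePoisson_antisymm] at h1
    have h2 : liePoisson (covec m) a (skewCoord (extendMat s N)) = 0 :=
      hab _ (extendModel_mem_blockModel μ N)
    rw [h2, neg_zero, ← hAm, ← hPm] at h1
    have h3 : (Am * (Pm * N - N * Pm)).trace = -(N * N).trace := by
      have e1 : (Am * (Pm * N)).trace = (N * (Am * Pm)).trace := by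
        rw [← Matrix.mul_assoc, Matrix.trace_mul_comm]
      have e2 : (Am * (N * Pm)).trace = (N * (Pm * Am)).trace := by
        rw [Matrix.trace_mul_comm, Matrix.mul_assoc]
      rw [Matrix.mul_sub, Matrix.trace_sub, e1, e2, ← Matrix.trace_sub, ← Matrix.mul_sub,
        ← Matrix.trace_neg, ← Matrix.mul_neg, hN, neg_sub]
    rw [h3] at h1
    exact (sub_eq_zero.1 (eq_zero_of_trace_mul_self hNs (by linarith))).symm
  have h4 := Submodule.mem_map_of_mem (f := extendModel s)
    ((hc μ hμ).mem_span_casimirGrad hPs hcomm hAs)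
  rw [Submodule.map_span, ← Set.range_comp] at h4
  exact h4

end

theorem spanD_ZSet {n : ℕ} {lam : Fin n → ℝ} (hu : 1 < (moments lam).card) (m : CotSO n) :
    spanD (ZSet lam) m =
      (Submodule.span ℝ (Set.range (casimirVec (id : Fin n → Fin n) m)) ⊔
        ⨆ μ ∈ moments lam, Submodule.span ℝ (Set.range (casimirVec (momentIncl lam μ) m))).map
          (covector m (liePoisson (covec m))) := by
  rw [ZSet, if_pos hu, spanD_union, CbarSet_eq, CLSet_eq, spanD_biUnion, Submodule.map_sup,
    spanD_casimirSet]
  simp only [Submodule.map_iSup, spanD_casimirSet]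

theorem blockModel_eq_top {n : ℕ} {lam : Fin n → ℝ} (hu : ¬1 < (moments lam).card) :
    blockModel lam = ⊤ := by
  rw [eq_top_iff]
  intro a _ r hr
  exact absurd (Finset.card_le_one.1 (not_lt.1 hu) _ (Finset.mem_image_of_mem lam (Finset.mem_univ _))
    _ (Finset.mem_image_of_mem lam (Finset.mem_univ _))) hr

/-- The momentum matrix and its diagonal blocks have cyclic vectors. -/
def IsCyclicAt {n : ℕ} (lam : Fin n → ℝ) (m : CotSO n) : Prop :=
  IsCyclicMat ((PL m).submatrix id id) ∧
    ∀ μ ∈ moments lam, IsCyclicMat ((PL m).submatrix (momentIncl lam μ) (momentIncl lam μ))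

theorem almostEverywhere_isCyclicAt {n : ℕ} (lam : Fin n → ℝ) :
    AlmostEverywhere (IsCyclicAt lam) :=
  (almostEverywhere_isCyclicMat Function.injective_id).and
    (AlmostEverywhere.finset_forall _ fun _ _ =>
      almostEverywhere_isCyclicMat Subtype.val_injective)

theorem spanD_ZSet_eq_inf {n : ℕ} {lam : Fin n → ℝ} {m : CotSO n} (hm : IsCyclicAt lam m) :
    spanD (ZSet lam) m = spanD (BSet lam) m ⊓ skewOrth (spanD (BSet lam) m) := by
  rw [spanD_BSet, inf_skewOrth_eq m (liePoisson_antisymm _)]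
  by_cases hu : 1 < (moments lam).card
  · rw [spanD_ZSet hu, radicalOn_eq hm.2, ker_liePoisson_eq hm.1, sup_comm]
  -- With at most one moment `H` is all of `so(n)`, so its radical is already the kernel and `C̄`
  -- suffices.
  · have h : radicalOn (liePoisson (covec m)) (blockModel lam) ≤
        LinearMap.ker (liePoisson (covec m)) := by
      rintro a ⟨_, ha⟩
      rw [blockModel_eq_top hu] at ha
      exact LinearMap.ext fun b => ha b trivial
    rw [sup_eq_right.2 h, ZSet, if_neg hu, CbarSet_eq, spanD_casimirSet, ker_liePoisson_eq hm.1]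

/-! ### Functions of a submersion and their derivatives. -/

section functionals
variable {E : Type*} [NormedAddCommGroup E] [NormedSpace ℝ E] [FiniteDimensional ℝ E]

theorem span_range_toLinearMap {ι : Type*} (φ : ι → E →L[ℝ] ℝ) :
    Submodule.span ℝ (Set.range fun i => (φ i : E →ₗ[ℝ] ℝ)) =
      (Submodule.span ℝ (Set.range φ)).map
        (LinearMap.toContinuousLinearMap (𝕜 := ℝ) (E := E) (F' := ℝ)).symm.toLinearMap := by
  rw [Submodule.map_span, ← Set.range_comp]
  rfl

/-- The kernel of the map with components `φ i` is the annihilator of their span, so both sides are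
the codimension of that kernel. -/
theorem finrank_range_pi_eq_finrank_span {ι : Type*} (φ : ι → E →L[ℝ] ℝ) :
    Module.finrank ℝ (LinearMap.range (LinearMap.pi fun i => (φ i : E →ₗ[ℝ] ℝ))) =
      Module.finrank ℝ (Submodule.span ℝ (Set.range φ)) := by
  have h1 := LinearMap.finrank_range_add_finrank_ker (LinearMap.pi fun i => (φ i : E →ₗ[ℝ] ℝ))
  have h2 := Subspace.finrank_add_finrank_dualCoannihilator_eq
    (Submodule.span ℝ (Set.range fun i => (φ i : E →ₗ[ℝ] ℝ)))
  have h3 : (Submodule.span ℝ (Set.range fun i => (φ i : E →ₗ[ℝ] ℝ))).dualCoannihilator =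
      LinearMap.ker (LinearMap.pi fun i => (φ i : E →ₗ[ℝ] ℝ)) := by
    ext x
    rw [Submodule.mem_dualCoannihilator, LinearMap.mem_ker]
    constructor
    · intro h
      funext i
      exact h _ (Submodule.subset_span ⟨i, rfl⟩)
    · intro h ψ hψ
      induction hψ using Submodule.span_induction with
      | mem ψ hψ =>
        obtain ⟨i, rfl⟩ := hψ
        exact congrFun h i
      | zero => rfl
      | add ψ ψ' _ _ h1 h2 => rw [LinearMap.add_apply, h1, h2, add_zero]
      | smul c ψ _ h1 => rw [LinearMap.smul_apply, h1, smul_zero]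
  rw [h3, span_range_toLinearMap, LinearEquiv.finrank_map_eq] at h2
  omega

theorem mem_span_of_forall_apply_eq_zero {ι : Type*} [Finite ι] {φ : ι → E →L[ℝ] ℝ}
    {ψ : E →L[ℝ] ℝ} (h : ∀ x, (∀ i, φ i x = 0) → ψ x = 0) :
    ψ ∈ Submodule.span ℝ (Set.range φ) := by
  have h1 : (ψ : E →ₗ[ℝ] ℝ) ∈ Submodule.span ℝ (Set.range fun i => (φ i : E →ₗ[ℝ] ℝ)) := by
    refine mem_span_of_iInf_ker_le_ker fun x hx => h x fun i => ?_
    exact (Submodule.mem_iInf _).1 hx i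
  rw [span_range_toLinearMap] at h1
  obtain ⟨χ, hχ, he⟩ := h1
  have : χ = ψ := ContinuousLinearMap.ext fun x => congrArg (fun L : E →ₗ[ℝ] ℝ => L x) he
  rwa [← this]

/-- The derivative of a function of the components of a submersion is a combination of the
derivatives of these components. -/
theorem fderiv_mem_span_of_factor {κ : Type*} [Fintype κ] {F : κ → E → ℝ}
    (hF : ∀ k, ContDiff ℝ 1 (F k)) {x : E}
    (hs : Module.finrank ℝ (Submodule.span ℝ (Set.range fun k => fderiv ℝ (F k) x)) =
      Fintype.card κ)
    {Z : E → ℝ} (hZ : DifferentiableAt ℝ Z x) {g : (κ → ℝ) → ℝ}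
    (hg : ∀ y, Z y = g fun k => F k y) :
    fderiv ℝ Z x ∈ Submodule.span ℝ (Set.range fun k => fderiv ℝ (F k) x) := by
  have : CompleteSpace E := FiniteDimensional.complete ℝ E
  let Φ : E → κ → ℝ := fun y k => F k y
  have hΦ : ContDiff ℝ 1 Φ := contDiff_pi.2 hF
  have hΦs : HasStrictFDerivAt Φ (fderiv ℝ Φ x) x := hΦ.contDiffAt.hasStrictFDerivAt (by simp)
  set D := fderiv ℝ Φ x
  have hD : ∀ k w, D w k = fderiv ℝ (F k) x w := fun k w =>
    congrArg (fun L : E →L[ℝ] ℝ => L w) (hasFDerivAt_pi'.1 hΦs.hasFDerivAt k).fderiv.symm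
  have hDp : (D : E →ₗ[ℝ] κ → ℝ) = LinearMap.pi fun k => (fderiv ℝ (F k) x : E →ₗ[ℝ] ℝ) :=
    LinearMap.ext fun w => funext fun k => hD k w
  have hsurj : LinearMap.range (D : E →ₗ[ℝ] κ → ℝ) = ⊤ := by
    apply Submodule.eq_top_of_finrank_eq
    rw [hDp, finrank_range_pi_eq_finrank_span, hs, Module.finrank_fintype_fun_eq_card]
  obtain ⟨L, hL⟩ := (D : E →ₗ[ℝ] κ → ℝ).exists_rightInverse_of_surjective hsurj
  let L' : (κ → ℝ) →L[ℝ] E := LinearMap.toContinuousLinearMap L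
  have hDL : ∀ v, D (L' v) = v := fun v => congrArg (fun T : (κ → ℝ) →ₗ[ℝ] κ → ℝ => T v) hL
  -- The restriction of `Φ` to the affine slice through `x` along a right inverse of `D`: its
  -- derivative at `0` is the identity, so it has a local inverse `σ`.
  let G : (κ → ℝ) → κ → ℝ := fun v => Φ (x + L' v)
  have hG : HasStrictFDerivAt G
      ((ContinuousLinearEquiv.refl ℝ (κ → ℝ) : (κ → ℝ) ≃L[ℝ] κ → ℝ) : (κ → ℝ) →L[ℝ] κ → ℝ) 0 := by
    have h1 : HasStrictFDerivAt (fun v : κ → ℝ => x + L' v) L' 0 :=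
      L'.hasStrictFDerivAt.const_add x
    have h2 : HasStrictFDerivAt Φ D (x + L' 0) := by rwa [map_zero, add_zero]
    refine (h2.comp 0 h1).congr_fderiv ?_
    exact ContinuousLinearMap.ext fun v => hDL v
  have hG0 : G 0 = Φ x := by simp only [G, map_zero, add_zero]
  set σ := hG.localInverse
  have hσ : HasFDerivAt σ _ (Φ x) := hG0 ▸ hG.to_localInverse.hasFDerivAt
  have hσ0 : σ (Φ x) = 0 := by rw [← hG0]; exact hG.localInverse_apply_image
  have hσr : ∀ᶠ v in nhds (Φ x), G (σ v) = v := hG0 ▸ hG.eventually_right_inverse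
  -- Since `Z` depends on `Φ` alone, `y` may be replaced by the slice point with the same value of
  -- `Φ`. The derivative of `Z` then factors through `D`, and no regularity of `g` is needed.
  have hev : ∀ᶠ y in nhds x, Z y = Z (x + L' (σ (Φ y))) := by
    filter_upwards [hΦ.continuous.continuousAt.eventually hσr] with y hy
    rw [hg, hg]
    exact congrArg g hy.symm
  have hin : HasFDerivAt (fun y => x + L' (σ (Φ y))) _ x :=
    (L'.hasFDerivAt.comp x (hσ.comp x hΦs.hasFDerivAt)).const_add x
  have hZ' : HasFDerivAt Z (fderiv ℝ Z x) (x + L' (σ (Φ x))) := by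
    rw [hσ0, map_zero, add_zero]; exact hZ.hasFDerivAt
  have hcomp := (hZ'.comp x hin).congr_of_eventuallyEq hev
  refine mem_span_of_forall_apply_eq_zero fun w hw => ?_
  have hDw : D w = 0 := funext fun k => (hD k w).trans (hw k)
  rw [hcomp.fderiv]
  simp [hDw]

end functionals

/-! ### Counting pairs and the rank of `B^λ`. -/

theorem sum_product_symm {α : Type*} [LinearOrder α] (s : Finset α) {g : α → α → ℕ}
    (hg : ∀ x y, g x y = g y x) :
    ∑ x ∈ s, ∑ y ∈ s, g x y =
      ∑ x ∈ s, g x x + 2 * ∑ p ∈ (s ×ˢ s).filter (fun p => p.1 < p.2), g p.1 p.2 := by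
  have h1 : ∑ p ∈ s ×ˢ s, g p.1 p.2 = ∑ p ∈ s ×ˢ s, (if p.1 = p.2 then g p.1 p.2 else 0) +
      (∑ p ∈ s ×ˢ s, (if p.1 < p.2 then g p.1 p.2 else 0) +
        ∑ p ∈ s ×ˢ s, (if p.2 < p.1 then g p.1 p.2 else 0)) := by
    rw [← Finset.sum_add_distrib, ← Finset.sum_add_distrib]
    refine Finset.sum_congr rfl fun p _ => ?_
    rcases lt_trichotomy p.1 p.2 with h | h | h
    · simp [h, h.ne, h.not_gt]
    · simp [h]
    · simp [h, h.ne', h.not_gt]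
  have h2 : ∑ p ∈ s ×ˢ s, (if p.2 < p.1 then g p.1 p.2 else 0) =
      ∑ p ∈ s ×ˢ s, (if p.1 < p.2 then g p.1 p.2 else 0) := by
    rw [Finset.sum_product, Finset.sum_product_right]
    refine Finset.sum_congr rfl fun x _ => Finset.sum_congr rfl fun y _ => ?_
    simp only [hg x y]
  have h3 : ∑ p ∈ s ×ˢ s, (if p.1 = p.2 then g p.1 p.2 else 0) = ∑ x ∈ s, g x x := by
    rw [Finset.sum_product]
    refine Finset.sum_congr rfl fun x hx => ?_
    rw [Finset.sum_ite_eq, if_pos hx]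
  rw [← Finset.sum_product', h1, h2, h3, Finset.sum_filter]
  ring

section
variable {n : ℕ} (lam : Fin n → ℝ)

theorem sum_mult : ∑ μ ∈ moments lam, mult lam μ = n := by
  have := Finset.card_eq_sum_card_image lam Finset.univ
  rw [Finset.card_univ, Fintype.card_fin] at this
  exact this.symm

theorem sq_eq_sum_mult_sq : n ^ 2 = ∑ μ ∈ moments lam, mult lam μ ^ 2 + 2 * pairSum lam := by
  have h := sum_product_symm (moments lam) (g := fun μ ν => mult lam μ * mult lam ν)
    fun _ _ => mul_comm _ _
  rw [← Finset.sum_mul_sum, sum_mult] at h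
  rw [sq, h, pairSum]
  simp only [sq]

/-- The number of pairs `i < j` with `λ_i = λ_j`. -/
theorem sum_mult_sq : ∑ μ ∈ moments lam, mult lam μ ^ 2 =
    n + 2 * Fintype.card {r : SOPair n // lam r.1.1 = lam r.1.2} := by
  have h := sum_product_symm (Finset.univ : Finset (Fin n))
    (g := fun i j => if lam i = lam j then 1 else 0) fun i j => by simp only [eq_comm]
  have h1 : ∑ i, ∑ j, (if lam i = lam j then 1 else 0) = ∑ μ ∈ moments lam, mult lam μ ^ 2 := by
    have h2 : ∀ i, ∑ j, (if lam i = lam j then 1 else 0) = mult lam (lam i) := by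
      intro i
      rw [mult, Finset.card_filter]
      simp only [eq_comm]
    simp only [h2]
    rw [moments, ← Finset.sum_fiberwise_of_maps_to
      (fun i _ => Finset.mem_image_of_mem lam (Finset.mem_univ i))]
    refine Finset.sum_congr rfl fun μ _ => ?_
    rw [Finset.sum_congr rfl fun i hi => by rw [(Finset.mem_filter.1 hi).2], Finset.sum_const, sq]
    rfl
  rw [← h1, h]
  congr 1
  · simp
  · congr 1
    rw [← Finset.sum_filter, Finset.filter_filter, Finset.sum_const, smul_eq_mul, mul_one,
      Finset.univ_product_univ, ← Fintype.card_subtype]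
    exact Fintype.card_congr
      { toFun := fun p => ⟨⟨p.1, p.2.1⟩, p.2.2⟩
        invFun := fun r => ⟨r.1.1, r.1.2, r.2⟩
        left_inv := fun _ => rfl
        right_inv := fun _ => rfl }

theorem card_SOPair (n : ℕ) : n ^ 2 = n + 2 * Fintype.card (SOPair n) := by
  have h := sum_product_symm (Finset.univ : Finset (Fin n)) (g := fun _ _ => 1) fun _ _ => rfl
  simp only [Finset.sum_const, Finset.card_univ, Fintype.card_fin, smul_eq_mul, mul_one,
    Finset.univ_product_univ] at h
  rw [sq, h, Fintype.card_subtype]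

theorem finrank_blockModel : Module.finrank ℝ (blockModel lam) =
    Fintype.card {r : SOPair n // lam r.1.1 = lam r.1.2} := by
  have h1 : LinearIndependent ℝ fun r : {r : SOPair n // lam r.1.1 = lam r.1.2} =>
      (Pi.single r.1 1 : SOModel n) :=
    (Pi.linearIndependent_single_one (SOPair n) ℝ).comp Subtype.val Subtype.val_injective
  have h2 : (Set.range fun r : {r : SOPair n // lam r.1.1 = lam r.1.2} =>
      (Pi.single r.1 1 : SOModel n)) = {a | ∃ r, lam r.1.1 = lam r.1.2 ∧ a = Pi.single r 1} := by
    ext a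
    constructor
    · rintro ⟨r, rfl⟩; exact ⟨r.1, r.2, rfl⟩
    · rintro ⟨r, hr, rfl⟩; exact ⟨⟨r, hr⟩, rfl⟩
  rw [← finrank_span_eq_card h1, h2, span_single_eq_blockModel]

/-- The indices of the functions of `B^λ`. -/
abbrev BIndex : Type := {r : SOPair n // lam r.1.1 = lam r.1.2} ⊕ SOPair n

/-- The rank formula, in additive form to avoid truncated subtraction: both `n²` and `∑ q_i²` split
into a diagonal part and twice a number of pairs. -/
theorem card_BIndex : Fintype.card (BIndex lam) + pairSum lam + n = n ^ 2 := by
  have h1 := sq_eq_sum_mult_sq lam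
  have h2 := sum_mult_sq lam
  have h3 := card_SOPair n
  rw [Fintype.card_sum]
  omega

/-- The functions of `B^λ`. -/
def BFun : BIndex lam → CotSO n → ℝ :=
  Sum.elim (fun r m => PL m r.1.1.1 r.1.1.2) fun r m => PR m r.1.1 r.1.2

theorem range_BFun : Set.range (BFun lam) = BSet lam := by
  ext f
  constructor
  · rintro ⟨r | r, rfl⟩
    · exact Or.inl ⟨_, _, r.1.2, r.2, rfl⟩
    · exact Or.inr ⟨_, _, r.2, rfl⟩
  · rintro (⟨i, j, hij, hl, rfl⟩ | ⟨i, j, hij, rfl⟩)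
    · exact ⟨Sum.inl ⟨⟨(i, j), hij⟩, hl⟩, rfl⟩
    · exact ⟨Sum.inr ⟨(i, j), hij⟩, rfl⟩

theorem rankAt_eq_finrank_spanD (F : Set (CotSO n → ℝ)) (m : CotSO n) :
    rankAt F m = Module.finrank ℝ (spanD F m) := by
  have h := finrank_range_pi_eq_finrank_span (E := CotModel n)
    fun f : F => (dAt f.1 m : CotModel n →L[ℝ] ℝ)
  refine Eq.trans h ?_
  rw [spanD, Set.image_eq_range]
  rfl

/-- No nonzero element of the block-diagonal part of `so(n)` commutes with the momentum matrix. -/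
def IsBlockRegularAt (m : CotSO n) : Prop :=
  ∀ a ∈ blockModel lam, skewMat a * PL m = PL m * skewMat a → a = 0

variable {lam}

theorem finrank_spanD_BSet {m : CotSO n} (hm : IsBlockRegularAt lam m) :
    Module.finrank ℝ (spanD (BSet lam) m) = Fintype.card (BIndex lam) := by
  rw [spanD_BSet, finrank_sup_covector m (liePoisson_antisymm _)
    fun a ha hk => hm a ha (mem_ker_liePoisson.1 hk), finrank_blockModel,
    Module.finrank_fintype_fun_eq_card, Fintype.card_sum]

theorem almostEverywhere_rankAt_BSet (hu : 1 < (moments lam).card) :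
    AlmostEverywhere fun m : CotSO n => rankAt (BSet lam) m = Fintype.card (BIndex lam) :=
  (almostEverywhere_block_commute hu).mono fun m hm => by
    rw [rankAt_eq_finrank_spanD, finrank_spanD_BSet hm]

end

/-! ### The centrality of `B^λ`. -/

section
variable {n : ℕ} {lam : Fin n → ℝ}

variable (lam) in
/-- The indices of the functions of `Z^λ`. -/
abbrev ZIndex : Type :=
  Fin (Fintype.card (Fin n) / 2) ⊕ Σ μ : moments lam, Fin (Fintype.card {i // lam i = μ.1} / 2)

theorem card_ZIndex : Fintype.card (ZIndex lam) = zNumber lam := by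
  simp only [Fintype.card_sum, Fintype.card_fin, Fintype.card_sigma, card_moment, zNumber]
  rw [Finset.sum_coe_sort (moments lam) fun μ => mult lam μ / 2]

variable (lam) in
/-- The functions of `Z^λ`. -/
def ZFun : ZIndex lam → CotSO n → ℝ :=
  Sum.elim (fun i m => casimir (i + 1) ((PL m).submatrix id id))
    fun x m => casimir (x.2 + 1) ((PL m).submatrix (momentIncl lam x.1) (momentIncl lam x.1))

variable (lam) in
/-- The gradients of the functions of `Z^λ`. -/
def ZVec (m : CotSO n) : ZIndex lam → SOModel n :=
  Sum.elim (casimirVec id m) fun x => casimirVec (momentIncl lam x.1) m x.2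

theorem dAt_ZFun (m : CotSO n) (k : ZIndex lam) :
    dAt (ZFun lam k) m = covector m (liePoisson (covec m)) (ZVec lam m k) := by
  rcases k with i | x
  · exact dAt_casimir m id _
  · exact dAt_casimir m (momentIncl lam x.1) _

theorem ZVec_mem (m : CotSO n) (k : ZIndex lam) :
    ZVec lam m k ∈ radicalOn (liePoisson (covec m)) (blockModel lam) ⊔
      LinearMap.ker (liePoisson (covec m)) := by
  rcases k with i | x
  · exact Submodule.mem_sup_right (ker_liePoisson_ge m (Submodule.subset_span ⟨i, rfl⟩))
  · exact Submodule.mem_sup_left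
      (span_casimirVec_le_radicalOn m x.1.1 (Submodule.subset_span ⟨x.2, rfl⟩))

theorem span_ZVec (m : CotSO n) : Submodule.span ℝ (Set.range (ZVec lam m)) =
    Submodule.span ℝ (Set.range (casimirVec (id : Fin n → Fin n) m)) ⊔
        ⨆ μ ∈ moments lam, Submodule.span ℝ (Set.range (casimirVec (momentIncl lam μ) m)) := by
  rw [ZVec, Set.Sum.elim_range, Submodule.span_union]
  congr 1
  rw [Set.range_sigma_eq_iUnion_range, Submodule.span_iUnion, iSup_subtype]

/-- The diagonal block of a matrix with given coordinates. -/
def blockOf (lam : Fin n → ℝ) (μ : ℝ) :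
    SOModel n →ₗ[ℝ] Matrix {i // lam i = μ} {i // lam i = μ} ℝ where
  toFun a := (skewMat a).submatrix (momentIncl lam μ) (momentIncl lam μ)
  map_add' a b := by rw [skewMat_add]; rfl
  map_smul' c a := by rw [skewMat_smul]; rfl

theorem blockOf_casimirVec_self (m : CotSO n) (μ : ℝ) (i) :
    blockOf lam μ (casimirVec (momentIncl lam μ) m i) =
      casimirGrad ((PL m).submatrix (momentIncl lam μ) (momentIncl lam μ)) (i + 1) :=
  submatrix_casimirVec Subtype.val_injective (casimirGrad_transpose _ _)

theorem blockOf_casimirVec_of_ne (m : CotSO n) {μ ν : ℝ} (h : μ ≠ ν) (i) :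
    blockOf lam μ (casimirVec (momentIncl lam ν) m i) = 0 := by
  ext k l
  change skewMat (skewCoord (extendMat (momentIncl lam ν) _)) k.1 l.1 = 0
  rw [skewMat_skewCoord (by rw [extendMat_transpose, casimirGrad_transpose, extendMat_neg])]
  exact extendMat_momentIncl_eq_zero lam ν _ fun e => h (k.2.symm.trans e.1)

/-- Restriction to the block of `μ` kills the gradients of all other blocks, which reduces
independence to a single cyclic block. -/
theorem linearIndependent_block_casimirVec {m : CotSO n} (hm : IsCyclicAt lam m) :
    LinearIndependent ℝ fun x : Σ μ : moments lam, Fin (Fintype.card {i // lam i = μ.1} / 2) =>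
      casimirVec (momentIncl lam x.1) m x.2 := by
  rw [Fintype.linearIndependent_iff]
  rintro g hg ⟨μ, i⟩
  rw [Fintype.sum_sigma] at hg
  have h1 := congrArg (blockOf lam μ) hg
  simp only [map_sum, map_smul, map_zero] at h1
  rw [Finset.sum_eq_single μ] at h1
  · simp only [blockOf_casimirVec_self] at h1
    exact Fintype.linearIndependent_iff.1 ((hm.2 μ μ.2).linearIndependent_casimirGrad
      (transpose_submatrix_PL (momentIncl lam μ) m)) (fun i => g ⟨μ, i⟩) h1 i
  · intro ν _ hν
    refine Finset.sum_eq_zero fun j _ => ?_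
    rw [blockOf_casimirVec_of_ne m fun e => hν (Subtype.ext e.symm), smul_zero]
  · exact fun h => absurd (Finset.mem_univ _) h

theorem linearIndependent_casimirVec_id {m : CotSO n} (hm : IsCyclicMat ((PL m).submatrix id id)) :
    LinearIndependent ℝ (casimirVec (id : Fin n → Fin n) m) := by
  refine LinearIndependent.of_comp (skewMatₗ n) ?_
  have h : skewMatₗ n ∘ casimirVec id m =
      fun i : Fin (Fintype.card (Fin n) / 2) =>
        casimirGrad ((PL m).submatrix id id) ((i : ℕ) + 1) := by
    funext i
    change skewMat (skewCoord (extendMat id _)) = _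
    rw [extendMat_id, skewMat_skewCoord (casimirGrad_transpose _ _)]
  rw [h]
  exact hm.linearIndependent_casimirGrad (transpose_submatrix_PL id m)

/-- The gradients from `C̄` lie in `ker c` and those from `C^{Lλ}` in `H`; regularity says that
these subspaces meet only in zero. -/
theorem linearIndependent_dAt_ZFun {m : CotSO n} (hm : IsCyclicAt lam m)
    (hr : IsBlockRegularAt lam m) : LinearIndependent ℝ fun k => dAt (ZFun lam k) m := by
  have h : LinearIndependent ℝ (ZVec lam m) := by
    refine LinearIndependent.sum_type (linearIndependent_casimirVec_id hm.1)
      (linearIndependent_block_casimirVec hm) ?_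
    rw [Submodule.disjoint_def]
    intro a h1 h2
    refine hr a ?_ (mem_ker_liePoisson.1 (ker_liePoisson_ge m h1))
    refine (Submodule.span_le.2 ?_ : _ ≤ blockModel lam) h2
    rintro _ ⟨x, rfl⟩
    exact extendModel_mem_blockModel _ _
  simp only [dAt_ZFun]
  exact h.map' (covector m (liePoisson (covec m))) (LinearMap.ker_eq_bot.2 (covector_injective m))

theorem finrank_spanD_ZSet_le (hu : 1 < (moments lam).card) (m : CotSO n) :
    Module.finrank ℝ (spanD (ZSet lam) m) ≤ zNumber lam := by
  rw [spanD_ZSet hu, ← span_ZVec, ← card_ZIndex]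
  exact (Submodule.finrank_map_le _ _).trans (finrank_range_le_card _)

theorem PR_eq_conj (m : CotSO n) : PR m = m.1.1 * PL m * m.1.1ᵀ := by
  have hs : (m.1.1 * PL m * m.1.1ᵀ)ᵀ = -(m.1.1 * PL m * m.1.1ᵀ) := by
    have := conj_transpose_neg m.1.1ᵀ (PL_transpose m)
    rwa [Matrix.transpose_transpose] at this
  ext i j
  have hij : (m.1.1 * PL m * m.1.1ᵀ) j i = -(m.1.1 * PL m * m.1.1ᵀ) i j :=
    congrFun (congrFun hs i) j
  have ht : (m.1.1ᵀ * basisD i j * m.1.1 * PL m).trace =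
      (basisD i j * (m.1.1 * PL m * m.1.1ᵀ)).trace := by
    rw [Matrix.mul_assoc, Matrix.mul_assoc, Matrix.trace_mul_comm, Matrix.mul_assoc]
  rw [PR_apply, covec_eq_trace, skewMat_skewCoord (conj_transpose_neg _ (basisD_transpose i j)),
    ht, trace_basisD_mul, hij]
  ring

/-- This makes `C̄` consist of functions of `B^λ`, although the entries of `P^L` outside the blocks
do not belong to `B^λ`. -/
theorem charpoly_PR (m : CotSO n) : (PR m).charpoly = (PL m).charpoly := by
  rw [PR_eq_conj, Matrix.mul_assoc, Matrix.charpoly_mul_comm, Matrix.mul_assoc,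
    SOGroup.transpose_mul_self, Matrix.mul_one]

theorem PR_transpose (m : CotSO n) : (PR m)ᵀ = -PR m := by
  have := conj_transpose_neg m.1.1ᵀ (PL_transpose m)
  rwa [Matrix.transpose_transpose, ← PR_eq_conj] at this

theorem skew_ext {A B : Matrix (Fin n) (Fin n) ℝ} (hA : Aᵀ = -A) (hB : Bᵀ = -B) {i j : Fin n}
    (h : ∀ k l, k < l → (k = i ∧ l = j ∨ k = j ∧ l = i) → A k l = B k l) : A i j = B i j := by
  have hA' : ∀ i j, A j i = -A i j := fun i j => congrFun (congrFun hA i) j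
  have hB' : ∀ i j, B j i = -B i j := fun i j => congrFun (congrFun hB i) j
  rcases lt_trichotomy i j with hij | rfl | hij
  · exact h i j hij (Or.inl ⟨rfl, rfl⟩)
  · linarith [hA' i i, hB' i i]
  · rw [hA' j i, hB' j i, h j i hij (Or.inr ⟨rfl, rfl⟩)]

theorem ZFun_eq_of_BSet_eq {m m' : CotSO n} (h : ∀ f ∈ BSet lam, f m = f m') (k : ZIndex lam) :
    ZFun lam k m = ZFun lam k m' := by
  rcases k with i | x
  · have h1 : PR m = PR m' := by
      ext i j
      exact skew_ext (PR_transpose m) (PR_transpose m') fun k l hkl _ =>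
        h _ (Or.inr ⟨k, l, hkl, rfl⟩)
    have h2 : (PL m).charpoly = (PL m').charpoly := by rw [← charpoly_PR, ← charpoly_PR, h1]
    simp only [ZFun, Sum.elim_inl, casimir, Matrix.submatrix_id_id, h2]
  · have h1 : (PL m).submatrix (momentIncl lam x.1) (momentIncl lam x.1) =
        (PL m').submatrix (momentIncl lam x.1) (momentIncl lam x.1) := by
      ext i j
      refine skew_ext (PL_transpose m) (PL_transpose m') fun k l hkl hk =>
        h _ (Or.inl ⟨k, l, hkl, ?_, rfl⟩)
      have hi := i.2
      have hj := j.2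
      rcases hk with ⟨rfl, rfl⟩ | ⟨rfl, rfl⟩
      · rw [hi, hj]
      · rw [hi, hj]
    simp only [ZFun, Sum.elim_inr, h1]

/-- Only the inclusion of the gradients in `rad(c|_H) + ker c` is used, and this holds at every
point, so the bracket vanishes on all of `M`. -/
theorem poissonBracket_ZFun (k : ZIndex lam) {f : CotSO n → ℝ} (hf : f ∈ BSet lam) (m : CotSO n) :
    poissonBracket (ZFun lam k) f m = 0 := by
  have h : dAt (ZFun lam k) m ∈ spanD (BSet lam) m ⊓ skewOrth (spanD (BSet lam) m) := by
    rw [spanD_BSet, inf_skewOrth_eq m (liePoisson_antisymm _), dAt_ZFun]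
    exact Submodule.mem_map_of_mem (ZVec_mem m k)
  exact h.2 _ (Submodule.subset_span ⟨f, hf, rfl⟩)

theorem contMDiff_ZFun (k : ZIndex lam) : ContMDiff (cotI n) 𝓘(ℝ, ℝ) ∞ (ZFun lam k) := by
  refine contMDiff_of_cotPt fun m => ?_
  rcases k with i | x
  · exact contDiff_casimir_cotPt m id _
  · exact contDiff_casimir_cotPt m (momentIncl lam x.1) _

theorem hasCentralFunctions_zNumber (hu : 1 < (moments lam).card) :
    HasCentralFunctions (BSet lam) (zNumber lam) := by
  let e : Fin (zNumber lam) ≃ ZIndex lam := (Fintype.equivFinOfCardEq card_ZIndex).symm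
  refine ⟨fun j => ZFun lam (e j), fun j => contMDiff_ZFun _, fun j => ?_, ?_,
    fun j f hf m => poissonBracket_ZFun _ hf m⟩
  · have h : Function.FactorsThrough (ZFun lam (e j)) fun m (f : BSet lam) => f.1 m :=
      fun m m' hm => ZFun_eq_of_BSet_eq (fun f hf => congrFun hm ⟨f, hf⟩) _
    obtain ⟨g, hg⟩ := (Function.factorsThrough_iff _).1 h
    exact ⟨g, fun m => congrFun hg m⟩
  · refine ((almostEverywhere_isCyclicAt lam).and (almostEverywhere_block_commute hu)).mono
      fun m hm => ?_
    exact (linearIndependent_dAt_ZFun hm.1 hm.2).comp e e.injective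

/-- At a regular point, the differential of a function of the elements of `B^λ` is a combination
of their differentials. -/
theorem dAt_mem_spanD_BSet {m : CotSO n} (hm : IsBlockRegularAt lam m) {Z : CotSO n → ℝ}
    (hZ : ContMDiff (cotI n) 𝓘(ℝ, ℝ) ∞ Z) {g : (BSet lam → ℝ) → ℝ}
    (hg : ∀ m, Z m = g fun f => f.1 m) : dAt Z m ∈ spanD (BSet lam) m := by
  have hF : ∀ k, ContDiff ℝ 1 fun z => BFun lam k (cotPt m z) := by
    rintro (r | r)
    · change ContDiff ℝ 1 fun z => PL (cotPt m z) r.1.1.1 r.1.1.2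
      rw [PL_cotPt_eq]; exact contDiff_momentumChart _ _ _
    · change ContDiff ℝ 1 fun z => PR (cotPt m z) r.1.1 r.1.2
      rw [PR_cotPt_eq]; exact contDiff_momentumChart _ _ _
  have hd : ∀ k, fderiv ℝ (fun z => BFun lam k (cotPt m z)) (0, covec m) = dAt (BFun lam k) m :=
    fun k => (dAt_eq_fderiv ((hF k).differentiable (by simp) _)).symm
  have hspan : Submodule.span ℝ
      (Set.range fun k => fderiv ℝ (fun z => BFun lam k (cotPt m z)) (0, covec m)) =
      spanD (BSet lam) m := by
    simp only [hd]
    rw [spanD, ← range_BFun, ← Set.range_comp]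
    rfl
  have hZd := differentiableAt_cotPt hZ m
  have hex : ∀ f : BSet lam, f.1 ∈ Set.range (BFun lam) := fun f => by
    rw [range_BFun]; exact f.2
  choose ix hix using hex
  rw [dAt_eq_fderiv hZd, ← hspan]
  refine fderiv_mem_span_of_factor hF ?_ hZd (g := fun v => g fun f => v (ix f)) fun z => ?_
  · rw [hspan]; exact finrank_spanD_BSet hm
  · rw [hg]
    simp only [hix]

/-- Orthogonality to the generators extends to their span by linearity of the Poisson tensor in its
second argument. -/
theorem mem_skewOrth_spanD {F : Set (CotSO n → ℝ)} {m : CotSO n} {α : CotangentAt m}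
    (h : ∀ f ∈ F, poissonTensor m α (dAt f m) = 0) : α ∈ skewOrth (spanD F m) := by
  rw [mem_skewOrth]
  intro β hβ
  induction hβ using Submodule.span_induction with
  | mem β hβ =>
    obtain ⟨f, hf, rfl⟩ := hβ
    exact h f hf
  | zero =>
    have h' : ∀ v, (0 : CotangentAt m) v = 0 := fun _ => rfl
    simp [poissonTensor, h']
  | add β β' _ _ h1 h2 =>
    have h' : ∀ v, (β + β') v = β v + β' v := fun _ => rfl
    rw [← add_zero (0 : ℝ)]
    nth_rewrite 1 [← h1]
    rw [← h2, poissonTensor, poissonTensor, poissonTensor, ← Finset.sum_add_distrib]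
    simp only [h']
    exact Finset.sum_congr rfl fun r _ => by ring
  | smul c β _ h1 =>
    have h' : ∀ v, (c • β) v = c * β v := fun _ => rfl
    rw [← mul_zero c, ← h1, poissonTensor, poissonTensor, Finset.mul_sum]
    simp only [h']
    exact Finset.sum_congr rfl fun r _ => by ring

/-- A single generic point suffices: there the independent differentials of the central functions
all lie in `Span dZ^λ`, whose dimension is at most `z^λ`. -/
theorem le_zNumber_of_hasCentralFunctions (hu : 1 < (moments lam).card) {k : ℕ}
    (h : HasCentralFunctions (BSet lam) k) : k ≤ zNumber lam := by
  obtain ⟨Z, hZ, hg, hi, hb⟩ := h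
  obtain ⟨m, ⟨hc, hr⟩, hm⟩ := (((almostEverywhere_isCyclicAt lam).and
    (almostEverywhere_block_commute hu)).and hi).exists
  have hmem : ∀ j, dAt (Z j) m ∈ spanD (ZSet lam) m := by
    intro j
    obtain ⟨g, hg⟩ := hg j
    rw [spanD_ZSet_eq_inf hc]
    refine ⟨dAt_mem_spanD_BSet hr (hZ j) hg, ?_⟩
    exact mem_skewOrth_spanD fun f hf => hb j f hf m
  have : FiniteDimensional ℝ (CotangentAt m) :=
    inferInstanceAs (FiniteDimensional ℝ (CotModel n →L[ℝ] ℝ))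
  have h1 := finrank_span_eq_card hm
  rw [Fintype.card_fin] at h1
  rw [← h1]
  refine le_trans (Submodule.finrank_mono (Submodule.span_le.2 ?_)) (finrank_spanD_ZSet_le hu m)
  rintro _ ⟨j, rfl⟩
  exact hmem j

theorem isCentrality_BSet (hu : 1 < (moments lam).card) :
    IsCentrality (BSet lam) (zNumber lam) :=
  ⟨hasCentralFunctions_zNumber hu, fun _ h => le_zNumber_of_hasCentralFunctions hu h⟩

end

/-! ### Arithmetic of the multiplicities and the final assembly. -/

theorem sum_half_mult {n : ℕ} (lam : Fin n → ℝ) :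
    2 * ∑ μ ∈ moments lam, mult lam μ / 2 + oddCount lam = n := by
  have h : oddCount lam = ∑ μ ∈ moments lam, mult lam μ % 2 := by
    rw [oddCount, Finset.card_filter]
    refine Finset.sum_congr rfl fun μ _ => ?_
    split_ifs with ho
    · exact (Nat.odd_iff.1 ho).symm
    · exact (Nat.even_iff.1 (Nat.not_odd_iff_even.1 ho)).symm
  rw [h, Finset.mul_sum, ← Finset.sum_add_distrib]
  simp only [Nat.div_add_mod]
  exact sum_mult lam

/-- With `S = ∑ [q/2]` the relation `2 S + d(q) = n` makes `d(q)` congruent to `n` modulo `2`, so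
`[n/2] = S + [d(q)/2]`. -/
theorem zNumber_add {n : ℕ} (lam : Fin n → ℝ) : zNumber lam + (oddCount lam + 1) / 2 = n := by
  have h := sum_half_mult lam
  rw [zNumber]
  omega

theorem mainTheorem3 (n : ℕ) (lam : Fin n → ℝ) (hlam : ∀ i, 0 < lam i) :
    AlmostEverywhere (fun m : CotSO n =>
      spanD (ZSet lam) m = spanD (BSet lam) m ⊓ skewOrth (spanD (BSet lam) m)) ∧
    (1 < (moments lam).card →
      AlmostEverywhere (fun m : CotSO n =>
        (rankAt (BSet lam) m : ℚ) = (n : ℚ) * (n - 1) - pairSum lam) ∧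
      (n : ℚ) * (n - 1) - pairSum lam =
        ((n : ℚ) ^ 2 - 2 * n + ∑ μ ∈ moments lam, (mult lam μ : ℚ) ^ 2) / 2 ∧
      IsCentrality (BSet lam) (zNumber lam) ∧
      (zNumber lam : ℤ) = (n : ℤ) - ((oddCount lam + 1) / 2 : ℕ) ∧
      IsDefect (BSet lam) ((pairSum lam : ℤ) - zNumber lam) ∧
      (pairSum lam : ℚ) - zNumber lam =
        ((n : ℚ) ^ 2 - 2 * n - ∑ μ ∈ moments lam, (mult lam μ : ℚ) ^ 2) / 2 +
          ((oddCount lam + 1) / 2 : ℕ)) := by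
  refine ⟨(almostEverywhere_isCyclicAt lam).mono fun m hm => spanD_ZSet_eq_inf hm, fun hu => ?_⟩
  have hsq : (n : ℚ) ^ 2 = ∑ μ ∈ moments lam, (mult lam μ : ℚ) ^ 2 + 2 * pairSum lam := by
    exact_mod_cast sq_eq_sum_mult_sq lam
  have hz := zNumber_add lam
  have hzq : (zNumber lam : ℚ) + ((oddCount lam + 1) / 2 : ℕ) = n := by exact_mod_cast hz
  refine ⟨(almostEverywhere_rankAt_BSet hu).mono fun m hm => ?_, by linarith,
    isCentrality_BSet hu, by omega,
    ⟨Fintype.card (BIndex lam), zNumber lam, almostEverywhere_rankAt_BSet hu,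
      isCentrality_BSet hu, ?_⟩, by linarith⟩
  · rw [hm]
    have : (Fintype.card (BIndex lam) : ℚ) + pairSum lam + n = (n : ℚ) ^ 2 := by
      exact_mod_cast card_BIndex lam
    linarith
  · have : (Fintype.card (BIndex lam) : ℤ) + pairSum lam + n = (n : ℤ) ^ 2 := by
      exact_mod_cast card_BIndex lam
    linarith
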